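/- Let $T=\{x,y\}^*$ be the binary rooted tree, let $\mathrm{Aut}(T)$ act on $T$ from the right, and for $g,h\in\mathrm{Aut}(T)$ let $\langle\!\langle g,h\rangle\!\rangle\in\mathrm{Aut}(T)$ be the automorphism acting as $g$ on the subtree below $x$ and as $h$ on the subtree below $y$; for subgroups $H,K\le\mathrm{Aut}(T)$ write $H\times K=\{\langle\!\langle h,k\rangle\!\rangle : h\in H,\ k\in K\}\le\mathrm{Aut}(T)$. Let $a,b\in\mathrm{Aut}(T)$ be defined recursively by $$a=\langle\!\langle b,1\rangle\!\rangle\,(x,y),\qquad b=\langle\!\langle a,1\rangle\!\rangle,$$ where $(x,y)$ exchanges the two subtrees below the root, and let $G=\langle a,b\rangle$. Write $[u,v]=u^{-1}v^{-1}uv$ and $c=[a,b]$, $d=[c,a]$, $e=[d,a]$. Let $\gamma_1=G$, $\gamma_{n+1}=[\gamma_n,G]$ be the lower central series of $G$, and let $\Gamma_n$ $(n\ge 1)$ be its lower $2$-central series, defined by $\Gamma_1=G$ and $$\Gamma_{n+1}=[G,\Gamma_n]\,\bigl(\Gamma_{\lceil (n+1)/2\rceil}\bigr)^2\qquad(n\ge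 1),$$ where $H^2$ denotes the subgroup generated by the squares of the elements of $H$. Then: 1. $G''=\gamma_3\times\gamma_3$ and $\gamma_3=(\gamma_3\times\gamma_3)\,\langle d,e\rangle$. 2. $\gamma_1/\gamma_2\cong\mathbb Z^2$, $\gamma_2/\gamma_3\cong\mathbb Z$, $\gamma_3/\gamma_4\cong\mathbb Z/4$, and $\gamma_n/\gamma_{n+1}$ is finite for every $n\ge 3$. 3. For every $n\ge 1$ the group $\Gamma_n/\Gamma_{n+1}$ is a finite elementary abelian $2$-group, and $$\dim_{\mathbb F_2}\Gamma_n/\Gamma_{n+1}=\begin{cases} i+2 & \text{if } n=2^i \text{ for some } i\ge 0,\\ \max\{\,i+1 : i\ge 0,\ 2^i\text{ divides } n\,\} & \text{otherwise.}\end{cases}$$ -/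

import Mathlib

open scoped Pointwise

namespace Basilica

/-- Rooted automorphisms of the binary rooted tree, whose vertices are the finite words in the
letters `x = false` and `y = true`: the automorphisms of the prefix order. -/
abbrev Aut : Type :=
  RelIso (fun u v : List Bool => u <+: v) (fun u v : List Bool => u <+: v)

/-- The automorphism group of the tree acting on the right: `g * h` is `g` followed by `h`. -/
abbrev RAut : Type := Autᵐᵒᵖ

/-- The right action of an automorphism on a vertex, `v ^ g`. -/
def act (v : List Bool) (g : RAut) : List Bool := g.unop v

theorem act_mul (v : List Bool) (g h : RAut) : act v (g * h) = act (act v g) h := rfl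

theorem aut_nil (g : Aut) : g [] = [] := by
  have h : g [] <+: g (g.symm []) := g.map_rel_iff.2 List.nil_prefix
  rw [RelIso.apply_symm_apply] at h
  exact List.prefix_nil.1 h

theorem ext_act {g h : RAut} (w : ∀ v, act v g = act v h) : g = h :=
  MulOpposite.unop_injective (RelIso.ext w)

/-- The map underlying `⟨g, h⟩`. -/
def pairFun (g h : List Bool → List Bool) : List Bool → List Bool
  | [] => []
  | false :: w => false :: g w
  | true :: w => true :: h w

/-- `⟨g, h⟩`: the automorphism acting as `g` on the subtree below `x` and as `h` on the
subtree below `y`. -/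
def pair (g h : RAut) : RAut := MulOpposite.op
  { toFun := pairFun g.unop h.unop
    invFun := pairFun g.unop.symm h.unop.symm
    left_inv := by
      rintro (_ | ⟨_ | _, w⟩) <;> simp [pairFun]
    right_inv := by
      rintro (_ | ⟨_ | _, w⟩) <;> simp [pairFun]
    map_rel_iff' := by
      rintro (_ | ⟨_ | _, u⟩) (_ | ⟨_ | _, v⟩) <;>
        simp [pairFun, List.cons_prefix_cons]
      · exact g.unop.map_rel_iff
      · exact h.unop.map_rel_iff }

/-- The map underlying the transposition of the two top subtrees. -/
def swapFun : List Bool → List Bool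
  | [] => []
  | i :: w => (!i) :: w

/-- The transposition `(x, y)` of the two top subtrees. -/
def swap : RAut := MulOpposite.op
  { toFun := swapFun
    invFun := swapFun
    left_inv := by rintro (_ | ⟨_ | _, w⟩) <;> simp [swapFun]
    right_inv := by rintro (_ | ⟨_ | _, w⟩) <;> simp [swapFun]
    map_rel_iff' := by
      rintro (_ | ⟨_ | _, u⟩) (_ | ⟨_ | _, v⟩) <;>
        simp [swapFun, List.cons_prefix_cons] }

/-- The embedding `(g, h) ↦ ⟨g, h⟩`. -/
def pairHom : RAut × RAut →* RAut where
  toFun p := pair p.1 p.2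
  map_one' := ext_act (by rintro (_ | ⟨_ | _, w⟩) <;> rfl)
  map_mul' _ _ := ext_act (by rintro (_ | ⟨_ | _, w⟩) <;> rfl)

/-- `H × K`, acting on the tree by `⟨h, k⟩` with `h ∈ H` and `k ∈ K`. -/
def prodSubgroup (H K : Subgroup RAut) : Subgroup RAut := (H.prod K).map pairHom

/-- `genFun false` is the action of `a` and `genFun true` is the action of `b`. -/
def genFun : Bool → List Bool → List Bool
  | _, [] => []
  | false, false :: w => true :: genFun true w
  | false, true :: w => false :: w
  | true, false :: w => false :: genFun false w
  | true, true :: w => true :: w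

/-- The inverse maps of `genFun`. -/
def genInv : Bool → List Bool → List Bool
  | _, [] => []
  | false, true :: w => false :: genInv true w
  | false, false :: w => true :: w
  | true, false :: w => false :: genInv false w
  | true, true :: w => true :: w

theorem genInv_genFun (s : Bool) (w : List Bool) : genInv s (genFun s w) = w := by
  induction w generalizing s with
  | nil => cases s <;> rfl
  | cons i w ih => cases s <;> cases i <;> simp [genFun, genInv, ih]

theorem genFun_genInv (s : Bool) (w : List Bool) : genFun s (genInv s w) = w := by
  induction w generalizing s with
  | nil => cases s <;> rfl
  | cons i w ih => cases s <;> cases i <;> simp [genFun, genInv, ih]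

theorem genFun_prefix (s : Bool) (u v : List Bool) :
    genFun s u <+: genFun s v ↔ u <+: v := by
  induction u generalizing s v with
  | nil => cases s <;> simp [genFun]
  | cons i u ih =>
    rcases v with _ | ⟨j, v⟩
    · cases s <;> cases i <;> simp [genFun]
    · cases s <;> cases i <;> cases j <;> simp [genFun, List.cons_prefix_cons, ih]

/-- The automorphism with underlying map `genFun s`. -/
def gen (s : Bool) : RAut := MulOpposite.op
  { toFun := genFun s
    invFun := genInv s
    left_inv := genInv_genFun s
    right_inv := genFun_genInv s
    map_rel_iff' := genFun_prefix s _ _ }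

/-- The generator `a = ⟨b, 1⟩ (x, y)`. -/
def a : RAut := gen false

/-- The generator `b = ⟨a, 1⟩`. -/
def b : RAut := gen true

theorem a_eq : a = pair b 1 * swap :=
  ext_act (by rintro (_ | ⟨_ | _, w⟩) <;> rfl)

theorem b_eq : b = pair a 1 :=
  ext_act (by rintro (_ | ⟨_ | _, w⟩) <;> rfl)

/-- The group `G = ⟨a, b⟩`. -/
def G : Subgroup RAut := Subgroup.closure {a, b}

/-- The commutator `[u, v] = u⁻¹ v⁻¹ u v`. -/
def comm {Γ : Type*} [Group Γ] (u v : Γ) : Γ := u⁻¹ * v⁻¹ * u * v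

/-- `c = [a, b]`. -/
def c : RAut := comm a b

/-- `d = [c, a]`. -/
def d : RAut := comm c a

/-- `e = [d, a]`. -/
def e : RAut := comm d a

/-- The lower central series `γ₁ = Γ`, `γₙ₊₁ = [γₙ, Γ]`, indexed from `1`
(with `γ₀ = Γ` as a dummy value). -/
def gamma (Γ : Type*) [Group Γ] (n : ℕ) : Subgroup Γ :=
  (⊤ : Subgroup Γ).lowerCentralSeries (n - 1)

instance gamma_normal (Γ : Type*) [Group Γ] (n : ℕ) : (gamma Γ n).Normal :=
  inferInstanceAs ((⊤ : Subgroup Γ).lowerCentralSeries (n - 1)).Normal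

/-- The subgroup `H²` generated by the squares of the elements of `H`. -/
def squares {Γ : Type*} [Group Γ] (H : Subgroup Γ) : Subgroup Γ :=
  Subgroup.closure {g | ∃ h ∈ H, g = h ^ 2}

instance squares_normal {Γ : Type*} [Group Γ] (H : Subgroup Γ) [hH : H.Normal] :
    (squares H).Normal := by
  have h : Group.conjugatesOfSet {g | ∃ h ∈ H, g = h ^ 2} = {g | ∃ h ∈ H, g = h ^ 2} := by
    refine Set.Subset.antisymm ?_ Group.subset_conjugatesOfSet
    intro x hx
    obtain ⟨_, ⟨h, hh, rfl⟩, hc⟩ := Group.mem_conjugatesOfSet_iff.1 hx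
    obtain ⟨k, rfl⟩ := isConj_iff.1 hc
    exact ⟨k * h * k⁻¹, hH.conj_mem h hh k, conj_pow.symm⟩
  have h' : squares H = Subgroup.normalClosure {g | ∃ h ∈ H, g = h ^ 2} := by
    rw [squares, Subgroup.normalClosure, h]
  rw [h']
  exact Subgroup.normalClosure_normal

/-- The lower `2`-central series `Γ₁ = Γ`, `Γₙ₊₁ = [Γ, Γₙ] (Γ_⌈(n+1)/2⌉)²`, indexed from `1`
(with `Γ₀ = Γ` as a dummy value). -/
def twoCentral (Γ : Type*) [Group Γ] : ℕ → Subgroup Γ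
  | 0 => ⊤
  | 1 => ⊤
  | n + 2 => ⁅(⊤ : Subgroup Γ), twoCentral Γ (n + 1)⁆ ⊔ squares (twoCentral Γ ((n + 3) / 2))

instance twoCentral_normal (Γ : Type*) [Group Γ] (n : ℕ) : (twoCentral Γ n).Normal := by
  induction n using Nat.strong_induction_on with
  | _ n ih =>
    match n, ih with
    | 0, _ => rw [twoCentral]; infer_instance
    | 1, _ => rw [twoCentral]; infer_instance
    | n + 2, ih =>
      rw [twoCentral]
      have h₁ := ih (n + 1) (by omega)
      have h₂ := ih ((n + 3) / 2) (by omega)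
      infer_instance

/-- The factor group `H / (H ∩ K)` for a normal subgroup `K`; it is `H / K` when `K ≤ H`. -/
abbrev Factor {Γ : Type*} [Group Γ] (H K : Subgroup Γ) : Type _ := H ⧸ K.subgroupOf H

end Basilica

open scoped commutatorElement

namespace Basilica

/-! ### Commutator calculus modulo a normal subgroup -/

section General

variable {Γ : Type*} [Group Γ]

/-! Everything follows from the recursion `a² = ⟨b, b⟩`, `b = ⟨a, 1⟩` by comparing coordinates. The
group `G'` is the normal closure of `c`, it contains `⟨c, 1⟩`, and its elements `⟨p, q⟩` satisfy `p
≡ aᵏ`, `q ≡ a⁻ᵏ` modulo `G'`. Hence brackets of such elements have both coordinates in `γ₃`, and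
conversely `⟨d, 1⟩` is a bracket of elements of `G'`, so `G'' = γ₃ × γ₃` (`second_derived`). The
quotient `γ₃ / G''` is free abelian on `d` and `f = ⟨c, c⁻¹⟩ ≡ d²e`; `b` acts trivially on it and
`a` by `d ↦ d⁻¹f`, `f ↦ f⁻¹` (`exists_coord`, `Coord.conjA`, `Coord.unique`). That `a, b` are
independent modulo `γ₂`, and `c` has infinite order modulo `γ₃`, is a 2-adic descent: a relation
forces another one between coordinates, with exponents halved (`ab_injective`, `C_injective`). The
character `x + 2y mod 4` of `dˣ fʸ` detects `γ₃ / γ₄`, and finiteness then propagates down the lower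
central series. For the 2-central series the orders of the factors are squeezed between two bounds.
Upper bound: `Γₙ` is generated by `γₙ`, `Γₙ₊₁` and squares from `Γ_⌈n/2⌉`
(`twoCentral_le_mixed_sup_squares`). Modulo `Γₙ₊₁` the group `γₙ` is cyclic of order at most 2,
generated by an explicit `zeta n` (`gamma_le_cyc`), and for even `n` the squares contribute at most
the order of `Γ_{n/2} / Γ_{n/2+1}`. This gives the recursion of `rank` (`relIndex_twoCentral_dvd`).
Lower bound: the subgroup `K i` contains `Γ` of index `2 ^ i + 1` (`twoCentral_le_K`). Normal forms
for `K i` and for `H i`, which contains `K i ∩ γ₃`, show that its index is at least `2 ^ (2 ^ (i +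
1) + i)` (`le_index_K`). This is the product of the upper bounds for `n ≤ 2 ^ i` (`sum_rank`), so
every upper bound is attained. -/

theorem commutatorElement_mem_iff (M : Subgroup Γ) [M.Normal] (g h : Γ) :
    ⁅g, h⁆ ∈ M ↔ Commute (g : Γ ⧸ M) (h : Γ ⧸ M) := by
  rw [← QuotientGroup.eq_one_iff, ← commutatorElement_eq_one_iff_commute]
  rfl

theorem comm_eq (g h : Γ) : comm g h = ⁅g⁻¹, h⁻¹⁆ := by
  simp [comm, commutatorElement_def]

theorem comm_mem_iff (M : Subgroup Γ) [M.Normal] (g h : Γ) :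
    comm g h ∈ M ↔ Commute (g : Γ ⧸ M) (h : Γ ⧸ M) := by
  rw [comm_eq, commutatorElement_mem_iff]
  simp

theorem comm_mem_iff' (M : Subgroup Γ) [M.Normal] (g h : Γ) : comm g h ∈ M ↔ ⁅g, h⁆ ∈ M := by
  rw [comm_mem_iff, commutatorElement_mem_iff]

theorem commutatorElement_mem_symm (M : Subgroup Γ) [M.Normal] {g h : Γ} (w : ⁅g, h⁆ ∈ M) :
    ⁅h, g⁆ ∈ M := by
  rw [commutatorElement_mem_iff] at w ⊢
  exact w.symm

theorem commutator_le_iff_commute (H K M : Subgroup Γ) [M.Normal] :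
    ⁅H, K⁆ ≤ M ↔ ∀ h ∈ H, ∀ k ∈ K, Commute (h : Γ ⧸ M) (k : Γ ⧸ M) := by
  simp_rw [Subgroup.commutator_le, commutatorElement_mem_iff]

/-- The elements commuting with all of `H` modulo `M`. -/
def centralizerMod (H M : Subgroup Γ) [M.Normal] : Subgroup Γ :=
  (Subgroup.centralizer (H.map (QuotientGroup.mk' M) : Set (Γ ⧸ M))).comap (QuotientGroup.mk' M)

theorem mem_centralizerMod {H M : Subgroup Γ} [M.Normal] {k : Γ} :
    k ∈ centralizerMod H M ↔ ∀ h ∈ H, ⁅h, k⁆ ∈ M := by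
  simp only [centralizerMod, Subgroup.mem_comap, Subgroup.mem_centralizer_iff, SetLike.mem_coe,
    Subgroup.mem_map, commutatorElement_mem_iff]
  constructor
  · intro w h hh
    exact w _ ⟨h, hh, rfl⟩
  · rintro w _ ⟨h, hh, rfl⟩
    exact w h hh

theorem commutator_le_iff_le_centralizerMod {H K M : Subgroup Γ} [M.Normal] :
    ⁅H, K⁆ ≤ M ↔ K ≤ centralizerMod H M := by
  rw [Subgroup.commutator_le]
  exact ⟨fun w k hk => mem_centralizerMod.2 fun h hh => w h hh k hk,
    fun w h hh k hk => mem_centralizerMod.1 (w hk) h hh⟩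

theorem commutator_sup_right_le {H K L M : Subgroup Γ} [M.Normal] (h₁ : ⁅H, K⁆ ≤ M)
    (h₂ : ⁅H, L⁆ ≤ M) : ⁅H, K ⊔ L⁆ ≤ M := by
  rw [commutator_le_iff_le_centralizerMod] at *
  exact sup_le h₁ h₂

theorem commutator_sup_left_le {H K L M : Subgroup Γ} [M.Normal] (h₁ : ⁅H, L⁆ ≤ M)
    (h₂ : ⁅K, L⁆ ≤ M) : ⁅H ⊔ K, L⁆ ≤ M := by
  rw [Subgroup.commutator_comm] at *
  exact commutator_sup_right_le h₁ h₂

/-- The elements commuting with `H` modulo `M` form a subgroup, so generators suffice on one side.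
-/
theorem commutator_closure_right_le {H M : Subgroup Γ} [M.Normal] {s : Set Γ}
    (w : ∀ h ∈ H, ∀ k ∈ s, ⁅h, k⁆ ∈ M) : ⁅H, Subgroup.closure s⁆ ≤ M := by
  rw [commutator_le_iff_le_centralizerMod, Subgroup.closure_le]
  exact fun k hk => mem_centralizerMod.2 fun h hh => w h hh k hk

theorem sq_mem_squares {H : Subgroup Γ} {h : Γ} (hh : h ∈ H) : h ^ 2 ∈ squares H :=
  Subgroup.subset_closure ⟨h, hh, rfl⟩

theorem squares_le {H M : Subgroup Γ} : squares H ≤ M ↔ ∀ h ∈ H, h ^ 2 ∈ M := by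
  rw [squares, Subgroup.closure_le]
  constructor
  · exact fun w h hh => w ⟨h, hh, rfl⟩
  · rintro w _ ⟨h, hh, rfl⟩
    exact w h hh

theorem squares_mono {H K : Subgroup Γ} (h : H ≤ K) : squares H ≤ squares K :=
  squares_le.2 fun _ hx => sq_mem_squares (h hx)

theorem squares_le_self (H : Subgroup Γ) : squares H ≤ H :=
  squares_le.2 fun _ hx => pow_mem hx 2

theorem commutatorElement_sq_left (y w : Γ) : ⁅y ^ 2, w⁆ = ⁅y, ⁅y, w⁆⁆ * ⁅y, w⁆ ^ 2 := by
  simp only [commutatorElement_def, pow_two]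
  group

theorem commutatorElement_sq_right (w y : Γ) :
    ⁅w, y ^ 2⁆ = ⁅w, y⁆ ^ 2 * ⁅⁅w, y⁆⁻¹, y⁆ := by
  simp only [commutatorElement_def, pow_two]
  group

/-- Rests on `⁅y², w⁆ = ⁅y, ⁅y, w⁆⁆ ⁅y, w⁆²`: a square in one argument costs a square and a double
commutator. -/
theorem commutator_squares_le {H K M : Subgroup Γ} [M.Normal]
    (w : ∀ h ∈ H, ∀ k ∈ K, ⁅h, k⁆ ^ 2 ∈ M ∧ ⁅h, ⁅h, k⁆⁆ ∈ M) : ⁅squares H, K⁆ ≤ M := by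
  rw [Subgroup.commutator_comm]
  apply commutator_closure_right_le
  rintro k hk _ ⟨h, hh, rfl⟩
  apply commutatorElement_mem_symm
  rw [commutatorElement_sq_left]
  exact mul_mem (w h hh k hk).2 (w h hh k hk).1

/-- The three subgroups lemma, applied in the quotient by `M`. -/
theorem commutator_commutator_le_of_rotate {H K L M : Subgroup Γ} [M.Normal]
    (h₁ : ⁅⁅K, L⁆, H⁆ ≤ M) (h₂ : ⁅⁅L, H⁆, K⁆ ≤ M) : ⁅⁅H, K⁆, L⁆ ≤ M := by
  have key : ∀ A B C : Subgroup Γ, ⁅⁅A, B⁆, C⁆ ≤ M ↔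
      ⁅⁅A.map (QuotientGroup.mk' M), B.map (QuotientGroup.mk' M)⁆,
        C.map (QuotientGroup.mk' M)⁆ = ⊥ := by
    intro A B C
    rw [← Subgroup.map_commutator, ← Subgroup.map_commutator, Subgroup.map_eq_bot_iff,
      QuotientGroup.ker_mk']
  rw [key] at *
  exact Subgroup.commutator_commutator_eq_bot_of_rotate h₁ h₂

/-! ### The lower central series and series closed under commutators and squares -/

theorem gamma_one : gamma Γ 1 = ⊤ := rfl

theorem gamma_two : gamma Γ 2 = commutator Γ := rfl

theorem gamma_succ (n : ℕ) (hn : 1 ≤ n) : gamma Γ (n + 1) = ⁅gamma Γ n, ⊤⁆ := by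
  obtain ⟨m, rfl⟩ := Nat.exists_eq_add_of_le' hn
  rfl

theorem gamma_antitone : Antitone (gamma Γ) := fun _ _ h =>
  (⊤ : Subgroup Γ).lowerCentralSeries_antitone (Nat.sub_le_sub_right h 1)

theorem commutator_gamma_le (m n : ℕ) (hm : 1 ≤ m) (hn : 1 ≤ n) :
    ⁅gamma Γ m, gamma Γ n⁆ ≤ gamma Γ (m + n) := by
  induction n, hn using Nat.le_induction generalizing m with
  | base => rw [gamma_one, ← gamma_succ m hm]
  | succ n hn ih =>
    rw [Subgroup.commutator_comm, gamma_succ n hn]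
    apply commutator_commutator_le_of_rotate
    · rw [Subgroup.commutator_comm ⊤, ← gamma_succ m hm]
      exact (ih (m + 1) (by omega)).trans (gamma_antitone (by omega))
    · rw [← add_assoc, gamma_succ _ (by omega)]
      exact Subgroup.commutator_mono (ih m hm) le_rfl

/-- The series `R₁ = N`, `Rₙ₊₁ = [Γ, Rₙ] (R_⌈(n+1)/2⌉)²`, with `R₀ = N` as a dummy value. -/
def sqSeries (N : Subgroup Γ) : ℕ → Subgroup Γ
  | 0 => N
  | 1 => N
  | n + 2 => ⁅(⊤ : Subgroup Γ), sqSeries N (n + 1)⁆ ⊔ squares (sqSeries N ((n + 3) / 2))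

theorem twoCentral_eq_sqSeries (n : ℕ) : twoCentral Γ n = sqSeries ⊤ n := by
  induction n using Nat.strong_induction_on with
  | _ n ih =>
    match n, ih with
    | 0, _ => rw [twoCentral, sqSeries]
    | 1, _ => rw [twoCentral, sqSeries]
    | n + 2, ih => rw [twoCentral, sqSeries, ih (n + 1) (by omega), ih ((n + 3) / 2) (by omega)]

section SqSeries

variable (N : Subgroup Γ)

instance sqSeries_normal [N.Normal] (n : ℕ) : (sqSeries N n).Normal := by
  induction n using Nat.strong_induction_on with
  | _ n ih =>
    match n, ih with
    | 0, _ => rw [sqSeries]; infer_instance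
    | 1, _ => rw [sqSeries]; infer_instance
    | n + 2, ih =>
      rw [sqSeries]
      have h₁ := ih (n + 1) (by omega)
      have h₂ := ih ((n + 3) / 2) (by omega)
      infer_instance

theorem sqSeries_one : sqSeries N 1 = N := by rw [sqSeries]

theorem sqSeries_succ (n : ℕ) (hn : 1 ≤ n) :
    sqSeries N (n + 1) = ⁅(⊤ : Subgroup Γ), sqSeries N n⁆ ⊔ squares (sqSeries N ((n + 2) / 2)) := by
  obtain ⟨m, rfl⟩ := Nat.exists_eq_add_of_le' hn
  rw [sqSeries]

theorem sqSeries_antitone [N.Normal] : Antitone (sqSeries N) := by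
  apply antitone_nat_of_succ_le
  intro n
  induction n using Nat.strong_induction_on with
  | _ n ih =>
    rcases Nat.eq_zero_or_pos n with rfl | hn
    · rw [sqSeries, sqSeries]
    rw [sqSeries_succ N n hn]
    refine sup_le (Subgroup.commutator_le_right _ _) ?_
    rcases Nat.lt_or_ge n 2 with h | h
    · obtain rfl : n = 1 := by omega
      exact squares_le_self _
    · obtain ⟨m, rfl⟩ := Nat.exists_eq_add_of_le' hn
      rw [sqSeries_succ N m (by omega)]
      refine le_sup_of_le_right (squares_mono ?_)
      rcases Nat.even_or_odd m with ⟨k, rfl⟩ | ⟨k, rfl⟩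
      · rw [show (k + k + 1 + 2) / 2 = k + 1 by omega, show (k + k + 2) / 2 = k + 1 by omega]
      · rw [show (2 * k + 1 + 1 + 2) / 2 = k + 1 + 1 by omega,
          show (2 * k + 1 + 2) / 2 = k + 1 by omega]
        exact ih (k + 1) (by omega)

theorem commutator_sqSeries_le (n : ℕ) (hn : 1 ≤ n) :
    ⁅sqSeries N n, (⊤ : Subgroup Γ)⁆ ≤ sqSeries N (n + 1) := by
  rw [sqSeries_succ N n hn, Subgroup.commutator_comm]
  exact le_sup_left

theorem squares_sqSeries_le (n : ℕ) (hn : 1 ≤ n) :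
    squares (sqSeries N n) ≤ sqSeries N (2 * n) := by
  obtain ⟨m, rfl⟩ := Nat.exists_eq_add_of_le' hn
  have h := sqSeries_succ N (2 * m + 1) (by omega)
  rw [show (2 * m + 1 + 2) / 2 = m + 1 by omega] at h
  rw [show 2 * (m + 1) = (2 * m + 1) + 1 by ring, h]
  exact le_sup_right

theorem sq_mem_sqSeries [N.Normal] {m n : ℕ} (hn : 1 ≤ n) (h : m ≤ 2 * n) {x : Γ}
    (hx : x ∈ sqSeries N n) :
    x ^ 2 ∈ sqSeries N m :=
  sqSeries_antitone N h (squares_sqSeries_le N n hn (sq_mem_squares hx))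

theorem commutatorElement_mem_sqSeries {n : ℕ} (hn : 1 ≤ n) {x : Γ} (hx : x ∈ sqSeries N n)
    (g : Γ) : ⁅x, g⁆ ∈ sqSeries N (n + 1) :=
  commutator_sqSeries_le N n hn (Subgroup.commutator_mem_commutator hx (Subgroup.mem_top g))

/-- The series `sqSeries` is contained in every series with the same closure properties. -/
theorem sqSeries_le_of {F : ℕ → Subgroup Γ} (h₁ : N ≤ F 1)
    (hc : ∀ n, 1 ≤ n → ⁅F n, (⊤ : Subgroup Γ)⁆ ≤ F (n + 1))
    (hs : ∀ m n, 1 ≤ n → m ≤ 2 * n → squares (F n) ≤ F m) (n : ℕ) (hn : 1 ≤ n) :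
    sqSeries N n ≤ F n := by
  induction n using Nat.strong_induction_on with
  | _ n ih =>
    rcases Nat.lt_or_ge n 2 with h | h
    · obtain rfl : n = 1 := by omega
      rwa [sqSeries_one]
    obtain ⟨m, rfl⟩ := Nat.exists_eq_add_of_le' hn
    rw [sqSeries_succ N m (by omega), Subgroup.commutator_comm]
    refine sup_le ?_ ?_
    · exact (Subgroup.commutator_mono (ih m (by omega) (by omega)) le_rfl).trans (hc m (by omega))
    · exact (squares_mono (ih _ (by omega) (by omega))).trans (hs _ _ (by omega) (by omega))

end SqSeries

/-! ### Commutators and squares in the lower 2-central series -/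

section TwoCentral

theorem twoCentral_one : twoCentral Γ 1 = ⊤ := by rw [twoCentral]

theorem twoCentral_succ (n : ℕ) (hn : 1 ≤ n) :
    twoCentral Γ (n + 1) =
      ⁅twoCentral Γ n, (⊤ : Subgroup Γ)⁆ ⊔ squares (twoCentral Γ ((n + 2) / 2)) := by
  simp only [twoCentral_eq_sqSeries, sqSeries_succ _ n hn, Subgroup.commutator_comm]

theorem twoCentral_antitone : Antitone (twoCentral Γ) := fun m n h => by
  simp only [twoCentral_eq_sqSeries, sqSeries_antitone ⊤ h]

theorem sq_mem_twoCentral {m n : ℕ} (hn : 1 ≤ n) (h : m ≤ 2 * n) {x : Γ}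
    (hx : x ∈ twoCentral Γ n) : x ^ 2 ∈ twoCentral Γ m := by
  rw [twoCentral_eq_sqSeries] at *
  exact sq_mem_sqSeries ⊤ hn h hx

theorem gamma_le_sqSeries (n : ℕ) (hn : 1 ≤ n) :
    gamma Γ (n + 1) ≤ sqSeries (commutator Γ) n := by
  induction n, hn using Nat.le_induction with
  | base => rw [sqSeries_one, gamma_two]
  | succ n hn ih =>
    rw [gamma_succ _ (by omega)]
    exact (Subgroup.commutator_mono ih le_rfl).trans (commutator_sqSeries_le _ n hn)

theorem sqSeries_commutator_le_twoCentral (n : ℕ) (hn : 1 ≤ n) :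
    sqSeries (commutator Γ) n ≤ twoCentral Γ (n + 1) := by
  refine sqSeries_le_of (F := fun n => twoCentral Γ (n + 1)) _ ?_ ?_ ?_ n hn
  · rw [twoCentral_succ 1 le_rfl, twoCentral_one]
    exact le_sup_left
  · intro n hn
    simp only [twoCentral_succ (n + 1) (by omega)]
    exact le_sup_left
  · intro m n hn h
    exact squares_le.2 fun x hx => sq_mem_twoCentral (by omega) (by omega) hx

theorem gamma_le_twoCentral (n : ℕ) (hn : 1 ≤ n) : gamma Γ n ≤ twoCentral Γ n := by
  induction n, hn using Nat.le_induction with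
  | base => rw [twoCentral_one]; exact le_top
  | succ n hn ih =>
    rw [gamma_succ _ (by omega), twoCentral_succ n hn]
    exact le_sup_of_le_left (Subgroup.commutator_mono ih le_rfl)

/-- Strong induction on `m` for all `n`: the commutator part of `Γₘ` is handled by the three
subgroups lemma, the squares by the formula for `⁅y², w⁆`. -/
theorem commutator_twoCentral_le (m n : ℕ) (hm : 1 ≤ m) (hn : 1 ≤ n) :
    ⁅twoCentral Γ m, twoCentral Γ n⁆ ≤ twoCentral Γ (m + n) := by
  induction m using Nat.strong_induction_on generalizing n with
  | _ m ih =>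
    rcases Nat.lt_or_ge m 2 with h | h
    · obtain rfl : m = 1 := by omega
      rw [add_comm, twoCentral_one, Subgroup.commutator_comm, twoCentral_succ n hn]
      exact le_sup_left
    obtain ⟨m, rfl⟩ := Nat.exists_eq_add_of_le' hm
    rw [twoCentral_succ m (by omega)]
    apply commutator_sup_left_le
    · apply commutator_commutator_le_of_rotate
      · rw [Subgroup.commutator_comm ⊤, Subgroup.commutator_comm]
        refine le_trans ?_ ((ih m (by omega) (n + 1) (by omega) (by omega)).trans
          (twoCentral_antitone (by omega)))
        refine Subgroup.commutator_mono le_rfl ?_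
        rw [twoCentral_succ n hn]
        exact le_sup_left
      · rw [Subgroup.commutator_comm (twoCentral Γ n), show m + 1 + n = m + n + 1 by ring,
          twoCentral_succ (m + n) (by omega)]
        exact le_sup_of_le_left (Subgroup.commutator_mono (ih m (by omega) n (by omega) hn) le_rfl)
    · apply commutator_squares_le
      intro y hy w hw
      have h₁ := ih ((m + 2) / 2) (by omega) n (by omega) hn
        (Subgroup.commutator_mem_commutator hy hw)
      refine ⟨sq_mem_twoCentral (by omega) (by omega) h₁, ?_⟩
      exact twoCentral_antitone (by omega) (ih ((m + 2) / 2) (by omega) _ (by omega) (by omega)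
        (Subgroup.commutator_mem_commutator hy h₁))

/-- The product `γₙ Γₙ₊₁` of terms of the two central series. -/
def mixed (Γ : Type*) [Group Γ] (n : ℕ) : Subgroup Γ := gamma Γ n ⊔ twoCentral Γ (n + 1)

instance mixed_normal (n : ℕ) : (mixed Γ n).Normal := by
  rw [mixed]
  infer_instance

theorem mixed_one : mixed Γ 1 = ⊤ := by rw [mixed, gamma_one, top_sup_eq]

theorem mixed_le (n : ℕ) (hn : 1 ≤ n) : mixed Γ n ≤ twoCentral Γ n :=
  sup_le (gamma_le_twoCentral n hn) (twoCentral_antitone (by omega))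

theorem le_mixed {m n : ℕ} (h : n + 1 ≤ m) : twoCentral Γ m ≤ mixed Γ n :=
  le_sup_of_le_right (twoCentral_antitone h)

theorem mixed_antitone {m n : ℕ} (hm : 1 ≤ m) (h : m ≤ n) : mixed Γ n ≤ mixed Γ m := by
  rcases h.eq_or_lt with rfl | h
  · exact le_rfl
  · exact (mixed_le n (by omega)).trans (le_mixed h)

theorem commutator_mixed_le (m n : ℕ) (hm : 1 ≤ m) (hn : 1 ≤ n) :
    ⁅mixed Γ m, mixed Γ n⁆ ≤ mixed Γ (m + n) := by
  apply commutator_sup_left_le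
  · apply commutator_sup_right_le
    · exact (commutator_gamma_le m n hm hn).trans le_sup_left
    · exact ((Subgroup.commutator_mono (gamma_le_twoCentral m hm) le_rfl).trans
        (commutator_twoCentral_le m (n + 1) hm (by omega))).trans (le_mixed (by omega))
  · exact ((Subgroup.commutator_mono le_rfl (mixed_le n hn)).trans
        (commutator_twoCentral_le (m + 1) n (by omega) hn)).trans (le_mixed (by omega))

/-- The two claims need each other. Rewriting `Γₕ` by the first one reduces commutators with it to
commutators with `mixed Γ h` and with squares from `Γ_⌈h/2⌉`, and the latter are controlled by the
second claim at a smaller index. -/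
theorem twoCentral_le_and_commutator_le (h : ℕ) (hh : 1 ≤ h) :
    (twoCentral Γ h ≤ mixed Γ h ⊔ squares (twoCentral Γ ((h + 1) / 2))) ∧
      ∀ k, 1 ≤ k → ⁅mixed Γ k, twoCentral Γ h⁆ ≤ mixed Γ (k + h) := by
  induction h using Nat.strong_induction_on with
  | _ h ih =>
    rcases Nat.lt_or_ge h 2 with h2 | h2
    · obtain rfl : h = 1 := by omega
      rw [twoCentral_one, ← mixed_one]
      exact ⟨le_sup_left, fun k hk => commutator_mixed_le k 1 hk le_rfl⟩
    obtain ⟨h, rfl⟩ := Nat.exists_eq_add_of_le' hh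
    have hA : twoCentral Γ (h + 1) ≤
        mixed Γ (h + 1) ⊔ squares (twoCentral Γ ((h + 1 + 1) / 2)) := by
      rw [twoCentral_succ h (by omega)]
      refine sup_le_sup ?_ le_rfl
      refine (Subgroup.commutator_mono (ih h (by omega) (by omega)).1 le_rfl).trans ?_
      apply commutator_sup_left_le
      · rw [← mixed_one]
        exact commutator_mixed_le h 1 (by omega) le_rfl
      · apply commutator_squares_le
        intro y hy w _
        have hB := (ih ((h + 1) / 2) (by omega) (by omega)).2
        have h₁ : ⁅y, w⁆ ∈ mixed Γ (1 + (h + 1) / 2) := by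
          refine commutatorElement_mem_symm _ (hB 1 le_rfl ?_)
          exact Subgroup.commutator_mem_commutator (by rw [mixed_one]; trivial) hy
        -- The square of `⁅y, w⁆` lies in `Γ` of index `2(1 + ⌈h/2⌉) ≥ h + 2`, one more than needed,
        -- hence in `mixed Γ (h + 1)` without any condition on its `γ` part.
        refine ⟨le_mixed (m := h + 2) (by omega)
          (sq_mem_twoCentral (by omega) (by omega) (mixed_le _ (by omega) h₁)), ?_⟩
        refine mixed_antitone ?_ ?_ (commutatorElement_mem_symm _ (hB _ ?_
          (Subgroup.commutator_mem_commutator h₁ hy)))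
        all_goals omega
    refine ⟨hA, fun k hk => ?_⟩
    refine (Subgroup.commutator_mono le_rfl hA).trans ?_
    apply commutator_sup_right_le
    · exact commutator_mixed_le k _ hk (by omega)
    · rw [Subgroup.commutator_comm]
      apply commutator_squares_le
      intro y hy w hw
      have hB := (ih ((h + 1 + 1) / 2) (by omega) (by omega)).2
      have h₁ : ⁅y, w⁆ ∈ mixed Γ (k + (h + 1 + 1) / 2) :=
        commutatorElement_mem_symm _ (hB k hk (Subgroup.commutator_mem_commutator hw hy))
      refine ⟨le_mixed (m := k + h + 2) (by omega)
          (sq_mem_twoCentral (by omega) (by omega) (mixed_le _ (by omega) h₁)), ?_⟩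
      refine mixed_antitone ?_ ?_ (commutatorElement_mem_symm _ (hB _ ?_
          (Subgroup.commutator_mem_commutator h₁ hy)))
      all_goals omega

theorem twoCentral_le_mixed_sup_squares (n : ℕ) (hn : 1 ≤ n) :
    twoCentral Γ n ≤ mixed Γ n ⊔ squares (twoCentral Γ ((n + 1) / 2)) :=
  (twoCentral_le_and_commutator_le n hn).1

/-- For `m = n` this makes squaring a homomorphism from `Γₙ` to the quotient by `mixed Γ (2 * n)`,
which is how the even factors are bounded later. -/
theorem commutator_twoCentral_le_mixed (m n : ℕ) (hm : 1 ≤ m) (hn : 1 ≤ n) :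
    ⁅twoCentral Γ m, twoCentral Γ n⁆ ≤ mixed Γ (m + n) := by
  induction m using Nat.strong_induction_on with
  | _ m ih =>
    rcases Nat.lt_or_ge m 2 with h | h
    · obtain rfl : m = 1 := by omega
      rw [twoCentral_one, ← mixed_one]
      exact (twoCentral_le_and_commutator_le n hn).2 1 le_rfl
    refine (Subgroup.commutator_mono (twoCentral_le_mixed_sup_squares m hm) le_rfl).trans ?_
    apply commutator_sup_left_le
    · exact (twoCentral_le_and_commutator_le n hn).2 m hm
    · apply commutator_squares_le
      intro y hy w hw
      have h₁ := ih ((m + 1) / 2) (by omega) (by omega) (Subgroup.commutator_mem_commutator hy hw)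
      refine ⟨le_mixed (m := m + n + 1) (by omega)
          (sq_mem_twoCentral (by omega) (by omega) (mixed_le _ (by omega) h₁)), ?_⟩
      refine mixed_antitone ?_ ?_ (commutatorElement_mem_symm _
        ((twoCentral_le_and_commutator_le _ (by omega)).2 _ ?_
          (Subgroup.commutator_mem_commutator h₁ hy)))
      all_goals omega

end TwoCentral

end General

/-! ### Wreath recursion for the generators and basic commutators -/

section Pairs

theorem pair_mul (g h g' h' : RAut) : pair g h * pair g' h' = pair (g * g') (h * h') :=
  (pairHom.map_mul (g, h) (g', h')).symm

theorem pair_one : pair 1 1 = 1 := pairHom.map_one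

theorem pair_inv (g h : RAut) : (pair g h)⁻¹ = pair g⁻¹ h⁻¹ :=
  (pairHom.map_inv (g, h)).symm

theorem act_pair_false (g h : RAut) (w : List Bool) :
    act (false :: w) (pair g h) = false :: act w g := rfl

theorem act_pair_true (g h : RAut) (w : List Bool) :
    act (true :: w) (pair g h) = true :: act w h := rfl

theorem pair_inj {g h g' h' : RAut} : pair g h = pair g' h' ↔ g = g' ∧ h = h' := by
  constructor
  · intro w
    constructor
    · refine ext_act fun v => ?_
      have := congrArg (act (false :: v)) w
      rw [act_pair_false, act_pair_false] at this
      exact (List.cons.inj this).2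
    · refine ext_act fun v => ?_
      have := congrArg (act (true :: v)) w
      rw [act_pair_true, act_pair_true] at this
      exact (List.cons.inj this).2
  · rintro ⟨rfl, rfl⟩
    rfl

theorem swap_mul_swap : swap * swap = 1 :=
  ext_act (by rintro (_ | ⟨_ | _, w⟩) <;> rfl)

theorem swap_mul_pair (g h : RAut) : swap * pair g h = pair h g * swap :=
  ext_act (by rintro (_ | ⟨_ | _, w⟩) <;> rfl)

theorem conj_a_pair (g h : RAut) : a⁻¹ * pair g h * a = pair h (b⁻¹ * g * b) := by
  rw [mul_assoc, inv_mul_eq_iff_eq_mul, a_eq, ← mul_assoc, pair_mul, mul_assoc (pair b 1),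
    swap_mul_pair, ← mul_assoc, pair_mul]
  simp [mul_assoc]

end Pairs

/-- The generator `a` as an element of `G`. -/
def gA : G := ⟨a, Subgroup.subset_closure (by simp)⟩

/-- The generator `b` as an element of `G`. -/
def gB : G := ⟨b, Subgroup.subset_closure (by simp)⟩

/-- The commutator `c` as an element of `G`. -/
def gC : G := comm gA gB

/-- The commutator `d` as an element of `G`. -/
def gD : G := comm gC gA

/-- The commutator `e` as an element of `G`. -/
def gE : G := comm gD gA

theorem coe_gD : (gD : RAut) = d := rfl

theorem coe_gE : (gE : RAut) = e := rfl

theorem closure_gA_gB : Subgroup.closure {gA, gB} = ⊤ := by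
  have h : (Subgroup.closure {gA, gB}).map G.subtype = (⊤ : Subgroup G).map G.subtype := by
    rw [MonoidHom.map_closure, ← MonoidHom.range_eq_map, Subgroup.range_subtype,
      Set.image_pair]
    rfl
  exact Subgroup.map_injective G.subtype_injective h

/-- `IsPair g x y` says that `g = ⟨x, y⟩`. -/
def IsPair (g x y : G) : Prop := (g : RAut) = pair x y

namespace IsPair

variable {g h x y x' y' : G}

theorem one : IsPair 1 1 1 := pair_one.symm

theorem mul (w : IsPair g x y) (w' : IsPair h x' y') : IsPair (g * h) (x * x') (y * y') := by
  rw [IsPair] at *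
  push_cast
  rw [w, w', pair_mul]

theorem inv (w : IsPair g x y) : IsPair g⁻¹ x⁻¹ y⁻¹ := by
  rw [IsPair] at *
  push_cast
  rw [w, pair_inv]

theorem pow (w : IsPair g x y) (n : ℕ) : IsPair (g ^ n) (x ^ n) (y ^ n) := by
  induction n with
  | zero => simpa using one
  | succ n ih => simpa only [pow_succ] using ih.mul w

theorem zpow (w : IsPair g x y) (n : ℤ) : IsPair (g ^ n) (x ^ n) (y ^ n) := by
  cases n with
  | ofNat n => simpa using w.pow n
  | negSucc n => simpa only [zpow_negSucc] using (w.pow (n + 1)).inv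

theorem bracket (w : IsPair g x y) (w' : IsPair h x' y') : IsPair ⁅g, h⁆ ⁅x, x'⁆ ⁅y, y'⁆ :=
  ((w.mul w').mul w.inv).mul w'.inv

theorem comm (w : IsPair g x y) (w' : IsPair h x' y') :
    IsPair (comm g h) (comm x x') (comm y y') :=
  ((w.inv.mul w'.inv).mul w).mul w'

theorem inj (w : IsPair g x y) (w' : IsPair g x' y') : x = x' ∧ y = y' := by
  have := pair_inj.1 (w.symm.trans w')
  exact ⟨Subtype.ext this.1, Subtype.ext this.2⟩

theorem eq (w : IsPair g x y) (w' : IsPair h x y) : g = h :=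
  Subtype.ext (w.trans w'.symm)

theorem conjA (w : IsPair g x y) : IsPair (gA⁻¹ * g * gA) y (gB⁻¹ * x * gB) := by
  rw [IsPair] at *
  push_cast
  rw [w]
  exact conj_a_pair _ _

theorem B : IsPair gB gA 1 := b_eq

theorem A_sq : IsPair (gA ^ 2) gB gB := by
  have h : (gA : RAut) = a := rfl
  rw [IsPair]
  push_cast
  rw [h, pow_two, a_eq, mul_assoc, ← mul_assoc swap, swap_mul_pair, mul_assoc, swap_mul_swap,
    mul_one, pair_mul]
  simp [gB]

theorem conjB (w : IsPair g x y) : IsPair (gB⁻¹ * g * gB) (gA⁻¹ * x * gA) y := by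
  simpa using (B.inv.mul w).mul B

theorem conjB_inv (w : IsPair g x y) : IsPair (gB * g * gB⁻¹) (gA * x * gA⁻¹) y := by
  simpa using (B.mul w).mul B.inv

theorem conjA_inv (w : IsPair g x y) : IsPair (gA * g * gA⁻¹) (gB * y * gB⁻¹) x := by
  have h := ((A_sq.mul w).mul A_sq.inv).conjA
  rw [show gA⁻¹ * (gA ^ 2 * g * (gA ^ 2)⁻¹) * gA = gA * g * gA⁻¹ by group,
    show gB⁻¹ * (gB * x * gB⁻¹) * gB = x by group] at h
  exact h

theorem not_A : ¬ IsPair gA x y := by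
  intro w
  have := congrArg (act [false]) w
  rw [act_pair_false] at this
  exact absurd (List.cons.inj this).1 (by simp)

/-- Write `c = (a⁻¹ b⁻¹ a) b`, note that conjugation by `a` moves `⟨a⁻¹, 1⟩` to the second
coordinate, and use `b⁻¹ a b = ac`. -/
theorem C : IsPair gC gA (gA * gC)⁻¹ := by
  have h := (B.inv.conjA).mul B
  have h1 : gA⁻¹ * gB⁻¹ * gA * gB = gC := rfl
  rw [h1] at h
  convert h using 1
  · simp
  · simp [gC, Basilica.comm, mul_assoc]

theorem D : IsPair gD (gA⁻¹ * (gA * gC)⁻¹) ((gA * gC) * (gA * gC)) := by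
  have h := C.inv.mul C.conjA
  have h1 : gC⁻¹ * (gA⁻¹ * gC * gA) = gD := by simp [gD, Basilica.comm, mul_assoc]
  rw [h1] at h
  convert h using 1
  simp [gC, Basilica.comm, mul_assoc]

/-- The second coordinates of `c²` and `d` cancel, leaving a conjugate of `c⁻¹` in the first; this
is the source of `⟨c, 1⟩`. -/
theorem C_sq_mul_D : IsPair (gC * gC * gD) (gA * gC⁻¹ * gA⁻¹) 1 := by
  have h := (C.mul C).mul D
  convert h using 1 <;> group

end IsPair

/-- Both have first coordinate `a`, and `b` has trivial second coordinate. -/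
theorem commute_C_B : Commute gC gB := by
  have h₁ := IsPair.C.mul IsPair.B
  have h₂ := IsPair.B.mul IsPair.C
  simp only [mul_one, one_mul] at h₁ h₂
  exact h₁.eq h₂

theorem normal_of_conj {N : Subgroup G} (hA : ∀ x ∈ N, gA⁻¹ * x * gA ∈ N)
    (hA' : ∀ x ∈ N, gA * x * gA⁻¹ ∈ N) (hB : ∀ x ∈ N, gB⁻¹ * x * gB ∈ N)
    (hB' : ∀ x ∈ N, gB * x * gB⁻¹ ∈ N) : N.Normal := by
  rw [← Subgroup.normalizer_eq_top_iff, eq_top_iff, ← closure_gA_gB, Subgroup.closure_le]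
  rintro _ (rfl | rfl)
  · refine Subgroup.mem_normalizer_iff.2 fun h => ⟨hA' h, fun w => ?_⟩
    simpa [mul_assoc] using hA _ w
  · refine Subgroup.mem_normalizer_iff.2 fun h => ⟨hB' h, fun w => ?_⟩
    simpa [mul_assoc] using hB _ w

theorem commutator_top_le {X M : Subgroup G} [M.Normal] (hA : ∀ g ∈ X, ⁅g, gA⁆ ∈ M)
    (hB : ∀ g ∈ X, ⁅g, gB⁆ ∈ M) : ⁅X, (⊤ : Subgroup G)⁆ ≤ M := by
  rw [← closure_gA_gB]
  apply commutator_closure_right_le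
  rintro h hh _ (rfl | rfl)
  · exact hA h hh
  · exact hB h hh

/-- A group generated by two commuting elements is abelian, so `G'` is the normal closure of `c`. -/
theorem commutator_le_of_C_mem {M : Subgroup G} [M.Normal] (h : gC ∈ M) : commutator G ≤ M := by
  have h' : ⁅gA, gB⁆ ∈ M := (comm_mem_iff' M gA gB).1 h
  rw [commutator_def, Subgroup.commutator_comm, ← closure_gA_gB]
  have key : ∀ g ∈ ({gA, gB} : Set G), ∀ g' ∈ ({gA, gB} : Set G), ⁅g, g'⁆ ∈ M := by
    rintro _ (rfl | rfl) _ (rfl | rfl)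
    · simp
    · exact h'
    · exact commutatorElement_mem_symm M h'
    · simp
  apply commutator_closure_right_le
  intro g hg g' hg'
  have : ⁅Subgroup.closure {g'}, Subgroup.closure {gA, gB}⁆ ≤ M := by
    apply commutator_closure_right_le
    intro x hx y hy
    have : ⁅Subgroup.closure {y}, Subgroup.closure {g'}⁆ ≤ M := by
      apply commutator_closure_right_le
      rintro z hz w rfl
      rw [Subgroup.mem_closure_singleton] at hz
      obtain ⟨n, rfl⟩ := hz
      have := key _ hy _ hg'
      rw [commutatorElement_mem_iff] at *
      exact this.zpow_left n
    exact commutatorElement_mem_symm M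
      (this (Subgroup.commutator_mem_commutator (Subgroup.mem_closure_singleton_self y) hx))
  exact commutatorElement_mem_symm M
    (this (Subgroup.commutator_mem_commutator (Subgroup.mem_closure_singleton_self g') hg))

theorem gC_mem : gC ∈ commutator G := by
  rw [gC, comm_mem_iff', commutator_def]
  exact Subgroup.commutator_mem_commutator trivial trivial

/-- Since `c` commutes with `b`, killing `d = [c, a]` makes `c` central, and then all of `G'`
central; so `γ₃` is the normal closure of `d`. -/
theorem gamma_three_le {M : Subgroup G} [M.Normal] (h : gD ∈ M) : gamma G 3 ≤ M := by
  have h₁ : commutator G ≤ (Subgroup.center (G ⧸ M)).comap (QuotientGroup.mk' M) := by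
    apply commutator_le_of_C_mem
    have hC : Subgroup.closure {gA, gB} ≤ centralizerMod (Subgroup.zpowers gC) M := by
      rw [Subgroup.closure_le]
      rintro _ (rfl | rfl) <;> refine mem_centralizerMod.2 ?_ <;> rintro _ ⟨n, rfl⟩ <;>
        rw [commutatorElement_mem_iff]
      · exact Commute.zpow_left (h := (comm_mem_iff M _ _).1 h) n
      · exact Commute.zpow_left (h := commute_C_B.map (QuotientGroup.mk' M)) n
    rw [closure_gA_gB] at hC
    rw [Subgroup.mem_comap, Subgroup.mem_center_iff]
    intro g
    obtain ⟨g, rfl⟩ := QuotientGroup.mk_surjective g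
    have := mem_centralizerMod.1 (hC (Subgroup.mem_top g)) gC (Subgroup.mem_zpowers gC)
    exact ((commutatorElement_mem_iff M _ _).1 this).symm
  rw [gamma_succ 2 (by norm_num), gamma_two, commutator_le_iff_commute]
  intro x hx y _
  exact (Subgroup.mem_center_iff.1 (h₁ hx) y).symm

attribute [irreducible] gA gB gC gD gE

/-! ### Subgroups supported on one or on both subtrees -/

/-- The elements `x` with `⟨x, 1⟩ ∈ N`. -/
def leftPull (N : Subgroup G) : Subgroup G where
  carrier := {x | ∃ g ∈ N, IsPair g x 1}
  one_mem' := ⟨1, one_mem N, IsPair.one⟩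
  mul_mem' := by
    rintro x y ⟨g, hg, w⟩ ⟨h, hh, w'⟩
    exact ⟨g * h, mul_mem hg hh, by simpa using w.mul w'⟩
  inv_mem' := by
    rintro x ⟨g, hg, w⟩
    exact ⟨g⁻¹, inv_mem hg, by simpa using w.inv⟩

theorem leftPull_mono {N M : Subgroup G} (h : N ≤ M) : leftPull N ≤ leftPull M :=
  fun _ ⟨g, hg, w⟩ => ⟨g, h hg, w⟩

theorem mem_of_mem_leftPull {N : Subgroup G} {g x : G} (w : IsPair g x 1) (h : x ∈ leftPull N) :
    g ∈ N := by
  obtain ⟨g', hg', w'⟩ := h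
  rwa [w.eq w']

/-- Conjugating `⟨x, 1⟩` by `b = ⟨a, 1⟩` conjugates `x` by `a`, and conjugating it by `a² = ⟨b, b⟩`
conjugates `x` by `b`. -/
instance leftPull_normal (N : Subgroup G) [hN : N.Normal] : (leftPull N).Normal := by
  apply normal_of_conj
  · rintro x ⟨g, hg, w⟩
    exact ⟨gB⁻¹ * g * gB, by simpa using hN.conj_mem g hg gB⁻¹, w.conjB⟩
  · rintro x ⟨g, hg, w⟩
    exact ⟨gB * g * gB⁻¹, hN.conj_mem g hg gB, w.conjB_inv⟩
  · rintro x ⟨g, hg, w⟩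
    refine ⟨(gA ^ 2)⁻¹ * g * gA ^ 2, by simpa using hN.conj_mem g hg (gA ^ 2)⁻¹, ?_⟩
    simpa using (IsPair.A_sq.inv.mul w).mul IsPair.A_sq
  · rintro x ⟨g, hg, w⟩
    refine ⟨gA ^ 2 * g * (gA ^ 2)⁻¹, hN.conj_mem g hg _, ?_⟩
    simpa using (IsPair.A_sq.mul w).mul IsPair.A_sq.inv

/-- The generator `c` is reached because `[b, a²] = ⟨[a, b], 1⟩`. -/
theorem commutator_le_leftPull : commutator G ≤ leftPull (commutator G) := by
  apply commutator_le_of_C_mem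
  refine ⟨comm gB (gA ^ 2), ?_, ?_⟩
  · rw [comm_mem_iff', commutator_def]
    exact Subgroup.commutator_mem_commutator trivial trivial
  · simpa [comm, gC] using IsPair.B.comm IsPair.A_sq

/-- The elements `⟨x, y⟩` of `G` with `x, y ∈ H`. -/
def dbl (H : Subgroup G) : Subgroup G where
  carrier := {g | ∃ x ∈ H, ∃ y ∈ H, IsPair g x y}
  one_mem' := ⟨1, one_mem H, 1, one_mem H, IsPair.one⟩
  mul_mem' := by
    rintro _ _ ⟨x, hx, y, hy, w⟩ ⟨x', hx', y', hy', w'⟩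
    exact ⟨_, mul_mem hx hx', _, mul_mem hy hy', w.mul w'⟩
  inv_mem' := by
    rintro _ ⟨x, hx, y, hy, w⟩
    exact ⟨_, inv_mem hx, _, inv_mem hy, w.inv⟩

theorem mem_dbl_iff {H : Subgroup G} {g x y : G} (w : IsPair g x y) :
    g ∈ dbl H ↔ x ∈ H ∧ y ∈ H := by
  constructor
  · rintro ⟨x', hx, y', hy, w'⟩
    obtain ⟨rfl, rfl⟩ := w.inj w'
    exact ⟨hx, hy⟩
  · rintro ⟨hx, hy⟩
    exact ⟨x, hx, y, hy, w⟩

theorem dbl_mono {H K : Subgroup G} (h : H ≤ K) : dbl H ≤ dbl K :=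
  fun _ ⟨x, hx, y, hy, w⟩ => ⟨x, h hx, y, h hy, w⟩

instance dbl_normal (H : Subgroup G) [hH : H.Normal] : (dbl H).Normal := by
  have conj' : ∀ x ∈ H, ∀ g, g⁻¹ * x * g ∈ H := fun x hx g => by
    simpa using hH.conj_mem x hx g⁻¹
  apply normal_of_conj
  · rintro _ ⟨x, hx, y, hy, w⟩
    exact ⟨_, hy, _, conj' x hx _, w.conjA⟩
  · rintro _ ⟨x, hx, y, hy, w⟩
    exact ⟨_, hH.conj_mem y hy _, _, hx, w.conjA_inv⟩
  · rintro _ ⟨x, hx, y, hy, w⟩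
    exact ⟨_, conj' x hx _, _, hy, w.conjB⟩
  · rintro _ ⟨x, hx, y, hy, w⟩
    exact ⟨_, hH.conj_mem x hx _, _, hy, w.conjB_inv⟩

theorem exists_isPair_one_right {N : Subgroup G} [hN : N.Normal] {x : G}
    (hx : x ∈ leftPull N) : ∃ g ∈ N, IsPair g 1 x := by
  obtain ⟨g, hg, w⟩ := (leftPull_normal N).conj_mem x hx gB
  refine ⟨gA⁻¹ * g * gA, by simpa using hN.conj_mem g hg gA⁻¹, ?_⟩
  simpa [mul_assoc] using w.conjA

/-- Conjugation by `a` carries `⟨bxb⁻¹, 1⟩` to `⟨1, x⟩`, so for a normal subgroup the left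
coordinate alone decides. -/
theorem dbl_le {H N : Subgroup G} [hN : N.Normal] (h : H ≤ leftPull N) : dbl H ≤ N := by
  rintro g ⟨x, hx, y, hy, w⟩
  obtain ⟨g₁, hg₁, w₁⟩ := h hx
  obtain ⟨g₂, hg₂, w₂⟩ := exists_isPair_one_right (h hy)
  have : IsPair (g₁ * g₂) x y := by simpa using w₁.mul w₂
  rw [w.eq this]
  exact mul_mem hg₁ hg₂

theorem exists_isPair {x y : G} (hx : x ∈ commutator G) (hy : y ∈ commutator G) :
    ∃ g ∈ commutator G, IsPair g x y := by
  obtain ⟨g₁, hg₁, w₁⟩ := commutator_le_leftPull hx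
  obtain ⟨g₂, hg₂, w₂⟩ := exists_isPair_one_right (commutator_le_leftPull hy)
  exact ⟨g₁ * g₂, mul_mem hg₁ hg₂, by simpa using w₁.mul w₂⟩

/-! ### The abelianization and the second derived subgroup -/

/-- The abelianization of `G`. -/
abbrev Ab : Type := G ⧸ commutator G

/-- The quotient of `G` by the third term of its lower central series. -/
abbrev G3 : Type := G ⧸ gamma G 3

instance : CommGroup Ab := inferInstanceAs (CommGroup (Abelianization G))

theorem ab_eq_one_iff {g : G} : (g : Ab) = 1 ↔ g ∈ commutator G := QuotientGroup.eq_one_iff g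

theorem exists_ab_eq (g : G) : ∃ m n : ℤ, (g : Ab) = (gA : Ab) ^ m * (gB : Ab) ^ n := by
  have hg : g ∈ Subgroup.closure {gA, gB} := by rw [closure_gA_gB]; trivial
  induction hg using Subgroup.closure_induction with
  | mem x hx =>
    rcases hx with rfl | rfl
    · exact ⟨1, 0, by simp⟩
    · exact ⟨0, 1, by simp⟩
  | one => exact ⟨0, 0, by simp⟩
  | mul x y _ _ hx hy =>
    obtain ⟨m, n, h⟩ := hx
    obtain ⟨m', n', h'⟩ := hy
    refine ⟨m + m', n + n', ?_⟩
    rw [QuotientGroup.mk_mul, h, h', zpow_add, zpow_add, mul_mul_mul_comm]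
  | inv x _ hx =>
    obtain ⟨m, n, h⟩ := hx
    exact ⟨-m, -n, by rw [QuotientGroup.mk_inv, h, mul_inv, zpow_neg, zpow_neg]⟩

theorem ab_C : (gC : Ab) = 1 := ab_eq_one_iff.2 gC_mem

/-- The condition defines a normal subgroup, because `b` preserves the coordinates modulo `G'` and
`a` swaps them, turning `k` into `-k`; it holds for `c` with `k = 1`. -/
theorem exists_isPair_of_mem_commutator {g : G} (hg : g ∈ commutator G) :
    ∃ (k : ℤ) (p q : G), IsPair g p q ∧ (p : Ab) = (gA : Ab) ^ k ∧ (q : Ab) = (gA : Ab) ^ (-k) := by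
  let T : Subgroup G :=
    { carrier := {g | ∃ (k : ℤ) (p q : G), IsPair g p q ∧ (p : Ab) = (gA : Ab) ^ k ∧
        (q : Ab) = (gA : Ab) ^ (-k)}
      one_mem' := ⟨0, 1, 1, IsPair.one, by simp, by simp⟩
      mul_mem' := by
        rintro _ _ ⟨k, p, q, w, h₁, h₂⟩ ⟨k', p', q', w', h₁', h₂'⟩
        refine ⟨k + k', _, _, w.mul w', ?_, ?_⟩
        · rw [QuotientGroup.mk_mul, h₁, h₁', zpow_add]
        · rw [QuotientGroup.mk_mul, h₂, h₂', neg_add, zpow_add]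
      inv_mem' := by
        rintro _ ⟨k, p, q, w, h₁, h₂⟩
        refine ⟨-k, _, _, w.inv, ?_, ?_⟩
        · rw [QuotientGroup.mk_inv, h₁, zpow_neg]
        · rw [QuotientGroup.mk_inv, h₂, zpow_neg, zpow_neg, zpow_neg] }
  have conj (x y : G) : ((x⁻¹ * y * x : G) : Ab) = y := by
    rw [QuotientGroup.mk_mul, QuotientGroup.mk_mul, QuotientGroup.mk_inv, mul_comm, ← mul_assoc,
      mul_inv_cancel, one_mul]
  have conj' (x y : G) : ((x * y * x⁻¹ : G) : Ab) = y := by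
    rw [QuotientGroup.mk_mul, QuotientGroup.mk_mul, QuotientGroup.mk_inv, mul_comm, ← mul_assoc,
      inv_mul_cancel, one_mul]
  have hT : T.Normal := by
    apply normal_of_conj
    · rintro _ ⟨k, p, q, w, h₁, h₂⟩
      exact ⟨-k, _, _, w.conjA, h₂, by rw [conj, h₁, neg_neg]⟩
    · rintro _ ⟨k, p, q, w, h₁, h₂⟩
      exact ⟨-k, _, _, w.conjA_inv, by rw [conj', h₂], by rw [h₁, neg_neg]⟩
    · rintro _ ⟨k, p, q, w, h₁, h₂⟩
      exact ⟨k, _, _, w.conjB, by rw [conj, h₁], h₂⟩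
    · rintro _ ⟨k, p, q, w, h₁, h₂⟩
      exact ⟨k, _, _, w.conjB_inv, by rw [conj', h₁], h₂⟩
  have hC : gC ∈ T := by
    refine ⟨1, _, _, IsPair.C, by simp, ?_⟩
    rw [QuotientGroup.mk_inv, QuotientGroup.mk_mul, ab_C]
    simp
  exact commutator_le_of_C_mem hC hg

theorem eq_zero_of_two_pow_dvd {m : ℤ} (h : ∀ t : ℕ, (2 : ℤ) ^ t ∣ m) : m = 0 := by
  refine Int.eq_zero_of_dvd_of_natAbs_lt_natAbs (h m.natAbs) ?_
  rw [Int.natAbs_pow]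
  exact Nat.lt_two_pow_self

/-- An odd `m` would make `a` fix the first level. For `m = 2m'` the element `aᵐ bⁿ` is `⟨b^m' aⁿ,
b^m'⟩`, and its coordinates are `aᵏ` and `a⁻ᵏ` modulo `G'`. -/
theorem ab_descent {m n : ℤ} (h : (gA : Ab) ^ m * (gB : Ab) ^ n = 1) :
    ∃ k m' : ℤ, m = 2 * m' ∧ (gA : Ab) ^ (n - k) * (gB : Ab) ^ m' = 1 ∧
      (gA : Ab) ^ k * (gB : Ab) ^ m' = 1 := by
  have hg : gA ^ m * gB ^ n ∈ commutator G := ab_eq_one_iff.1 (by simpa using h)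
  obtain ⟨k, p, q, w, hp, hq⟩ := exists_isPair_of_mem_commutator hg
  rcases Int.even_or_odd' m with ⟨m', rfl | rfl⟩
  · refine ⟨k, m', rfl, ?_⟩
    have w' := (IsPair.A_sq.zpow m').mul (IsPair.B.zpow n)
    rw [← zpow_natCast, ← zpow_mul] at w'
    obtain ⟨rfl, rfl⟩ := w.inj w'
    simp only [QuotientGroup.mk_mul, QuotientGroup.mk_zpow, one_zpow, mul_one,
      zpow_neg] at hp hq
    constructor
    · rw [zpow_sub, ← hp, hq, ← hp]
      group
    · rw [hq, mul_inv_cancel]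
  · exfalso
    have w' := (w.mul (IsPair.B.zpow (-n))).mul (IsPair.A_sq.zpow (-m'))
    have hA : gA ^ (2 * m' + 1) * gB ^ n * gB ^ (-n) * (gA ^ 2) ^ (-m') = gA := by
      rw [← zpow_natCast, ← zpow_mul]
      push_cast
      group
    rw [hA] at w'
    exact IsPair.not_A w'

theorem ab_injective {m n : ℤ} (h : (gA : Ab) ^ m * (gB : Ab) ^ n = 1) : m = 0 ∧ n = 0 := by
  have key : ∀ t : ℕ, ∀ m n : ℤ, (gA : Ab) ^ m * (gB : Ab) ^ n = 1 →
      (2 : ℤ) ^ t ∣ m ∧ (2 : ℤ) ^ t ∣ n := by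
    intro t
    induction t with
    | zero => simp
    | succ t ih =>
      have first : ∀ m n : ℤ, (gA : Ab) ^ m * (gB : Ab) ^ n = 1 → (2 : ℤ) ^ (t + 1) ∣ m := by
        intro m n h
        obtain ⟨k, m', rfl, -, h'⟩ := ab_descent h
        rw [pow_succ']
        exact mul_dvd_mul_left 2 (ih _ _ h').2
      intro m n h
      obtain ⟨k, m', hm, h₁, h₂⟩ := ab_descent h
      refine ⟨first m n h, ?_⟩
      -- `n = (n - k) + k`, and both summands are exponents of `a` in relations, hence divisible by
      -- `2 ^ (t + 1)`.
      simpa using dvd_add (first _ _ h₁) (first _ _ h₂)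
  exact ⟨eq_zero_of_two_pow_dvd fun t => (key t m n h).1,
    eq_zero_of_two_pow_dvd fun t => (key t m n h).2⟩

theorem commute_mod_gamma_three {x : G} (hx : x ∈ commutator G) (g : G) :
    Commute (x : G3) (g : G3) := by
  rw [← commutatorElement_mem_iff, gamma_succ 2 (by norm_num)]
  exact Subgroup.commutator_mem_commutator hx trivial

theorem bracket_mem_gamma_three {p q : G} {k l : ℤ} (hp : (p : Ab) = (gA : Ab) ^ k)
    (hq : (q : Ab) = (gA : Ab) ^ l) : ⁅p, q⁆ ∈ gamma G 3 := by
  rw [← QuotientGroup.mk_zpow, QuotientGroup.eq] at hp hq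
  obtain ⟨x, hx⟩ : ∃ x, x = p⁻¹ * gA ^ k := ⟨_, rfl⟩
  obtain ⟨y, hy⟩ : ∃ y, y = q⁻¹ * gA ^ l := ⟨_, rfl⟩
  rw [← hx] at hp
  rw [← hy] at hq
  obtain rfl : p = gA ^ k * x⁻¹ := by rw [hx]; group
  obtain rfl : q = gA ^ l * y⁻¹ := by rw [hy]; group
  have hx' := inv_mem hp
  have hy' := inv_mem hq
  rw [commutatorElement_mem_iff]
  push_cast [QuotientGroup.mk_mul]
  refine Commute.mul_left (Commute.mul_right ?_ ?_) (commute_mod_gamma_three hx' _)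
  · rw [QuotientGroup.mk_zpow, QuotientGroup.mk_zpow]
    exact (Commute.refl _).zpow_zpow _ _
  · exact (commute_mod_gamma_three hy' _).symm

theorem gD_mem : gD ∈ gamma G 3 := by
  rw [gD, comm_mem_iff', gamma_succ 2 (by norm_num)]
  exact Subgroup.commutator_mem_commutator gC_mem trivial

theorem gamma_three_le_commutator : gamma G 3 ≤ commutator G := by
  rw [← gamma_two]
  exact gamma_antitone (by norm_num)

/-- For `≤`, corresponding coordinates of two elements of `G'` are powers of `a` modulo `G'`, so
they commute modulo `γ₃`. For `≥`, bracketing `⟨c, 1⟩ ∈ G'` with `c = ⟨a, (ac)⁻¹⟩` gives `⟨d, 1⟩`,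
and `d` normally generates `γ₃`. -/
theorem second_derived : ⁅commutator G, commutator G⁆ = dbl (gamma G 3) := by
  apply le_antisymm
  · rw [Subgroup.commutator_le]
    intro x hx y hy
    obtain ⟨k, p, q, w, hp, hq⟩ := exists_isPair_of_mem_commutator hx
    obtain ⟨k', p', q', w', hp', hq'⟩ := exists_isPair_of_mem_commutator hy
    exact ⟨_, bracket_mem_gamma_three hp hp', _, bracket_mem_gamma_three hq hq', w.bracket w'⟩
  · apply dbl_le
    apply gamma_three_le
    obtain ⟨u, hu, w⟩ := commutator_le_leftPull gC_mem
    refine ⟨comm u gC, ?_, ?_⟩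
    · rw [comm_mem_iff']
      exact Subgroup.commutator_mem_commutator hu gC_mem
    · simpa [comm, gD] using w.comm IsPair.C

/-! ### Coordinates on `γ₃ / G''` -/

/-- The quotient of `G` by its second derived subgroup. -/
abbrev Gpp : Type := G ⧸ dbl (gamma G 3)

theorem commute_mod_dbl {x y : G} (hx : x ∈ commutator G) (hy : y ∈ commutator G) :
    Commute (x : Gpp) (y : Gpp) := by
  rw [← commutatorElement_mem_iff, ← second_derived]
  exact Subgroup.commutator_mem_commutator hx hy

/-- The bracket of `⟨p, q⟩` with `⟨a, 1⟩` is `⟨⁅p, a⁆, 1⟩`, and `p` is a power of `a` modulo `G'`.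
-/
theorem commute_B_mod_dbl {x : G} (hx : x ∈ commutator G) :
    Commute (x : Gpp) (gB : Gpp) := by
  rw [← commutatorElement_mem_iff]
  obtain ⟨k, p, q, w, hp, hq⟩ := exists_isPair_of_mem_commutator hx
  refine ⟨_, bracket_mem_gamma_three hp (q := gA) (l := 1) (by simp), 1, one_mem _, ?_⟩
  simpa using w.bracket IsPair.B

/-- The element `⟨c, 1⟩`. -/
def gU : G := (gB⁻¹ * (gC * gC * gD) * gB)⁻¹

/-- The element `⟨1, c⟩`. -/
def gV : G := gA⁻¹ * gU * gA

/-- The element `⟨c, c⁻¹⟩`. -/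
def gF : G := gU * gV⁻¹

attribute [irreducible] gU gV gF

theorem conjB_C : gB⁻¹ * gC * gB = gC := by
  rw [mul_assoc, commute_C_B.eq, inv_mul_cancel_left]

theorem IsPair.U : IsPair gU gC 1 := by
  have h := IsPair.C_sq_mul_D.conjB.inv
  rw [show (gA⁻¹ * (gA * gC⁻¹ * gA⁻¹) * gA)⁻¹ = gC by group, inv_one] at h
  rwa [gU]

theorem IsPair.V : IsPair gV 1 gC := by
  have h := IsPair.U.conjA
  rw [conjB_C] at h
  rwa [gV]

theorem IsPair.F : IsPair gF gC gC⁻¹ := by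
  have h := IsPair.U.mul IsPair.V.inv
  rw [inv_one, mul_one, one_mul] at h
  rwa [gF]

theorem gD_mem_commutator : gD ∈ commutator G := gamma_three_le_commutator gD_mem

theorem gE_mem_gamma_four : gE ∈ gamma G 4 := by
  rw [gE, comm_mem_iff', gamma_succ 3 (by norm_num)]
  exact Subgroup.commutator_mem_commutator gD_mem trivial

theorem gU_mem : gU ∈ commutator G := mem_of_mem_leftPull IsPair.U (commutator_le_leftPull gC_mem)

theorem gV_mem : gV ∈ commutator G := by
  have h := (inferInstance : (commutator G).Normal).conj_mem _ gU_mem gA⁻¹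
  rw [inv_inv] at h
  rwa [gV]

theorem gF_mem_commutator : gF ∈ commutator G := by
  rw [gF]
  exact mul_mem gU_mem (inv_mem gV_mem)

theorem conjA_F : gA⁻¹ * gF * gA = gF⁻¹ := by
  have h := IsPair.F.conjA
  rw [conjB_C] at h
  exact h.eq (by simpa using IsPair.F.inv)

theorem conjA_C : gA⁻¹ * gC * gA = gC * gD := by
  simp [gD, comm, mul_assoc]

theorem conjA_D : gA⁻¹ * gD * gA = gD * gE := by
  simp [gE, comm, mul_assoc]

/-- Modulo `G''` the conjugation by `b` in the definition of `⟨c, 1⟩` disappears, so `⟨c, 1⟩ ≡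
(c²d)⁻¹`; its conjugate by `a` is `⟨1, c⟩ ≡ ((cd)²de)⁻¹`, and `G'` is commutative there. -/
theorem mk_F : (gF : Gpp) = (gD : Gpp) * (gD : Gpp) * (gE : Gpp) := by
  have hX : gC * gC * gD ∈ commutator G := mul_mem (mul_mem gC_mem gC_mem) gD_mem_commutator
  have hU : (gU : Gpp) = ((gC * gC * gD : G) : Gpp)⁻¹ := by
    have h := (commute_B_mod_dbl hX).eq
    rw [gU]
    simp only [QuotientGroup.mk_inv, QuotientGroup.mk_mul] at h ⊢
    rw [mul_assoc (gB : Gpp)⁻¹, h, inv_mul_cancel_left]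
  have hV : (gV : Gpp) = ((gC * gD * (gC * gD) * (gD * gE) : G) : Gpp)⁻¹ := by
    have h : (gA : Gpp)⁻¹ * ((gC * gC * gD : G) : Gpp)⁻¹ * (gA : Gpp) =
        ((gC * gD * (gC * gD) * (gD * gE) : G) : Gpp)⁻¹ := by
      rw [← conjA_C, ← conjA_D]
      simp only [QuotientGroup.mk_inv, QuotientGroup.mk_mul]
      group
    rw [gV, QuotientGroup.mk_mul, QuotientGroup.mk_mul, QuotientGroup.mk_inv, hU, h]
  have hCD := (commute_mod_dbl gC_mem gD_mem_commutator).eq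
  rw [gF, QuotientGroup.mk_mul, QuotientGroup.mk_inv, hU, hV, inv_inv, inv_mul_eq_iff_eq_mul]
  simp only [QuotientGroup.mk_mul]
  simp only [mul_assoc]
  congr 1
  rw [← mul_assoc (gD : Gpp) (gC : Gpp), ← hCD, mul_assoc]

theorem commute_D_F : Commute (gD : Gpp) (gF : Gpp) :=
  commute_mod_dbl gD_mem_commutator gF_mem_commutator

theorem mk_E : (gE : Gpp) = (gD : Gpp) ^ (-2 : ℤ) * (gF : Gpp) := by
  rw [mk_F]
  group

/-- `Coord g x y` says that `g` is `d ^ x f ^ y` modulo the second derived subgroup. -/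
def Coord (g : G) (x y : ℤ) : Prop := (g : Gpp) = (gD : Gpp) ^ x * (gF : Gpp) ^ y

namespace Coord

variable {g h : G} {x y x' y' : ℤ}

theorem of_mem (hg : g ∈ dbl (gamma G 3)) : Coord g 0 0 := by
  simpa [Coord] using hg

theorem mul (w : Coord g x y) (w' : Coord h x' y') : Coord (g * h) (x + x') (y + y') := by
  rw [Coord] at *
  rw [QuotientGroup.mk_mul, w, w', zpow_add, zpow_add,
    (commute_D_F.zpow_zpow x' y).symm.mul_mul_mul_comm]

theorem inv (w : Coord g x y) : Coord g⁻¹ (-x) (-y) := by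
  rw [Coord] at *
  rw [QuotientGroup.mk_inv, w, mul_inv_rev, zpow_neg, zpow_neg,
    ((commute_D_F.zpow_zpow x y).inv_inv).eq]

theorem D : Coord gD 1 0 := by simp [Coord]

theorem F : Coord gF 0 1 := by simp [Coord]

theorem zpow (w : Coord g x y) (n : ℤ) : Coord (g ^ n) (n * x) (n * y) := by
  rw [Coord] at *
  rw [QuotientGroup.mk_zpow, w, (commute_D_F.zpow_zpow x y).mul_zpow, ← zpow_mul, ← zpow_mul,
    mul_comm x, mul_comm y]

theorem zpow_mul_zpow (x y : ℤ) : Coord (gD ^ x * gF ^ y) x y := by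
  simpa using (D.zpow x).mul (F.zpow y)

theorem exists_eq (w : Coord g x y) : ∃ t ∈ dbl (gamma G 3), g = gD ^ x * gF ^ y * t := by
  refine ⟨(gD ^ x * gF ^ y)⁻¹ * g, ?_, by group⟩
  rw [← QuotientGroup.eq]
  exact (zpow_mul_zpow x y).trans w.symm

theorem E : Coord gE (-2) 1 := by
  rw [Coord, mk_E, zpow_one]

theorem of_conj (s : G) (hD : Coord (s⁻¹ * gD * s) x y) (hF : Coord (s⁻¹ * gF * s) x' y')
    {m n : ℤ} (w : Coord g m n) : Coord (s⁻¹ * g * s) (m * x + n * x') (m * y + n * y') := by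
  obtain ⟨t, ht, rfl⟩ := w.exists_eq
  have := ((hD.zpow m).mul (hF.zpow n)).mul
    (of_mem (by simpa using (dbl_normal (gamma G 3)).conj_mem t ht s⁻¹))
  rw [add_zero, add_zero] at this
  convert this using 1
  have hc (z : G) (k : ℤ) : (s⁻¹ * z * s) ^ k = s⁻¹ * z ^ k * s := by
    simpa using conj_zpow (a := s⁻¹) (b := z) (i := k)
  rw [hc, hc]
  group

/-- From `e ≡ d⁻²f` one gets `a⁻¹da = de ≡ d⁻¹f`, while `a⁻¹fa = f⁻¹` because `a` swaps the
coordinates of `⟨c, c⁻¹⟩`. -/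
theorem conjA (w : Coord g x y) : Coord (gA⁻¹ * g * gA) (-x) (x - y) := by
  have hD : Coord (gA⁻¹ * gD * gA) (-1) 1 := by
    rw [conjA_D]
    simpa using D.mul E
  have hF : Coord (gA⁻¹ * gF * gA) 0 (-1) := by
    rw [conjA_F]
    simpa using F.inv
  have := of_conj gA hD hF w
  convert this using 1 <;> ring

theorem conjA_inv (w : Coord g x y) : Coord (gA * g * gA⁻¹) (-x) (-x - y) := by
  have hF : gA * gF * gA⁻¹ = gF⁻¹ := by
    have h : gF = gA * gF⁻¹ * gA⁻¹ := by rw [← conjA_F]; group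
    rw [← inv_inj, inv_inv]
    simpa [mul_assoc] using h.symm
  have hD : Coord (gA * gD * gA⁻¹) (-1) (-1) := by
    have h₁ : (gA : Gpp)⁻¹ * gD * gA = (gD : Gpp) ^ (-1 : ℤ) * gF ^ (1 : ℤ) :=
      (conjA (x := 1) (y := 0) D)
    have h₂ : (gA : Gpp) * gF * (gA : Gpp)⁻¹ = (gF : Gpp)⁻¹ :=
      congrArg (QuotientGroup.mk' (dbl (gamma G 3))) hF
    have h₃ : (gD : Gpp) = (gA * (gD : Gpp) * (gA : Gpp)⁻¹)⁻¹ * (gF : Gpp)⁻¹ := by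
      rw [← h₂]
      calc (gD : Gpp) = gA * ((gA : Gpp)⁻¹ * gD * gA) * (gA : Gpp)⁻¹ := by group
        _ = _ := by rw [h₁]; group
    have h₄ : (gA : Gpp) * gD * (gA : Gpp)⁻¹ = (gF : Gpp)⁻¹ * (gD : Gpp)⁻¹ := by
      rw [eq_mul_inv_iff_mul_eq, ← eq_inv_mul_iff_mul_eq]
      exact h₃
    rw [Coord, zpow_neg_one, zpow_neg_one, (commute_D_F.inv_inv).eq]
    exact h₄
  have hF' : Coord (gA * gF * gA⁻¹) 0 (-1) := by
    rw [hF]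
    simpa using F.inv
  have := of_conj gA⁻¹ (by simpa using hD) (by simpa using hF') w
  rw [inv_inv] at this
  convert this using 1 <;> ring

theorem mem_commutator (w : Coord g x y) : g ∈ commutator G := by
  obtain ⟨t, ht, rfl⟩ := w.exists_eq
  refine mul_mem (mul_mem (zpow_mem gD_mem_commutator _) (zpow_mem gF_mem_commutator _)) ?_
  rw [← second_derived] at ht
  exact Subgroup.commutator_le_left _ _ ht

theorem of_commute {s : G} (w : Coord g x y) (h : Commute (g : Gpp) (s : Gpp)) :
    Coord (s⁻¹ * g * s) x y := by
  rw [Coord] at *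
  rw [QuotientGroup.mk_mul, QuotientGroup.mk_mul, QuotientGroup.mk_inv, mul_assoc, h.eq,
    inv_mul_cancel_left, w]

theorem conjB (w : Coord g x y) : Coord (gB⁻¹ * g * gB) x y :=
  w.of_commute (commute_B_mod_dbl w.mem_commutator)

theorem conjB_inv (w : Coord g x y) : Coord (gB * g * gB⁻¹) x y := by
  simpa using w.of_commute (s := gB⁻¹) (by
    simpa using (commute_B_mod_dbl w.mem_commutator).inv_right)

end Coord

theorem exists_coord {g : G} (hg : g ∈ gamma G 3) : ∃ x y, Coord g x y := by
  let T : Subgroup G :=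
    { carrier := {g | ∃ x y, Coord g x y}
      one_mem' := ⟨0, 0, Coord.of_mem (one_mem _)⟩
      mul_mem' := by
        rintro _ _ ⟨x, y, w⟩ ⟨x', y', w'⟩
        exact ⟨_, _, w.mul w'⟩
      inv_mem' := by
        rintro _ ⟨x, y, w⟩
        exact ⟨_, _, w.inv⟩ }
  have hT : T.Normal := by
    apply normal_of_conj
    · rintro _ ⟨x, y, w⟩
      exact ⟨_, _, w.conjA⟩
    · rintro _ ⟨x, y, w⟩
      exact ⟨_, _, w.conjA_inv⟩
    · rintro _ ⟨x, y, w⟩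
      exact ⟨_, _, w.conjB⟩
    · rintro _ ⟨x, y, w⟩
      exact ⟨_, _, w.conjB_inv⟩
  exact gamma_three_le (M := T) ⟨1, 0, Coord.D⟩ hg

theorem dbl_gamma_three_le : dbl (gamma G 3) ≤ gamma G 3 := by
  rw [← second_derived, gamma_succ 2 (by norm_num), gamma_two]
  exact Subgroup.commutator_mono le_rfl le_top

theorem dbl_gamma_three_le_four : dbl (gamma G 3) ≤ gamma G 4 := by
  rw [← second_derived, ← gamma_two]
  exact commutator_gamma_le 2 2 (by norm_num) (by norm_num)

theorem gF_mem : gF ∈ gamma G 3 := by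
  have h : gD * gD * gE ∈ gamma G 3 := mul_mem (mul_mem gD_mem gD_mem)
    (gamma_antitone (by norm_num) gE_mem_gamma_four)
  have h' : (gF : Gpp) = ((gD * gD * gE : G) : Gpp) := mk_F
  rw [eq_comm, QuotientGroup.eq] at h'
  simpa [mul_assoc] using mul_mem h (dbl_gamma_three_le h')

theorem IsPair.zpow_D_mul_zpow_F (x y : ℤ) :
    IsPair (gD ^ x * gF ^ y) ((gA⁻¹ * (gA * gC)⁻¹) ^ x * gC ^ y)
      (((gA * gC) * (gA * gC)) ^ x * gC⁻¹ ^ y) :=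
  (IsPair.D.zpow x).mul (IsPair.F.zpow y)

theorem mk_left_D_zpow (x y : ℤ) : (((gA⁻¹ * (gA * gC)⁻¹) ^ x * gC ^ y : G) : G3) =
    (gA : G3) ^ (-2 * x) * (gC : G3) ^ (y - x) := by
  have h := commute_mod_gamma_three gC_mem gA
  have h' : (gA : G3)⁻¹ * ((gA : G3) * gC)⁻¹ = (gA : G3) ^ (-2 : ℤ) * (gC : G3)⁻¹ := by
    rw [mul_inv_rev, (h.inv_inv).eq]
    group
  simp only [QuotientGroup.mk_mul, QuotientGroup.mk_zpow, QuotientGroup.mk_inv]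
  rw [h', ((h.symm.zpow_left _).inv_right).mul_zpow, ← zpow_mul, inv_zpow', mul_assoc, ← zpow_add]
  congr 2
  ring

theorem mk_right_D_zpow (x y : ℤ) : ((((gA * gC) * (gA * gC)) ^ x * gC⁻¹ ^ y : G) : G3) =
    (gA : G3) ^ (2 * x) * (gC : G3) ^ (2 * x - y) := by
  have h := commute_mod_gamma_three gC_mem gA
  simp only [QuotientGroup.mk_mul, QuotientGroup.mk_zpow, QuotientGroup.mk_inv]
  rw [← pow_two, h.symm.mul_pow, (h.symm.pow_pow _ _).mul_zpow, inv_zpow', mul_assoc,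
    ← zpow_natCast, ← zpow_natCast, ← zpow_mul, ← zpow_mul, ← zpow_add]
  push_cast
  rfl

theorem ab_A_injective {m : ℤ} (h : (gA : Ab) ^ m = 1) : m = 0 :=
  (ab_injective (m := m) (n := 0) (by simpa using h)).1

theorem ab_of_G3 {m n k : ℤ} {g : G} (h : (g : G3) = (gA : G3) ^ m * (gC : G3) ^ n)
    (hg : (g : Ab) = (gA : Ab) ^ k) : k = m := by
  have h' : (g : G3) = ((gA ^ m * gC ^ n : G) : G3) := h
  rw [QuotientGroup.eq] at h'
  have h'' := gamma_three_le_commutator h'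
  rw [← QuotientGroup.eq] at h''
  change (g : Ab) = ((gA ^ m * gC ^ n : G) : Ab) at h''
  rw [QuotientGroup.mk_mul, QuotientGroup.mk_zpow, QuotientGroup.mk_zpow, ab_C, one_zpow,
    mul_one, hg, ← mul_inv_eq_one, ← zpow_neg, ← zpow_add] at h''
  have := ab_A_injective h''
  omega

/-- Write `cᵏ ≡ dˣ fʸ` modulo `γ₃ × γ₃` and compare coordinates modulo `γ₃`. The exponents of `a`
give `k = -2x`; the first coordinate gives `c^(y-x) ∈ γ₃`, the second `cʸ ∈ γ₃`, hence `cˣ ∈ γ₃`. -/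
theorem C_descent {k : ℤ} (h : gC ^ k ∈ gamma G 3) :
    ∃ x : ℤ, k = -2 * x ∧ gC ^ x ∈ gamma G 3 := by
  obtain ⟨x, y, w⟩ := exists_coord h
  obtain ⟨t, ⟨p, hp, q, hq, wt⟩, ht⟩ := w.exists_eq
  have w₁ := IsPair.C.zpow k
  have w₂ := (IsPair.zpow_D_mul_zpow_F x y).mul wt
  rw [← ht] at w₂
  obtain ⟨h₁, h₂⟩ := w₁.inj w₂
  have hC := commute_mod_gamma_three gC_mem gA
  have e₁ : ((gA ^ k : G) : G3) = (gA : G3) ^ (-2 * x) * (gC : G3) ^ (y - x) := by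
    rw [h₁, QuotientGroup.mk_mul, (QuotientGroup.eq_one_iff p).2 hp, mul_one, mk_left_D_zpow]
  have hk := ab_of_G3 (k := k) e₁ (by simp)
  have e₂ : (((gA * gC)⁻¹ ^ k : G) : G3) = (gA : G3) ^ (2 * x) * (gC : G3) ^ (2 * x - y) := by
    rw [h₂, QuotientGroup.mk_mul, (QuotientGroup.eq_one_iff q).2 hq, mul_one, mk_right_D_zpow]
  subst hk
  simp only [QuotientGroup.mk_mul, QuotientGroup.mk_zpow, QuotientGroup.mk_inv] at e₁ e₂
  rw [left_eq_mul] at e₁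
  rw [inv_zpow', hC.symm.mul_zpow, show -(-2 * x) = 2 * x by ring, mul_left_cancel_iff,
    zpow_sub, left_eq_mul, inv_eq_one] at e₂
  rw [zpow_sub, e₂, one_mul, inv_eq_one] at e₁
  refine ⟨x, rfl, ?_⟩
  rwa [← QuotientGroup.eq_one_iff]

theorem C_injective {k : ℤ} (h : gC ^ k ∈ gamma G 3) : k = 0 := by
  refine eq_zero_of_two_pow_dvd fun t => ?_
  induction t generalizing k with
  | zero => simp
  | succ t ih =>
    obtain ⟨x, rfl, hx⟩ := C_descent h
    rw [neg_mul, dvd_neg, pow_succ']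
    exact mul_dvd_mul_left 2 (ih hx)

/-- The first coordinate of `dˣ fʸ` is `a^(-2x) c^(y-x)` modulo `γ₃`; the abelianization kills `x`,
and the infinite order of `c` modulo `γ₃` kills `y`. -/
theorem coord_one {x y : ℤ} (h : Coord 1 x y) : x = 0 ∧ y = 0 := by
  have h' : gD ^ x * gF ^ y ∈ dbl (gamma G 3) := by
    rw [← QuotientGroup.eq_one_iff]
    exact Eq.symm h
  have h₁ := ((mem_dbl_iff (IsPair.zpow_D_mul_zpow_F x y)).1 h').1
  rw [← QuotientGroup.eq_one_iff] at h₁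
  have h₂ := mk_left_D_zpow x y
  have hx : (0 : ℤ) = -2 * x := by
    refine ab_of_G3 (g := 1) (n := y - x) ?_ (by simp)
    rw [← h₂, h₁, QuotientGroup.mk_one]
  obtain rfl : x = 0 := by omega
  refine ⟨rfl, C_injective ?_⟩
  rw [← QuotientGroup.eq_one_iff, ← h₁, h₂]
  simp

theorem Coord.unique {g : G} {x y x' y' : ℤ} (w : Coord g x y) (w' : Coord g x' y') :
    x = x' ∧ y = y' := by
  have h := w.mul w'.inv
  rw [mul_inv_cancel] at h
  have := coord_one h
  omega

/-! ### The filtration `H` of `γ₃` and the lengths of its layers -/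

/-- The series `H₀ = H₁ = γ₃`, `Hᵢ₊₁ = Hᵢ² (Hᵢ × Hᵢ)`; here `Hᵢ` turns out to be the intersection
of `γ₃` with the term of the lower `2`-central series of index `2 ^ i + 1`. -/
def H : ℕ → Subgroup G
  | 0 => gamma G 3
  | 1 => gamma G 3
  | n + 2 => squares (H (n + 1)) ⊔ dbl (H (n + 1))

theorem H_zero : H 0 = gamma G 3 := by rw [H]

theorem H_one : H 1 = gamma G 3 := by rw [H]

theorem H_add_two (n : ℕ) : H (n + 2) = squares (H (n + 1)) ⊔ dbl (H (n + 1)) := by rw [H]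

instance H_normal (n : ℕ) : (H n).Normal := by
  induction n using Nat.strong_induction_on with
  | _ n ih =>
    match n, ih with
    | 0, _ => rw [H_zero]; infer_instance
    | 1, _ => rw [H_one]; infer_instance
    | n + 2, ih =>
      rw [H_add_two]
      have h := ih (n + 1) (by omega)
      infer_instance

theorem H_succ_le (n : ℕ) : H (n + 1) ≤ H n := by
  induction n with
  | zero => rw [H_zero, H_one]
  | succ n ih =>
    rw [H_add_two]
    refine sup_le (squares_le_self _) ((dbl_mono ih).trans ?_)
    cases n with
    | zero => rw [H_zero, H_one]; exact dbl_gamma_three_le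
    | succ n => rw [H_add_two]; exact le_sup_right

theorem H_antitone : Antitone H := antitone_nat_of_succ_le H_succ_le

theorem H_le_gamma (n : ℕ) : H n ≤ gamma G 3 := H_zero ▸ H_antitone n.zero_le

theorem dbl_H_le (n : ℕ) : dbl (H n) ≤ H (n + 1) := by
  cases n with
  | zero => rw [H_zero, H_one]; exact dbl_gamma_three_le
  | succ n => rw [H_add_two]; exact le_sup_right

theorem sq_mem_H {n : ℕ} {x : G} (hx : x ∈ H n) : x ^ 2 ∈ H (n + 1) := by
  cases n with
  | zero =>
    rw [H_one, ← H_zero]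
    exact pow_mem hx 2
  | succ n =>
    rw [H_add_two]
    exact Subgroup.mem_sup_left (sq_mem_squares hx)

theorem pow_mem_H {x : G} (hx : x ∈ gamma G 3) (n : ℕ) : x ^ 2 ^ n ∈ H (n + 1) := by
  induction n with
  | zero => rwa [H_one, pow_zero, pow_one]
  | succ n ih =>
    rw [pow_succ, pow_mul]
    exact sq_mem_H ih

/-- The subgroup of `G` stabilizing the two top subtrees. -/
def S : Subgroup G := Subgroup.closure {gA ^ 2, gB} ⊔ commutator G

instance S_normal : S.Normal := Subgroup.Normal.of_commutator_le _ le_sup_right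

theorem gA_sq_mem_S : gA ^ 2 ∈ S := Subgroup.mem_sup_left (Subgroup.subset_closure (by simp))

theorem mem_S_of_mem_commutator {x : G} (hx : x ∈ commutator G) : x ∈ S :=
  Subgroup.mem_sup_right hx

theorem commutator_S_le {X M : Subgroup G} [M.Normal] (hA : ∀ g ∈ X, ⁅g, gA ^ 2⁆ ∈ M)
    (hB : ∀ g ∈ X, ⁅g, gB⁆ ∈ M) (hC : ∀ g ∈ X, ∀ x ∈ commutator G, ⁅g, x⁆ ∈ M) :
    ⁅X, S⁆ ≤ M := by
  apply commutator_sup_right_le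
  · apply commutator_closure_right_le
    rintro h hh _ (rfl | rfl)
    · exact hA h hh
    · exact hB h hh
  · rw [Subgroup.commutator_le]
    exact hC

section Layer

variable (P : Subgroup G)

/-- The subgroups between `Hᵢ` and `Hᵢ₊₁` obtained by repeated commutation with `P`. -/
def layer (i : ℕ) : ℕ → Subgroup G
  | 0 => H i
  | j + 1 => ⁅layer i j, P⁆ ⊔ H (i + 1)

theorem layer_zero (i : ℕ) : layer P i 0 = H i := rfl

theorem layer_succ (i j : ℕ) : layer P i (j + 1) = ⁅layer P i j, P⁆ ⊔ H (i + 1) := rfl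

theorem H_le_layer (i j : ℕ) : H (i + 1) ≤ layer P i j := by
  cases j with
  | zero => exact H_succ_le i
  | succ j => exact le_sup_right

variable [P.Normal]

instance layer_normal (i j : ℕ) : (layer P i j).Normal := by
  induction j with
  | zero => rw [layer_zero]; infer_instance
  | succ j ih => rw [layer_succ]; infer_instance

theorem layer_antitone (i : ℕ) : Antitone (layer P i) := by
  apply antitone_nat_of_succ_le
  intro j
  rw [layer_succ]
  exact sup_le (Subgroup.commutator_le_left _ _) (H_le_layer P i j)

theorem layer_le (i j : ℕ) : layer P i j ≤ H i := layer_antitone P i j.zero_le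

variable {P}

theorem sq_mem_of_mem_layer {i j : ℕ} {w : G} (hw : w ∈ layer P i j) : w ^ 2 ∈ H (i + 1) :=
  sq_mem_H (layer_le P i j hw)

variable (P) in
/-- Commutation with `y` lowers every layer by at least `t` steps. -/
def Raises (i : ℕ) (y : G) (t : ℕ) : Prop :=
  ∀ j, ∀ w ∈ layer P i j, ⁅w, y⁆ ∈ layer P i (j + t)

/-- In `⁅w, y²⁆ = ⁅w, y⁆² ⁅⁅w, y⁆⁻¹, y⁆` the square already lies in `H (i + 1)`, so only the double
commutator counts. The layers behave like modules in characteristic 2, where `(y - 1)² = y² - 1`. -/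
theorem Raises.sq {i t : ℕ} {y : G} (h : Raises P i y t) : Raises P i (y ^ 2) (t * 2) := by
  intro j w hw
  have h₁ := h j w hw
  rw [commutatorElement_sq_right]
  refine mul_mem (H_le_layer P _ _ (sq_mem_of_mem_layer h₁)) ?_
  rw [mul_two, ← add_assoc]
  exact h _ _ (inv_mem h₁)

theorem raises_pow (i : ℕ) {y : G} (hy : y ∈ P) (s : ℕ) : Raises P i (y ^ 2 ^ s) (2 ^ s) := by
  induction s with
  | zero =>
    intro j w hw
    rw [pow_zero, pow_one]
    exact Subgroup.mem_sup_left (Subgroup.commutator_mem_commutator hw hy)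
  | succ s ih =>
    rw [pow_succ, pow_mul]
    exact ih.sq

/-- The square formula is used once in each argument: squares fall into `H (i + 1)`, and what
remains has been lowered by `x` and by `y`, that is by `s + t` steps. -/
theorem bracket_sq_mem {i s t : ℕ} {x y : G} (hx : Raises P i x s) (hy : Raises P i y t)
    (hl : layer P i (s + t) ≤ H (i + 1)) (hxy : ⁅x, y⁆ ∈ H i) : ⁅x ^ 2, y ^ 2⁆ ∈ H (i + 1) := by
  have h₁ : ⁅x ^ 2, y⁆ ∈ layer P i s := by
    rw [commutatorElement_sq_left]
    refine mul_mem (commutatorElement_mem_symm _ ?_) (H_le_layer P _ _ (sq_mem_H hxy))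
    simpa using hx 0 _ hxy
  rw [commutatorElement_sq_right]
  exact mul_mem (sq_mem_of_mem_layer h₁) (hl (hy _ _ (inv_mem h₁)))

end Layer

section DoubleCommutator

variable {W W₁ : Subgroup G} [W₁.Normal]

/-- Elements of `S` act coordinatewise, so one commutator with `S` is one commutator in each
coordinate. -/
theorem commutator_dbl_S_le (h : ⁅W, (⊤ : Subgroup G)⁆ ≤ W₁) : ⁅dbl W, S⁆ ≤ dbl W₁ := by
  have key : ∀ g ∈ dbl W, ∀ s p q : G, IsPair s p q → ⁅g, s⁆ ∈ dbl W₁ := by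
    rintro g ⟨x, hx, y, hy, w⟩ s p q ws
    exact ⟨_, h (Subgroup.commutator_mem_commutator hx trivial), _,
      h (Subgroup.commutator_mem_commutator hy trivial), w.bracket ws⟩
  apply commutator_S_le
  · exact fun g hg => key g hg _ _ _ IsPair.A_sq
  · exact fun g hg => key g hg _ _ _ IsPair.B
  · intro g hg x hx
    obtain ⟨k, p, q, w, -⟩ := exists_isPair_of_mem_commutator hx
    exact key g hg _ _ _ w

/-- `W` modulo `W₁` is central of exponent 2, so modulo `W₁ × W₁` the group `G` acts on `W × W` only
by swapping coordinates. One commutator lands in the diagonal, a second one kills it. -/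
theorem commutator_commutator_dbl_le [W.Normal] (h : ⁅W, (⊤ : Subgroup G)⁆ ≤ W₁)
    (hs : squares W ≤ W₁) : ⁅⁅dbl W, (⊤ : Subgroup G)⁆, (⊤ : Subgroup G)⁆ ≤ dbl W₁ := by
  have hc : ∀ x ∈ W, ∀ g : G, Commute (x : G ⧸ W₁) (g : G ⧸ W₁) := fun x hx g =>
    (commutatorElement_mem_iff W₁ x g).1 (h (Subgroup.commutator_mem_commutator hx trivial))
  have hs' : ∀ x ∈ W, (x : G ⧸ W₁) * (x : G ⧸ W₁) = 1 := fun x hx => by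
    have := (QuotientGroup.eq_one_iff (x ^ 2)).2 (hs (sq_mem_squares hx))
    rwa [pow_two] at this
  have hs'' : ∀ x ∈ W, (x : G ⧸ W₁)⁻¹ = (x : G ⧸ W₁) := fun x hx =>
    inv_eq_of_mul_eq_one_left (hs' x hx)
  have hconj : ∀ x ∈ W, ∀ g : G, ((g⁻¹ * x * g : G) : G ⧸ W₁) = x := fun x hx g => by
    rw [QuotientGroup.mk_mul, QuotientGroup.mk_mul, QuotientGroup.mk_inv, mul_assoc,
      (hc x hx g).eq, inv_mul_cancel_left]
  have hW : W.Normal := inferInstance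
  have hconj' : ∀ x ∈ W, ∀ g : G, g⁻¹ * x * g ∈ W := fun x hx g => by
    simpa using hW.conj_mem x hx g⁻¹
  -- The diagonal of `W × W` modulo `W₁ × W₁`.
  let V : Subgroup G :=
    { carrier := {g | ∃ x ∈ W, ∃ y ∈ W, IsPair g x y ∧ (x : G ⧸ W₁) = y}
      one_mem' := ⟨1, one_mem _, 1, one_mem _, IsPair.one, rfl⟩
      mul_mem' := by
        rintro _ _ ⟨x, hx, y, hy, w, e⟩ ⟨x', hx', y', hy', w', e'⟩
        refine ⟨_, mul_mem hx hx', _, mul_mem hy hy', w.mul w', ?_⟩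
        rw [QuotientGroup.mk_mul, QuotientGroup.mk_mul, e, e']
      inv_mem' := by
        rintro _ ⟨x, hx, y, hy, w, e⟩
        refine ⟨_, inv_mem hx, _, inv_mem hy, w.inv, ?_⟩
        rw [QuotientGroup.mk_inv, QuotientGroup.mk_inv, e] }
  have hV : V.Normal := by
    apply normal_of_conj
    · rintro _ ⟨x, hx, y, hy, w, e⟩
      exact ⟨_, hy, _, hconj' x hx _, w.conjA, by rw [hconj x hx, e]⟩
    · rintro _ ⟨x, hx, y, hy, w, e⟩
      refine ⟨_, hW.conj_mem y hy _, _, hx, w.conjA_inv, ?_⟩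
      have := hconj y hy gB⁻¹
      rw [inv_inv] at this
      rw [this, e]
    · rintro _ ⟨x, hx, y, hy, w, e⟩
      exact ⟨_, hconj' x hx _, _, hy, w.conjB, by rw [hconj x hx, e]⟩
    · rintro _ ⟨x, hx, y, hy, w, e⟩
      refine ⟨_, hW.conj_mem x hx _, _, hy, w.conjB_inv, ?_⟩
      have := hconj x hx gA⁻¹
      rw [inv_inv] at this
      rw [this, e]
  have hcommA (g : G) : comm g gA = g⁻¹ * (gA⁻¹ * g * gA) := by simp [comm, mul_assoc]
  have hcommB (g : G) : comm g gB = g⁻¹ * (gB⁻¹ * g * gB) := by simp [comm, mul_assoc]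
  have h₁ : ⁅dbl W, (⊤ : Subgroup G)⁆ ≤ V := by
    apply commutator_top_le
    · rintro g ⟨x, hx, y, hy, w⟩
      rw [← comm_mem_iff', hcommA]
      refine ⟨_, mul_mem (inv_mem hx) hy, _, mul_mem (inv_mem hy) (hconj' x hx _),
        w.inv.mul w.conjA, ?_⟩
      rw [QuotientGroup.mk_mul, QuotientGroup.mk_mul, hconj x hx, QuotientGroup.mk_inv,
        QuotientGroup.mk_inv, hs'' x hx, hs'' y hy, (hc x hx y).eq]
    · rintro g ⟨x, hx, y, hy, w⟩
      rw [← comm_mem_iff', hcommB]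
      refine ⟨_, mul_mem (inv_mem hx) (hconj' x hx _), _, mul_mem (inv_mem hy) hy,
        w.inv.mul w.conjB, ?_⟩
      rw [QuotientGroup.mk_mul, hconj x hx, QuotientGroup.mk_inv, inv_mul_cancel, inv_mul_cancel,
        QuotientGroup.mk_one]
  refine (Subgroup.commutator_mono h₁ le_rfl).trans ?_
  apply commutator_top_le
  · rintro g ⟨x, hx, y, hy, w, e⟩
    rw [← comm_mem_iff', hcommA]
    refine ⟨_, ?_, _, ?_, w.inv.mul w.conjA⟩
    · rw [← QuotientGroup.eq_one_iff, QuotientGroup.mk_mul, QuotientGroup.mk_inv, e,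
        inv_mul_cancel]
    · rw [← QuotientGroup.eq_one_iff, QuotientGroup.mk_mul, hconj x hx, QuotientGroup.mk_inv, e,
        inv_mul_cancel]
  · rintro g ⟨x, hx, y, hy, w, e⟩
    rw [← comm_mem_iff', hcommB]
    refine ⟨_, ?_, _, ?_, w.inv.mul w.conjB⟩
    · rw [← QuotientGroup.eq_one_iff, QuotientGroup.mk_mul, hconj x hx, QuotientGroup.mk_inv,
        inv_mul_cancel]
    · rw [inv_mul_cancel]
      exact one_mem _

end DoubleCommutator

/-- Normal form of the elements of `Hᵢ₊₁`. -/
def Form (i : ℕ) : Prop :=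
  ∀ g ∈ H (i + 1), ∃ x y : ℤ, ∃ t ∈ dbl (H i), g = gD ^ (2 ^ i * x) * gF ^ (2 ^ i * y) * t

theorem Form.coord {i : ℕ} (hF : Form i) {g : G} (hg : g ∈ H (i + 1)) :
    ∃ x y : ℤ, Coord g (2 ^ i * x) (2 ^ i * y) := by
  obtain ⟨x, y, t, ht, rfl⟩ := hF g hg
  refine ⟨x, y, ?_⟩
  simpa using (Coord.zpow_mul_zpow _ _).mul (Coord.of_mem (dbl_mono (H_le_gamma i) ht))

theorem Form.mem {i : ℕ} (hF : Form i) {g : G} (hg : g ∈ H (i + 1)) {x y : ℤ}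
    (hxy : Coord g (2 ^ (i + 1) * x) (2 ^ (i + 1) * y)) : g ∈ dbl (H i) ⊔ H (i + 2) := by
  obtain ⟨x', y', t, ht, rfl⟩ := hF g hg
  have h := ((Coord.zpow_mul_zpow _ _).mul (Coord.of_mem (dbl_mono (H_le_gamma i) ht))).unique hxy
  rw [add_zero, add_zero] at h
  refine mul_mem (Subgroup.mem_sup_right ?_) (Subgroup.mem_sup_left ht)
  have key : ∀ z ∈ gamma G 3, ∀ n : ℤ, z ^ (2 ^ (i + 1) * n) ∈ H (i + 2) := by
    intro z hz n
    rw [zpow_mul]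
    refine zpow_mem ?_ n
    exact_mod_cast pow_mem_H hz (i + 1)
  rw [h.1, h.2]
  exact mul_mem (key _ gD_mem _) (key _ gF_mem _)

/-- On coordinates `a²` acts by `(x, y) ↦ (x, y - 2x)`, while `b` and `G'` act trivially, so every
commutator gains a factor 2. -/
theorem Form.commutator_S_le {i : ℕ} (hF : Form i) : ⁅H (i + 1), S⁆ ≤ dbl (H i) ⊔ H (i + 2) := by
  have hN : ∀ g ∈ H (i + 1), ∀ s : G, g⁻¹ * (s⁻¹ * g * s) ∈ H (i + 1) := fun g hg s =>
    mul_mem (inv_mem hg) (by simpa using (H_normal (i + 1)).conj_mem g hg s⁻¹)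
  have hcomm (g s : G) : comm g s = g⁻¹ * (s⁻¹ * g * s) := by simp [comm, mul_assoc]
  apply Basilica.commutator_S_le
  · intro g hg
    rw [← comm_mem_iff', hcomm]
    obtain ⟨x, y, w⟩ := hF.coord hg
    refine hF.mem (hN g hg _) (x := 0) (y := -x) ?_
    have := w.inv.mul w.conjA.conjA
    convert this using 1
    · simp [pow_two, mul_assoc]
    · ring
    · rw [pow_succ]; ring
  · intro g hg
    rw [← comm_mem_iff', hcomm]
    obtain ⟨x, y, w⟩ := hF.coord hg
    refine hF.mem (hN g hg _) (x := 0) (y := 0) ?_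
    simpa [mul_assoc] using w.inv.mul w.conjB
  · intro g hg s hs
    rw [← comm_mem_iff', hcomm]
    obtain ⟨x, y, w⟩ := hF.coord hg
    refine hF.mem (hN g hg _) (x := 0) (y := 0) ?_
    simpa [mul_assoc] using w.inv.mul (w.of_commute (commute_mod_dbl w.mem_commutator hs))

/-- Commutation with `a` sends `(x, y)` to `(-2x, x - 2y)`. Once, it gains a factor 2 in the first
coordinate, which is what `T` records; twice, in both. -/
theorem Form.commutator_commutator_le {i : ℕ} (hF : Form i) :
    ⁅⁅H (i + 1), (⊤ : Subgroup G)⁆, (⊤ : Subgroup G)⁆ ≤ dbl (H i) ⊔ H (i + 2) := by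
  have hH := H_normal (i + 1)
  have hconj : ∀ g ∈ H (i + 1), ∀ s : G, s⁻¹ * g * s ∈ H (i + 1) := fun g hg s => by
    simpa using hH.conj_mem g hg s⁻¹
  have hcomm (g s : G) : comm g s = g⁻¹ * (s⁻¹ * g * s) := by simp [comm, mul_assoc]
  let T : Subgroup G :=
    { carrier := {g | g ∈ H (i + 1) ∧ ∃ x y : ℤ, Coord g (2 ^ (i + 1) * x) y}
      one_mem' := ⟨one_mem _, 0, 0, by simpa using Coord.of_mem (one_mem _)⟩
      mul_mem' := by
        rintro _ _ ⟨h, x, y, w⟩ ⟨h', x', y', w'⟩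
        exact ⟨mul_mem h h', x + x', y + y', by rw [mul_add]; exact w.mul w'⟩
      inv_mem' := by
        rintro _ ⟨h, x, y, w⟩
        exact ⟨inv_mem h, -x, -y, by rw [mul_neg]; exact w.inv⟩ }
  have hT : T.Normal := by
    apply normal_of_conj
    · rintro _ ⟨h, x, y, w⟩
      exact ⟨hconj _ h _, -x, _, by rw [mul_neg]; exact w.conjA⟩
    · rintro _ ⟨h, x, y, w⟩
      exact ⟨hH.conj_mem _ h _, -x, _, by rw [mul_neg]; exact w.conjA_inv⟩
    · rintro _ ⟨h, x, y, w⟩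
      exact ⟨hconj _ h _, x, _, w.conjB⟩
    · rintro _ ⟨h, x, y, w⟩
      exact ⟨hH.conj_mem _ h _, x, _, w.conjB_inv⟩
  have h₁ : ⁅H (i + 1), (⊤ : Subgroup G)⁆ ≤ T := by
    apply commutator_top_le
    · intro g hg
      rw [← comm_mem_iff', hcomm]
      obtain ⟨x, y, w⟩ := hF.coord hg
      refine ⟨mul_mem (inv_mem hg) (hconj g hg _), -x, -(2 ^ i * y) + (2 ^ i * x - 2 ^ i * y), ?_⟩
      have := w.inv.mul w.conjA
      convert this using 1
      rw [pow_succ]; ring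
    · intro g hg
      rw [← comm_mem_iff', hcomm]
      obtain ⟨x, y, w⟩ := hF.coord hg
      refine ⟨mul_mem (inv_mem hg) (hconj g hg _), 0, 0, ?_⟩
      simpa using w.inv.mul w.conjB
  refine (Subgroup.commutator_mono h₁ le_rfl).trans ?_
  apply commutator_top_le
  · rintro g ⟨hg, x, y, w⟩
    rw [← comm_mem_iff', hcomm]
    obtain ⟨x', y', w'⟩ := hF.coord hg
    obtain ⟨-, rfl⟩ := w.unique w'
    refine hF.mem (mul_mem (inv_mem hg) (hconj g hg _)) (x := -(2 * x)) (y := x - y') ?_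
    have := w.inv.mul w.conjA
    convert this using 1
    · ring
    · rw [pow_succ]; ring
  · rintro g ⟨hg, x, y, w⟩
    rw [← comm_mem_iff', hcomm]
    refine hF.mem (mul_mem (inv_mem hg) (hconj g hg _)) (x := 0) (y := 0) ?_
    simpa using w.inv.mul w.conjB

/-- The layer between `Hᵢ` and `Hᵢ₊₁` has length at most `2 ^ (i + 1) - 2`. -/
def LenTop (i : ℕ) : Prop := ∀ j, 2 ^ (i + 1) ≤ j + 2 → layer ⊤ i j ≤ H (i + 1)

/-- The layer between `Hᵢ` and `Hᵢ₊₁` has length at most `2 ^ i` with respect to `S`. -/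
def LenS (i : ℕ) : Prop := layer S i (2 ^ i) ≤ H (i + 1)

theorem squares_layer_le {i j : ℕ} : squares (layer ⊤ i j) ≤ layer ⊤ i (j + 1) :=
  squares_le.2 fun _ hx => H_le_layer _ _ _ (sq_mem_of_mem_layer hx)

/-- Two commutators lead from `H (i + 1)` into `dbl (H i)` modulo `H (i + 2)`; each step of the
layer below then costs two more, for a total of `2 + 2 (2 ^ (i + 1) - 2) = 2 ^ (i + 2) - 2`. -/
theorem Form.lenTop {i : ℕ} (hF : Form i) (hL : LenTop i) : LenTop (i + 1) := by
  have key : ∀ j, layer ⊤ (i + 1) (2 + 2 * j) ≤ dbl (layer ⊤ i j) ⊔ H (i + 2) := by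
    intro j
    induction j with
    | zero =>
      refine sup_le (commutator_sup_left_le ?_ ?_) le_sup_right
      · exact hF.commutator_commutator_le
      · exact (Subgroup.commutator_le_left _ _).trans le_sup_right
    | succ j ih =>
      rw [show 2 + 2 * (j + 1) = 2 + 2 * j + 1 + 1 by ring, layer_succ, layer_succ]
      refine sup_le (commutator_sup_left_le ?_ ?_) le_sup_right
      · have h₁ : ⁅layer ⊤ (i + 1) (2 + 2 * j), (⊤ : Subgroup G)⁆ ≤
            ⁅dbl (layer ⊤ i j), (⊤ : Subgroup G)⁆ ⊔ H (i + 2) := by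
          refine (Subgroup.commutator_mono ih le_rfl).trans (commutator_sup_left_le le_sup_left ?_)
          exact (Subgroup.commutator_le_left _ _).trans le_sup_right
        refine (Subgroup.commutator_mono h₁ le_rfl).trans (commutator_sup_left_le ?_ ?_)
        · refine (commutator_commutator_dbl_le ?_ squares_layer_le).trans le_sup_left
          rw [layer_succ]
          exact le_sup_left
        · exact (Subgroup.commutator_le_left _ _).trans le_sup_right
      · exact (Subgroup.commutator_le_left _ _).trans le_sup_right
  intro j hj
  have h2 : 2 ^ (i + 1) ≥ 2 := by rw [pow_succ]; have := Nat.one_le_two_pow (n := i); omega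
  have hp : 2 ^ (i + 1 + 1) = 2 ^ (i + 1) * 2 := pow_succ _ _
  refine (layer_antitone ⊤ (i + 1) (show 2 + 2 * (2 ^ (i + 1) - 2) ≤ j by omega)).trans
    ((key _).trans (sup_le ?_ le_rfl))
  exact (dbl_mono (hL _ (by omega))).trans (dbl_H_le _)

/-- With `S` in place of `G` each stage costs one commutator: `1 + (2 ^ (i + 1) - 2) ≤ 2 ^ (i + 1)`.
-/
theorem Form.lenS {i : ℕ} (hF : Form i) (hL : LenTop i) : LenS (i + 1) := by
  have key : ∀ j, layer S (i + 1) (1 + j) ≤ dbl (layer ⊤ i j) ⊔ H (i + 2) := by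
    intro j
    induction j with
    | zero => exact sup_le hF.commutator_S_le le_sup_right
    | succ j ih =>
      rw [← add_assoc, layer_succ]
      refine sup_le ?_ le_sup_right
      refine (Subgroup.commutator_mono ih le_rfl).trans (commutator_sup_left_le ?_ ?_)
      · refine (commutator_dbl_S_le ?_).trans le_sup_left
        rw [layer_succ]
        exact le_sup_left
      · exact (Subgroup.commutator_le_left _ _).trans le_sup_right
  have h2 : 2 ^ (i + 1) ≥ 2 := by rw [pow_succ]; have := Nat.one_le_two_pow (n := i); omega
  refine (layer_antitone S (i + 1) (show 1 + (2 ^ (i + 1) - 2) ≤ 2 ^ (i + 1) by omega)).trans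
    ((key _).trans (sup_le ?_ le_rfl))
  exact (dbl_mono (hL _ (by omega))).trans (dbl_H_le _)

/-- Powers of elements of `S` commuting modulo `γ₃` commute modulo the groups `Hᵢ`. -/
def PowS (i : ℕ) : Prop :=
  ∀ x ∈ S, ∀ y ∈ S, ⁅x, y⁆ ∈ gamma G 3 → ⁅x ^ 2 ^ i, y ^ 2 ^ i⁆ ∈ H (i + 1)

/-- The elements `x ^ 2 ^ i` and `y ^ 2 ^ i` each lower the layer by `2 ^ i` steps, which together
exhaust its length. -/
theorem PowS.succ {i : ℕ} (h : PowS i) (hL : LenS (i + 1)) : PowS (i + 1) := by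
  intro x hx y hy hxy
  rw [pow_succ, pow_mul, pow_mul]
  refine bracket_sq_mem (raises_pow (i + 1) hx i) (raises_pow (i + 1) hy i) ?_ (h x hx y hy hxy)
  rw [← two_mul, ← pow_succ']
  exact hL

theorem LenS.bracket_mem {i : ℕ} (hL : LenS i) {x s : G} (hx : x ∈ H i) (hs : s ∈ S) :
    ⁅x, s ^ 2 ^ i⁆ ∈ H (i + 1) := by
  have := raises_pow i hs i 0 x hx
  rw [zero_add] at this
  exact hL this

theorem left_D_mem_S : gA⁻¹ * (gA * gC)⁻¹ ∈ S := by
  rw [show gA⁻¹ * (gA * gC)⁻¹ = (gA ^ 2)⁻¹ * (gA * gC⁻¹ * gA⁻¹) by group]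
  refine mul_mem (inv_mem gA_sq_mem_S) (mem_S_of_mem_commutator ?_)
  exact (inferInstance : (commutator G).Normal).conj_mem _ (inv_mem gC_mem) _

theorem right_D_mem_S : (gA * gC) * (gA * gC) ∈ S := by
  rw [show (gA * gC) * (gA * gC) = gA ^ 2 * (gA⁻¹ * gC * gA⁻¹⁻¹) * gC by group]
  refine mul_mem (mul_mem gA_sq_mem_S (mem_S_of_mem_commutator ?_)) (mem_S_of_mem_commutator gC_mem)
  exact (inferInstance : (commutator G).Normal).conj_mem _ gC_mem _

theorem bracket_C_mem {x : G} : ⁅x, gC⁆ ∈ gamma G 3 :=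
  (commutatorElement_mem_iff _ _ _).2 (commute_mod_gamma_three gC_mem x).symm

theorem bracket_C_inv_mem {x : G} : ⁅x, gC⁻¹⁆ ∈ gamma G 3 :=
  (commutatorElement_mem_iff _ _ _).2 (commute_mod_gamma_three (inv_mem gC_mem) x).symm

/-- Modulo `dbl (H (i + 1))` the powers `d ^ 2 ^ i` and `f ^ 2 ^ i` commute with each other and with
`dbl (H i)`, which has exponent 2. Squaring a normal form thus doubles its exponents and removes its
tail; commutation is checked in coordinates by `PowS` and `LenS`. -/
theorem Form.succ {i : ℕ} (hF : Form i) (hL : LenS i) (hP : PowS i) : Form (i + 1) := by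
  have hC := mem_S_of_mem_commutator gC_mem
  have hDF : Commute ((gD ^ 2 ^ i : G) : G ⧸ dbl (H (i + 1))) ((gF ^ 2 ^ i : G) :) := by
    rw [← commutatorElement_mem_iff]
    exact ⟨_, hP _ left_D_mem_S _ hC bracket_C_mem, _,
      hP _ right_D_mem_S _ (inv_mem hC) bracket_C_inv_mem,
      (IsPair.D.pow (2 ^ i)).bracket (IsPair.F.pow (2 ^ i))⟩
  have hDt : ∀ t ∈ dbl (H i), Commute (t : G ⧸ dbl (H (i + 1))) ((gD ^ 2 ^ i : G) :) := by
    rintro t ⟨x, hx, y, hy, w⟩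
    rw [← commutatorElement_mem_iff]
    exact ⟨_, hL.bracket_mem hx left_D_mem_S, _, hL.bracket_mem hy right_D_mem_S,
      w.bracket (IsPair.D.pow (2 ^ i))⟩
  have hFt : ∀ t ∈ dbl (H i), Commute (t : G ⧸ dbl (H (i + 1))) ((gF ^ 2 ^ i : G) :) := by
    rintro t ⟨x, hx, y, hy, w⟩
    rw [← commutatorElement_mem_iff]
    exact ⟨_, hL.bracket_mem hx hC, _, hL.bracket_mem hy (inv_mem hC),
      w.bracket (IsPair.F.pow (2 ^ i))⟩
  have htt : ∀ t ∈ dbl (H i), (t : G ⧸ dbl (H (i + 1))) ^ 2 = 1 := by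
    rintro t ⟨x, hx, y, hy, w⟩
    rw [← QuotientGroup.mk_pow, QuotientGroup.eq_one_iff]
    exact ⟨_, sq_mem_H hx, _, sq_mem_H hy, w.pow 2⟩
  simp only [QuotientGroup.mk_pow] at hDF hDt hFt
  have hDF' (x y : ℤ) : Commute ((gD : G ⧸ dbl (H (i + 1))) ^ (2 ^ i * x))
      ((gF : G ⧸ dbl (H (i + 1))) ^ (2 ^ i * y)) := by
    have := hDF.zpow_zpow x y
    rw [← zpow_natCast, ← zpow_natCast, ← zpow_mul, ← zpow_mul] at this
    exact_mod_cast this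
  have hp : (2 : ℤ) ^ (i + 1) = 2 ^ i * 2 := pow_succ _ _
  let T : Subgroup G :=
    { carrier := {g | ∃ x y : ℤ, (g : G ⧸ dbl (H (i + 1))) =
        (gD : G ⧸ dbl (H (i + 1))) ^ (2 ^ (i + 1) * x) *
          (gF : G ⧸ dbl (H (i + 1))) ^ (2 ^ (i + 1) * y)}
      one_mem' := ⟨0, 0, by simp⟩
      mul_mem' := by
        rintro g h ⟨x, y, e⟩ ⟨x', y', e'⟩
        refine ⟨x + x', y + y', ?_⟩
        rw [QuotientGroup.mk_mul, e, e', mul_add, mul_add, zpow_add, zpow_add]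
        refine Commute.mul_mul_mul_comm ?_ _ _
        rw [hp, mul_assoc, mul_assoc]
        exact (hDF' _ _).symm
      inv_mem' := by
        rintro g ⟨x, y, e⟩
        refine ⟨-x, -y, ?_⟩
        rw [QuotientGroup.mk_inv, e, mul_inv_rev, mul_neg, mul_neg, zpow_neg, zpow_neg]
        refine (Commute.inv_inv ?_).symm.eq
        rw [hp, mul_assoc, mul_assoc]
        exact hDF' _ _ }
  have hT : H (i + 2) ≤ T := by
    rw [H_add_two]
    refine sup_le (squares_le.2 fun g hg => ?_) fun g hg => ⟨0, 0, ?_⟩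
    · obtain ⟨x, y, t, ht, rfl⟩ := hF g hg
      refine ⟨x, y, ?_⟩
      rw [QuotientGroup.mk_pow, QuotientGroup.mk_mul, QuotientGroup.mk_mul]
      have h₁ := ((hDt t ht).zpow_right x).symm
      have h₂ := ((hFt t ht).zpow_right y).symm
      have hn (n : ℤ) (z : G ⧸ dbl (H (i + 1))) : (z ^ 2 ^ i) ^ n = z ^ (2 ^ i * n) := by
        rw [← zpow_natCast, ← zpow_mul]
        push_cast
        rfl
      rw [hn] at h₁ h₂
      rw [QuotientGroup.mk_zpow, QuotientGroup.mk_zpow, (h₁.mul_left h₂).mul_pow, htt t ht,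
        mul_one, (hDF' x y).mul_pow, ← zpow_natCast, ← zpow_natCast, ← zpow_mul, ← zpow_mul, hp]
      congr 2 <;> push_cast <;> ring
    · rw [(QuotientGroup.eq_one_iff g).2 hg]
      simp
  intro g hg
  obtain ⟨x, y, e⟩ := hT hg
  refine ⟨x, y, (gD ^ (2 ^ (i + 1) * x) * gF ^ (2 ^ (i + 1) * y))⁻¹ * g, ?_, by group⟩
  rw [← QuotientGroup.eq, e]
  rfl

theorem form_and (i : ℕ) : Form i ∧ LenTop i ∧ LenS i ∧ PowS i := by
  induction i with
  | zero =>
    -- The repeated term `H 0 = H 1` makes the layer at level 0 trivial, so both length bounds hold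
    -- at the start.
    have h₁ : H 0 ≤ H (0 + 1) := by rw [H_zero, zero_add, H_one]
    refine ⟨?_, fun j _ => (layer_le _ _ _).trans h₁, (layer_le _ _ _).trans h₁, ?_⟩
    · intro g hg
      rw [zero_add, H_one] at hg
      obtain ⟨x, y, w⟩ := exists_coord hg
      obtain ⟨t, ht, rfl⟩ := w.exists_eq
      exact ⟨x, y, t, by rwa [H_zero], by simp⟩
    · intro x _ y _ h
      simpa [H_one] using h
  | succ i ih =>
    obtain ⟨hF, hL, hS, hP⟩ := ih
    have hS' := hF.lenS hL
    exact ⟨hF.succ hS hP, hF.lenTop hL, hS', hP.succ hS'⟩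

theorem form (i : ℕ) : Form i := (form_and i).1

theorem lenTop (i : ℕ) : LenTop i := (form_and i).2.1

theorem lenS (i : ℕ) : LenS i := (form_and i).2.2.1

theorem powS (i : ℕ) : PowS i := (form_and i).2.2.2

/-- By uniqueness of coordinates an element of `γ₃ × γ₃` in normal form has zero exponents, so only
its tail in `dbl (H i)` is left. -/
theorem H_inf_dbl_le (i : ℕ) : H (i + 1) ⊓ dbl (gamma G 3) ≤ dbl (H i) := by
  rintro g ⟨hg, hg'⟩
  obtain ⟨x, y, t, ht, rfl⟩ := form i g hg
  have h := ((Coord.zpow_mul_zpow _ _).mul (Coord.of_mem (dbl_mono (H_le_gamma i) ht))).unique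
    (Coord.of_mem hg')
  rw [add_zero, add_zero] at h
  rw [h.1, h.2]
  simpa using ht

/-- `PowS` does not apply, as `a` moves the two top subtrees; layers with respect to all of `G` are
used, of length at most `2 ^ (i + 1) - 2 ≤ 2 ^ i + 2 ^ i`. -/
theorem bracket_C_A_pow_mem (i : ℕ) : ⁅gC ^ 2 ^ i, gA ^ 2 ^ i⁆ ∈ H i := by
  induction i with
  | zero =>
    rw [H_zero, pow_zero, pow_one, pow_one]
    exact commutatorElement_mem_symm _ bracket_C_mem
  | succ i ih =>
    rw [pow_succ, pow_mul, pow_mul]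
    refine bracket_sq_mem (raises_pow i (Subgroup.mem_top _) i)
      (raises_pow i (Subgroup.mem_top _) i) (lenTop i _ ?_) ih
    rw [pow_succ]
    omega

/-! ### Heisenberg relations among powers of `a`, `b` and `c` -/

section Heisenberg

variable {Γ : Type*} [Group Γ] {α β κ : Γ} {n : ℤ}

theorem heisenberg_zpow_mul_zpow (hα : Commute κ α) (hβ : Commute κ β)
    (h : β⁻¹ * α * β = α * κ ^ n) (x y : ℤ) :
    β ^ y * α ^ x = α ^ x * β ^ y * κ ^ (-(n * x * y)) := by
  have h₁ : α * β * α⁻¹ = β * κ ^ n := by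
    rw [mul_inv_eq_iff_eq_mul, mul_assoc, (hα.zpow_left n).eq, ← h]
    group
  have h₂ : α * β ^ y * α⁻¹ = β ^ y * κ ^ (n * y) := by
    rw [← conj_zpow, h₁, (hβ.symm.zpow_right n).mul_zpow, zpow_mul]
  have h₃ : (β ^ y)⁻¹ * α * β ^ y = α * κ ^ (n * y) := by
    rw [mul_inv_eq_iff_eq_mul, mul_assoc, (hα.zpow_left _).eq] at h₂
    rw [mul_assoc, inv_mul_eq_iff_eq_mul, h₂]
  have h₄ : (β ^ y)⁻¹ * α ^ x * β ^ y = α ^ x * κ ^ (n * x * y) := by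
    have := conj_zpow (a := (β ^ y)⁻¹) (b := α) (i := x)
    rw [inv_inv] at this
    rw [← this, h₃, (hα.symm.zpow_right _).mul_zpow, ← zpow_mul]
    congr 2
    ring
  rw [mul_assoc, inv_mul_eq_iff_eq_mul] at h₄
  rw [h₄]
  simp only [mul_assoc]
  rw [← zpow_add, add_neg_cancel, zpow_zero, mul_one]

theorem heisenberg_mul (hα : Commute κ α) (hβ : Commute κ β)
    (h : β⁻¹ * α * β = α * κ ^ n) (x y z x' y' z' : ℤ) :
    (α ^ x * β ^ y * κ ^ z) * (α ^ x' * β ^ y' * κ ^ z') =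
      α ^ (x + x') * β ^ (y + y') * κ ^ (z + z' - n * x' * y) := by
  have e := heisenberg_zpow_mul_zpow hα hβ h x' y
  have c₁ := (hα.zpow_zpow z x').eq
  have c₂ := (hβ.zpow_zpow z y').eq
  have c₃ := (hβ.zpow_zpow (-(n * x' * y)) y').eq
  calc (α ^ x * β ^ y * κ ^ z) * (α ^ x' * β ^ y' * κ ^ z')
      = α ^ x * β ^ y * (κ ^ z * α ^ x') * β ^ y' * κ ^ z' := by simp only [mul_assoc]
    _ = α ^ x * (β ^ y * α ^ x') * (κ ^ z * β ^ y') * κ ^ z' := by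
        rw [c₁]; simp only [mul_assoc]
    _ = α ^ x * α ^ x' * β ^ y * (κ ^ (-(n * x' * y)) * β ^ y') * κ ^ z * κ ^ z' := by
        rw [e, c₂]; simp only [mul_assoc]
    _ = α ^ (x + x') * β ^ (y + y') * κ ^ (z + z' - n * x' * y) := by
        rw [c₃, zpow_add, zpow_add, show z + z' - n * x' * y = -(n * x' * y) + z + z' by ring,
          zpow_add, zpow_add]
        simp only [mul_assoc]

theorem heisenberg_inv (hα : Commute κ α) (hβ : Commute κ β)
    (h : β⁻¹ * α * β = α * κ ^ n) (x y z : ℤ) :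
    (α ^ x * β ^ y * κ ^ z)⁻¹ = α ^ (-x) * β ^ (-y) * κ ^ (-z - n * x * y) := by
  rw [inv_eq_iff_mul_eq_one, heisenberg_mul hα hβ h]
  rw [add_neg_cancel, add_neg_cancel, zpow_zero, zpow_zero]
  rw [show z + (-z - n * x * y) - n * -x * y = 0 by ring]
  simp

end Heisenberg

theorem LenTop.bracket_mem {i : ℕ} {x : G} (hx : x ∈ H i) (g : G) :
    ⁅x, g ^ 2 ^ (i + 1)⁆ ∈ H (i + 1) := by
  have h := raises_pow i (Subgroup.mem_top g) (i + 1) 0 x hx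
  exact lenTop i _ (by omega) h

theorem exists_C_zpow {g : G} (hg : g ∈ commutator G) :
    ∃ z : ℤ, ∃ h ∈ gamma G 3, g = gC ^ z * h := by
  let T : Subgroup G := (Subgroup.zpowers (gC : G3)).comap (QuotientGroup.mk' (gamma G 3))
  have hT : T.Normal := by
    have : (Subgroup.zpowers (gC : G3)).Normal := by
      constructor
      rintro _ ⟨n, rfl⟩ g
      obtain ⟨g, rfl⟩ := QuotientGroup.mk_surjective g
      refine ⟨n, ?_⟩
      have h := ((commute_mod_gamma_three gC_mem g).zpow_left n).eq
      change (gC : G3) ^ n = (g : G3) * (gC : G3) ^ n * (g : G3)⁻¹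
      rw [← h, mul_inv_cancel_right]
    infer_instance
  have hC : gC ∈ T := Subgroup.mem_zpowers _
  obtain ⟨z, hz⟩ := commutator_le_of_C_mem hC hg
  refine ⟨z, (gC ^ z)⁻¹ * g, ?_, by group⟩
  rw [← QuotientGroup.eq]
  exact hz

/-- Repeated squaring: modulo `H (i + 1)` the error from `H i` has exponent 2 and commutes with the
relevant powers, so it disappears and only an error in `H (i + 1)` survives. -/
theorem pow_A_mul_C (i : ℕ) :
    ∃ h ∈ H i, (gA * gC) ^ 2 ^ (i + 1) = gA ^ 2 ^ (i + 1) * gC ^ 2 ^ (i + 1) * h := by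
  induction i with
  | zero =>
    refine ⟨(gA ^ 2 * gC ^ 2)⁻¹ * (gA * gC) ^ 2, ?_, by rw [zero_add, pow_one]; group⟩
    rw [H_zero, ← QuotientGroup.eq]
    simp only [QuotientGroup.mk_mul, QuotientGroup.mk_pow]
    rw [(commute_mod_gamma_three gC_mem gA).symm.mul_pow]
  | succ i ih =>
    obtain ⟨h, hh, e⟩ := ih
    have hA := (commutatorElement_mem_iff _ _ _).1 (LenTop.bracket_mem hh gA)
    have hC := (commutatorElement_mem_iff _ _ _).1 (LenTop.bracket_mem hh gC)
    have hCA := (commutatorElement_mem_iff _ _ _).1 (bracket_C_A_pow_mem (i + 1))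
    have h2 : (h : G ⧸ H (i + 1)) ^ 2 = 1 := (QuotientGroup.eq_one_iff _).2 (sq_mem_H hh)
    refine ⟨(gA ^ 2 ^ (i + 1 + 1) * gC ^ 2 ^ (i + 1 + 1))⁻¹ * (gA * gC) ^ 2 ^ (i + 1 + 1), ?_,
      by group⟩
    rw [← QuotientGroup.eq, pow_succ 2 (i + 1), pow_mul, pow_mul, pow_mul, e]
    simp only [QuotientGroup.mk_mul, QuotientGroup.mk_pow] at *
    rw [(hA.symm.mul_left hC.symm).mul_pow, hCA.symm.mul_pow, h2, mul_one]

theorem conjB_A : gB⁻¹ * gA * gB = gA * gC := by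
  simp [gC, comm, mul_assoc]

/-- Each doubling of the exponent of `b` replaces the error `h` by `⁅h, b ^ 2 ^ s⁆` modulo `H (i +
1)`, which is `2 ^ s` steps deeper. At `s = i + 1` the depth exceeds the length of the layer. -/
theorem conj_B_pow_A_pow (i s : ℕ) :
    ∃ h ∈ H i, (∀ j, j + 1 ≤ 2 ^ s → h ∈ layer ⊤ i j) ∧
      (gB ^ 2 ^ s)⁻¹ * gA ^ 2 ^ (i + 1) * gB ^ 2 ^ s =
        gA ^ 2 ^ (i + 1) * (gC ^ 2 ^ s) ^ 2 ^ (i + 1) * h := by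
  induction s with
  | zero =>
    obtain ⟨h, hh, e⟩ := pow_A_mul_C i
    refine ⟨h, hh, fun j hj => ?_, ?_⟩
    · obtain rfl : j = 0 := by simpa using hj
      exact hh
    · have := conj_pow (a := gB⁻¹) (b := gA) (i := 2 ^ (i + 1))
      rw [inv_inv, conjB_A, e] at this
      simp only [pow_zero, pow_one]
      exact this.symm
  | succ s ih =>
    obtain ⟨h, hh, hl, e⟩ := ih
    obtain ⟨N, hN⟩ : ∃ N, N = (gC ^ 2 ^ s) ^ 2 ^ (i + 1) := ⟨_, rfl⟩
    obtain ⟨β, hβ⟩ : ∃ β, β = gB ^ 2 ^ s := ⟨_, rfl⟩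
    have hNβ : Commute N β := by
      rw [hN, hβ]
      exact ((commute_C_B.pow_pow _ _).pow_left _)
    have hk₁ : comm h N ∈ H (i + 1) := by
      rw [hN, comm_mem_iff']
      exact LenTop.bracket_mem hh _
    have hN2 : (gC ^ 2 ^ (s + 1)) ^ 2 ^ (i + 1) = N * N := by
      rw [hN, pow_succ 2 s, pow_mul, ← pow_two, ← pow_mul, mul_comm, pow_mul]
    have hβ2 : gB ^ 2 ^ (s + 1) = β * β := by
      rw [hβ, pow_succ, pow_mul, pow_two]
    rw [← hN, ← hβ] at e
    have hconj : h * comm h N * h * comm h β ∈ H i :=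
      mul_mem (mul_mem (mul_mem hh (H_succ_le _ hk₁)) hh) (by
        have := mul_mem (inv_mem hh) ((H_normal i).conj_mem h hh β⁻¹)
        simpa [comm, mul_assoc] using this)
    refine ⟨h * comm h N * h * comm h β, hconj, fun j hj => ?_, ?_⟩
    · rw [show h * comm h N * h * comm h β = (h * comm h N * h⁻¹) * h ^ 2 * comm h β by
        rw [pow_two]; group]
      refine mul_mem (mul_mem (H_le_layer _ _ _ ((H_normal (i + 1)).conj_mem _ hk₁ h))
        (H_le_layer _ _ _ (sq_mem_H hh))) ?_
      have hp := Nat.one_le_two_pow (n := s)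
      rw [pow_succ] at hj
      rw [comm_mem_iff', hβ]
      exact layer_antitone ⊤ i (show j ≤ 2 ^ s - 1 + 2 ^ s by omega)
        (raises_pow i (Subgroup.mem_top gB) s _ _ (hl (2 ^ s - 1) (by omega)))
    · rw [hN2, hβ2]
      calc (β * β)⁻¹ * gA ^ 2 ^ (i + 1) * (β * β)
          = β⁻¹ * (β⁻¹ * gA ^ 2 ^ (i + 1) * β) * β := by group
        _ = β⁻¹ * (gA ^ 2 ^ (i + 1) * N * h) * β := by rw [e]
        _ = (β⁻¹ * gA ^ 2 ^ (i + 1) * β) * (β⁻¹ * N * β) * (β⁻¹ * h * β) := by group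
        _ = gA ^ 2 ^ (i + 1) * (N * N) * (h * comm h N * h * comm h β) := by
            rw [e, mul_assoc β⁻¹ N, hNβ.eq, inv_mul_cancel_left]
            simp only [comm]
            group

/-! ### The filtration `K` of `G` and its normal form -/

/-- A normal subgroup containing the term of index `2 ^ i + 1` of the lower `2`-central series. -/
def K : ℕ → Subgroup G
  | 0 => twoCentral G 2
  | i + 1 => squares (K i) ⊔ H (i + 1)

theorem K_zero : K 0 = twoCentral G 2 := rfl

theorem K_succ (i : ℕ) : K (i + 1) = squares (K i) ⊔ H (i + 1) := rfl

instance K_normal (i : ℕ) : (K i).Normal := by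
  induction i with
  | zero => rw [K_zero]; infer_instance
  | succ i ih => rw [K_succ]; infer_instance

theorem H_le_K (i : ℕ) : H i ≤ K i := by
  cases i with
  | zero =>
    rw [H_zero, K_zero]
    exact (gamma_antitone (by norm_num)).trans (gamma_le_twoCentral 2 (by norm_num))
  | succ i => exact le_sup_right

theorem squares_K_le (i : ℕ) : squares (K i) ≤ K (i + 1) := le_sup_left

theorem K_succ_le (i : ℕ) : K (i + 1) ≤ K i :=
  sup_le (squares_le_self _) ((H_succ_le i).trans (H_le_K i))

theorem exists_of_mem_twoCentral_two {g : G} (hg : g ∈ twoCentral G 2) :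
    ∃ x y z : ℤ, ∃ h ∈ gamma G 3, g = gA ^ (2 * x) * gB ^ (2 * y) * gC ^ z * h := by
  let T : Subgroup G :=
    { carrier := {g | ∃ x y : ℤ, (g : Ab) = (gA : Ab) ^ (2 * x) * (gB : Ab) ^ (2 * y)}
      one_mem' := ⟨0, 0, by simp⟩
      mul_mem' := by
        rintro g h ⟨x, y, e⟩ ⟨x', y', e'⟩
        refine ⟨x + x', y + y', ?_⟩
        rw [QuotientGroup.mk_mul, e, e', mul_add, mul_add, zpow_add, zpow_add, mul_mul_mul_comm]
      inv_mem' := by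
        rintro g ⟨x, y, e⟩
        refine ⟨-x, -y, ?_⟩
        rw [QuotientGroup.mk_inv, e, mul_inv, mul_neg, mul_neg, zpow_neg, zpow_neg] }
  have hT : twoCentral G 2 ≤ T := by
    rw [twoCentral_succ 1 le_rfl, twoCentral_one]
    refine sup_le (fun g hg => ⟨0, 0, ?_⟩) (squares_le.2 fun g _ => ?_)
    · rw [ab_eq_one_iff.2 hg]
      simp
    · obtain ⟨x, y, e⟩ := exists_ab_eq g
      refine ⟨x, y, ?_⟩
      rw [QuotientGroup.mk_pow, e, mul_pow, mul_comm 2, mul_comm 2, zpow_mul, zpow_mul]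
      rfl
  obtain ⟨x, y, e⟩ := hT hg
  have hg' : (gA ^ (2 * x) * gB ^ (2 * y))⁻¹ * g ∈ commutator G := by
    rw [← QuotientGroup.eq]
    exact e.symm
  obtain ⟨z, h, hh, e'⟩ := exists_C_zpow hg'
  refine ⟨x, y, z, h, hh, ?_⟩
  rw [inv_mul_eq_iff_eq_mul] at e'
  rw [e']
  simp only [mul_assoc]

/-- Modulo `H (i + 1)` the powers `α`, `β`, `κ` satisfy Heisenberg relations, and elements of `H i`
have exponent 2 and commute with them; squaring therefore doubles the exponents up to a power of
`κ`. -/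
theorem exists_of_mem_K (i : ℕ) : ∀ g ∈ K i, ∃ x y z : ℤ, ∃ h ∈ H i,
    g = gA ^ (2 ^ (i + 1) * x) * gB ^ (2 ^ (i + 1) * y) * gC ^ (2 ^ i * z) * h := by
  induction i with
  | zero =>
    intro g hg
    rw [H_zero]
    simpa using exists_of_mem_twoCentral_two hg
  | succ i ih =>
    obtain ⟨α, hα⟩ : ∃ α, α = (gA : G ⧸ H (i + 1)) ^ 2 ^ (i + 1) := ⟨_, rfl⟩
    obtain ⟨β, hβ⟩ : ∃ β, β = (gB : G ⧸ H (i + 1)) ^ 2 ^ (i + 1) := ⟨_, rfl⟩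
    obtain ⟨κ, hκ⟩ : ∃ κ, κ = (gC : G ⧸ H (i + 1)) ^ 2 ^ i := ⟨_, rfl⟩
    have c₁ : Commute κ α := by
      have h := powS i gC (mem_S_of_mem_commutator gC_mem) (gA ^ 2) gA_sq_mem_S
        (commutatorElement_mem_symm _ bracket_C_mem)
      rw [← pow_mul, ← pow_succ', commutatorElement_mem_iff] at h
      rw [hκ, hα]
      exact h
    have c₂ : Commute κ β := by
      rw [hκ, hβ]
      exact (commute_C_B.map (QuotientGroup.mk' (H (i + 1)))).pow_pow _ _
    -- The exponent of `κ` must be even, so that the correction to a square is again an even power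
    -- of `κ`. The witness is `n = 2 ^ (i + 1)`, as `2 ^ (i + 1) * 2 ^ (i + 1) = 2 ^ i * (2 * n)`.
    obtain ⟨n, hn⟩ : ∃ n : ℤ, β⁻¹ * α * β = α * κ ^ (2 * n) := by
      obtain ⟨h, -, hl, e⟩ := conj_B_pow_A_pow i (i + 1)
      have hp := Nat.one_le_two_pow (n := i + 1)
      have hh := lenTop i (2 ^ (i + 1) - 1) (by omega) (hl _ (by omega))
      refine ⟨2 ^ (i + 1), ?_⟩
      have e' := congrArg (QuotientGroup.mk' (H (i + 1))) e
      rw [map_mul _ _ h, show QuotientGroup.mk' (H (i + 1)) h = 1 from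
        (QuotientGroup.eq_one_iff h).2 hh, mul_one] at e'
      rw [hα, hβ, hκ]
      refine e'.trans ?_
      rw [map_mul, map_pow, map_pow, map_pow, QuotientGroup.mk'_apply, QuotientGroup.mk'_apply]
      congr 1
      rw [← pow_mul, ← zpow_natCast, ← zpow_natCast, ← zpow_mul]
      congr 1
      push_cast
      ring
    let T : Subgroup G :=
      { carrier := {g | ∃ x y z : ℤ,
          (g : G ⧸ H (i + 1)) = α ^ (2 * x) * β ^ (2 * y) * κ ^ (2 * z)}
        one_mem' := ⟨0, 0, 0, by simp⟩
        mul_mem' := by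
          rintro g h ⟨x, y, z, e⟩ ⟨x', y', z', e'⟩
          refine ⟨x + x', y + y', z + z' - n * (2 * x') * (2 * y), ?_⟩
          rw [QuotientGroup.mk_mul, e, e', heisenberg_mul c₁ c₂ hn]
          congr 2 <;> ring_nf
        inv_mem' := by
          rintro g ⟨x, y, z, e⟩
          refine ⟨-x, -y, -z - n * (2 * x) * (2 * y), ?_⟩
          rw [QuotientGroup.mk_inv, e, heisenberg_inv c₁ c₂ hn]
          congr 2 <;> ring_nf }
    have hT : K (i + 1) ≤ T := by
      rw [K_succ]
      refine sup_le (squares_le.2 fun g hg => ?_) fun g hg => ⟨0, 0, 0, ?_⟩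
      · obtain ⟨x, y, z, h, hh, rfl⟩ := ih g hg
        have hA : Commute (h : G ⧸ H (i + 1)) α := by
          rw [hα]
          exact (commutatorElement_mem_iff _ _ _).1 (LenTop.bracket_mem hh gA)
        have hB : Commute (h : G ⧸ H (i + 1)) β := by
          rw [hβ]
          exact (commutatorElement_mem_iff _ _ _).1 (LenTop.bracket_mem hh gB)
        have hC : Commute (h : G ⧸ H (i + 1)) κ := by
          rw [hκ]
          exact (commutatorElement_mem_iff _ _ _).1
            ((lenS i).bracket_mem hh (mem_S_of_mem_commutator gC_mem))
        have h2 : (h : G ⧸ H (i + 1)) ^ 2 = 1 := (QuotientGroup.eq_one_iff _).2 (sq_mem_H hh)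
        have e : ((gA ^ (2 ^ (i + 1) * x) * gB ^ (2 ^ (i + 1) * y) * gC ^ (2 ^ i * z) : G) :
            G ⧸ H (i + 1)) = α ^ x * β ^ y * κ ^ z := by
          rw [hα, hβ, hκ, ← zpow_natCast, ← zpow_natCast, ← zpow_natCast, ← zpow_mul, ← zpow_mul,
            ← zpow_mul]
          push_cast
          rfl
        refine ⟨x, y, z - n * x * y, ?_⟩
        rw [QuotientGroup.mk_pow, QuotientGroup.mk_mul, e, Commute.mul_pow, h2, mul_one, pow_two,
          heisenberg_mul c₁ c₂ hn]
        · congr 2 <;> ring_nf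
        · exact ((hA.zpow_right _).mul_right (hB.zpow_right _)).mul_right (hC.zpow_right _) |>.symm
      · rw [(QuotientGroup.eq_one_iff g).2 hg]
        simp
    intro g hg
    obtain ⟨x, y, z, e⟩ := hT hg
    refine ⟨x, y, z, (gA ^ (2 ^ (i + 1 + 1) * x) * gB ^ (2 ^ (i + 1 + 1) * y) *
      gC ^ (2 ^ (i + 1) * z))⁻¹ * g, ?_, by group⟩
    rw [← QuotientGroup.eq, e, hα, hβ, hκ, ← zpow_natCast, ← zpow_natCast, ← zpow_natCast,
      ← zpow_mul, ← zpow_mul, ← zpow_mul]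
    push_cast
    rw [← mul_assoc, ← mul_assoc, ← mul_assoc, ← pow_succ, ← pow_succ]
    rfl

theorem ab_of_mem_K {i : ℕ} {g : G} (hg : g ∈ K i) :
    ∃ x y : ℤ, (g : Ab) = (gA : Ab) ^ (2 ^ (i + 1) * x) * (gB : Ab) ^ (2 ^ (i + 1) * y) := by
  obtain ⟨x, y, z, h, hh, rfl⟩ := exists_of_mem_K i g hg
  refine ⟨x, y, ?_⟩
  have h1 : (h : Ab) = 1 := ab_eq_one_iff.2 (gamma_three_le_commutator (H_le_gamma i hh))
  simp only [QuotientGroup.mk_mul, QuotientGroup.mk_zpow, h1, ab_C, one_zpow, mul_one]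

theorem exists_of_mem_K_of_mem_commutator {i : ℕ} {g : G} (hg : g ∈ K i)
    (hg' : g ∈ commutator G) : ∃ z : ℤ, ∃ h ∈ H i, g = gC ^ (2 ^ i * z) * h := by
  obtain ⟨x, y, z, h, hh, rfl⟩ := exists_of_mem_K i g hg
  have h1 : (h : Ab) = 1 := ab_eq_one_iff.2 (gamma_three_le_commutator (H_le_gamma i hh))
  rw [← ab_eq_one_iff] at hg'
  simp only [QuotientGroup.mk_mul, QuotientGroup.mk_zpow, h1, ab_C, one_zpow, mul_one] at hg'
  have := ab_injective hg'
  exact ⟨z, h, hh, by rw [this.1, this.2]; simp⟩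

theorem K_inf_gamma_le (i : ℕ) : K i ⊓ gamma G 3 ≤ H i := by
  rintro g ⟨hg, hg'⟩
  obtain ⟨z, h, hh, rfl⟩ :=
    exists_of_mem_K_of_mem_commutator hg (gamma_three_le_commutator hg')
  have hC := (Subgroup.mul_mem_cancel_right _ (H_le_gamma i hh)).1 hg'
  rw [C_injective hC]
  simpa using hh

/-- `M` contains some term of the lower `2`-central series. -/
def IsCofinal (M : Subgroup G) : Prop := ∃ N, 1 ≤ N ∧ twoCentral G N ≤ M

theorem IsCofinal.mono {M M' : Subgroup G} (h : IsCofinal M) (hM : M ≤ M') : IsCofinal M' :=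
  h.imp fun _ hN => ⟨hN.1, hN.2.trans hM⟩

/-- `Γ` of index `2N` is generated by commutators from index `2N - 1 ≥ N` and squares from index
`N`. -/
theorem IsCofinal.step {M M' : Subgroup G} (h : IsCofinal M) (hs : squares M ≤ M')
    (hc : ⁅M, (⊤ : Subgroup G)⁆ ≤ M') : IsCofinal M' := by
  obtain ⟨N, hN, hM⟩ := h
  refine ⟨(2 * N - 1) + 1, by omega, ?_⟩
  rw [twoCentral_succ _ (by omega), show (2 * N - 1 + 2) / 2 = N by omega]
  refine sup_le (le_trans (Subgroup.commutator_mono ?_ le_rfl) hc) ((squares_mono hM).trans hs)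
  exact (twoCentral_antitone (by omega)).trans hM

/-- Finitely many commutators lead from `K i` to `K (i + 1)`: two reach `K i ∩ γ₃ ≤ H i`, and the
finite length of the layer does the rest. Squares of `K i` lie in `K (i + 1)` throughout. -/
theorem isCofinal_K (i : ℕ) : IsCofinal (K i) := by
  induction i with
  | zero => exact ⟨2, by norm_num, le_rfl⟩
  | succ i ih =>
    have step (M : Subgroup G) [M.Normal] (hM : M ≤ K i) (h : IsCofinal (M ⊔ K (i + 1))) :
        IsCofinal (⁅M, (⊤ : Subgroup G)⁆ ⊔ K (i + 1)) := by
      refine h.step ((squares_mono (sup_le hM (K_succ_le i))).trans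
        ((squares_K_le i).trans le_sup_right)) (commutator_sup_left_le le_sup_left ?_)
      exact (Subgroup.commutator_le_left _ _).trans le_sup_right
    have h₁ := step _ ((Subgroup.commutator_le_left _ _).trans le_rfl)
      (step (K i) le_rfl (ih.mono le_sup_left))
    have hle : ⁅⁅K i, (⊤ : Subgroup G)⁆, (⊤ : Subgroup G)⁆ ≤ H i := by
      refine (le_inf ?_ ?_).trans (K_inf_gamma_le i)
      · exact (Subgroup.commutator_le_left _ _).trans (Subgroup.commutator_le_left _ _)
      · rw [gamma_succ 2 (by norm_num), gamma_succ 1 le_rfl, gamma_one]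
        exact Subgroup.commutator_mono (Subgroup.commutator_mono le_top le_rfl) le_rfl
    have h₂ : ∀ j, IsCofinal (layer ⊤ i j ⊔ K (i + 1)) := by
      intro j
      induction j with
      | zero => exact h₁.mono (sup_le_sup_right hle _)
      | succ j ih =>
        refine (step _ ((layer_le _ _ _).trans (H_le_K i)) ih).mono (sup_le_sup_right ?_ _)
        rw [layer_succ]
        exact le_sup_left
    exact (h₂ (2 ^ (i + 1))).mono
      (sup_le ((lenTop i _ (by omega)).trans (H_le_K (i + 1))) le_rfl)

/-! ### Cyclic generators of the lower central series modulo `Y` -/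

/-- The descending series starting at the commutator subgroup built like the lower
`2`-central series. -/
abbrev Y (n : ℕ) : Subgroup G := sqSeries (commutator G) n

theorem Y_le_commutator {n : ℕ} (hn : 1 ≤ n) : Y n ≤ commutator G := by
  rw [← sqSeries_one (commutator G)]
  exact sqSeries_antitone _ hn

theorem comm_mem_Y {n : ℕ} (hn : 1 ≤ n) {x : G} (hx : x ∈ Y n) (g : G) : comm x g ∈ Y (n + 1) :=
  (comm_mem_iff' _ _ _).2 (commutatorElement_mem_sqSeries _ hn hx g)

theorem gamma_le_Y {n : ℕ} (hn : 1 ≤ n) : gamma G (n + 1) ≤ Y n := gamma_le_sqSeries n hn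

theorem comm_sq_right {Γ : Type*} [Group Γ] (w y : Γ) :
    comm w (y ^ 2) = comm w y ^ 2 * comm (comm w y) y := by
  simp only [comm, pow_two]
  group

theorem IsPair.comm_A {w x : G} (h : IsPair w x 1) :
    IsPair (Basilica.comm w gA) x⁻¹ (gB⁻¹ * x * gB) := by
  have := h.inv.mul h.conjA
  simpa [Basilica.comm, mul_assoc] using this

theorem gU_mem_Y : gU ∈ Y 2 := by
  have h : gC * gC * gD ∈ Y 2 := by
    refine mul_mem ?_ (gamma_le_Y (by norm_num) gD_mem)
    rw [← pow_two]
    exact sq_mem_sqSeries _ le_rfl le_rfl (by rw [sqSeries_one]; exact gC_mem)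
  rw [gU]
  refine inv_mem ?_
  simpa using (sqSeries_normal (commutator G) 2).conj_mem _ h gB⁻¹

/-- Each commutator of `y` with a generator is realised by commutators of depth two on `w = ⟨y, 1⟩`,
which is why the index doubles. -/
theorem Y_le_leftPull {n : ℕ} (hn : 1 ≤ n) : Y n ≤ leftPull (Y (2 * n)) := by
  refine sqSeries_le_of (F := fun n => leftPull (Y (2 * n))) _ ?_ ?_ ?_ n hn
  · exact commutator_le_of_C_mem ⟨_, gU_mem_Y, IsPair.U⟩
  · intro n hn
    apply commutator_top_le
    · rintro y ⟨w, hw, h⟩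
      -- `[w⁻¹, a]` has first coordinate `y`, and bracketing with `b = ⟨a, 1⟩` trivialises the
      -- second.
      refine ⟨⁅Basilica.comm w⁻¹ gA, gB⁆, ?_, ?_⟩
      · exact commutatorElement_mem_sqSeries _ (by omega) (comm_mem_Y (by omega) (inv_mem hw) _) _
      · have := (show IsPair w⁻¹ y⁻¹ 1 by simpa using h.inv).comm_A.bracket IsPair.B
        simpa using this
    · rintro y ⟨w, hw, h⟩
      refine ⟨⁅w, gA ^ 2⁆, ?_, by simpa using h.bracket IsPair.A_sq⟩
      have hw' := commutatorElement_mem_sqSeries _ (by omega) hw gA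
      rw [commutatorElement_sq_right]
      exact mul_mem (sq_mem_sqSeries _ (by omega) (by omega) hw')
        (commutatorElement_mem_sqSeries _ (by omega) (inv_mem hw') _)
  · intro m n hn hm
    refine squares_le.2 ?_
    rintro y ⟨w, hw, h⟩
    exact ⟨w ^ 2, sq_mem_sqSeries _ (by omega) (by omega) hw, by simpa using h.pow 2⟩

theorem dbl_gamma_three_le_Y : dbl (gamma G 3) ≤ Y 4 :=
  (dbl_mono (gamma_le_Y (by norm_num))).trans (dbl_le (Y_le_leftPull (by norm_num)))

theorem sup_Y_normal {n : ℕ} (hn : 1 ≤ n) {X : Subgroup G} (hX : X ≤ Y n) :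
    (X ⊔ Y (n + 1)).Normal := by
  rw [← Subgroup.commutator_top_right_le_iff]
  refine (Subgroup.commutator_mono (sup_le hX (sqSeries_antitone _ n.le_succ)) le_rfl).trans ?_
  exact (commutator_sqSeries_le _ n hn).trans le_sup_right

theorem exists_eq_gE : ∃ t ∈ dbl (gamma G 3), gE = gD ^ (-2 : ℤ) * gF * t := by
  simpa using Coord.E.exists_eq

theorem D_zpow_mem_Y : gD ^ (-2 : ℤ) ∈ Y 4 := by
  rw [zpow_neg]
  exact inv_mem (sq_mem_sqSeries _ (by norm_num) le_rfl (gamma_le_Y (by norm_num) gD_mem))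

theorem gF_mem_Y : gF ∈ Y 3 := by
  obtain ⟨t, ht, e⟩ := exists_eq_gE
  have h : gF = (gD ^ (-2 : ℤ))⁻¹ * gE * t⁻¹ := by rw [e]; group
  have hle : Y 4 ≤ Y 3 := sqSeries_antitone _ (by norm_num)
  rw [h]
  exact mul_mem (mul_mem (inv_mem (hle D_zpow_mem_Y)) (gamma_le_Y (by norm_num) gE_mem_gamma_four))
    (inv_mem (hle (dbl_gamma_three_le_Y ht)))

open Classical in
/-- The element `⟨x, 1⟩`, when it exists. -/
noncomputable def lift (x : G) : G := if h : ∃ g, IsPair g x 1 then h.choose else 1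

theorem isPair_lift {x : G} (hx : x ∈ commutator G) : IsPair (lift x) x 1 := by
  obtain ⟨g, -, w⟩ := commutator_le_leftPull hx
  have h : ∃ g, IsPair g x 1 := ⟨g, w⟩
  rw [lift, dif_pos h]
  exact h.choose_spec

/-- Generators of the terms of the lower central series modulo the groups `Y n`. -/
noncomputable def zeta (n : ℕ) : G :=
  -- Indices 0 and 1 carry dummy values. At 4 one may take `f` because `e ≡ f` modulo `Y 4`; beyond
  -- that, index `2m - 1` carries `⟨ζₘ, 1⟩` and index `2m` its commutator with `a`.
  if n ≤ 2 then gC else if n = 3 then gD else if n = 4 then gF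
  else if n % 2 = 1 then lift (zeta ((n + 1) / 2)) else comm (lift (zeta ((n + 1) / 2))) gA
  termination_by n

theorem zeta_two : zeta 2 = gC := by rw [zeta]; simp

theorem zeta_three : zeta 3 = gD := by rw [zeta]; simp

theorem zeta_four : zeta 4 = gF := by rw [zeta]; simp

theorem zeta_odd {m : ℕ} (hm : 3 ≤ m) : zeta (2 * m - 1) = lift (zeta m) := by
  rw [zeta, if_neg (by omega), if_neg (by omega), if_neg (by omega), if_pos (by omega),
    show (2 * m - 1 + 1) / 2 = m by omega]

theorem zeta_even {m : ℕ} (hm : 3 ≤ m) : zeta (2 * m) = comm (lift (zeta m)) gA := by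
  rw [zeta, if_neg (by omega), if_neg (by omega), if_neg (by omega), if_neg (by omega),
    show (2 * m + 1) / 2 = m by omega]

/-- Induction along the recursion defining `zeta`. -/
theorem zeta_induction {P : ∀ n, 2 ≤ n → Prop} (h₂ : P 2 (by omega)) (h₃ : P 3 (by omega))
    (h₄ : P 4 (by omega)) (ho : ∀ m (hm : 3 ≤ m), P m (by omega) → P (2 * m - 1) (by omega))
    (he : ∀ m (hm : 3 ≤ m), P m (by omega) → P (2 * m) (by omega)) (n : ℕ) (hn : 2 ≤ n) :
    P n hn := by
  induction n using Nat.strong_induction_on with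
  | _ n ih =>
    rcases Nat.lt_or_ge n 5 with h | h
    · interval_cases n
      exacts [h₂, h₃, h₄]
    · rcases Nat.even_or_odd' n with ⟨m, rfl | rfl⟩
      · exact he m (by omega) (ih m (by omega) (by omega))
      · have := ho (m + 1) (by omega) (ih (m + 1) (by omega) (by omega))
        simpa only [show 2 * (m + 1) - 1 = 2 * m + 1 by omega] using this

theorem lift_mem_Y {n : ℕ} (hn : 1 ≤ n) {x : G} (hx : x ∈ Y n) : lift x ∈ Y (2 * n) :=
  mem_of_mem_leftPull (isPair_lift (Y_le_commutator hn hx)) (Y_le_leftPull hn hx)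

theorem zeta_mem_Y (n : ℕ) (hn : 2 ≤ n) : zeta n ∈ Y (n - 1) := by
  induction n, hn using zeta_induction with
  | h₂ =>
    rw [zeta_two]
    change gC ∈ sqSeries (commutator G) 1
    rw [sqSeries_one]
    exact gC_mem
  | h₃ => rw [zeta_three]; exact gamma_le_Y (by norm_num) gD_mem
  | h₄ => rw [zeta_four]; exact gF_mem_Y
  | ho m hm ih =>
    rw [zeta_odd hm, show 2 * m - 1 - 1 = 2 * (m - 1) by omega]
    exact lift_mem_Y (by omega) ih
  | he m hm ih =>
    rw [zeta_even hm, show 2 * m - 1 = 2 * (m - 1) + 1 by omega]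
    exact comm_mem_Y (by omega) (lift_mem_Y (by omega) ih) _

theorem zeta_mem_commutator {n : ℕ} (hn : 2 ≤ n) : zeta n ∈ commutator G :=
  Y_le_commutator (by omega) (zeta_mem_Y n hn)

theorem isPair_zeta {m : ℕ} (hm : 3 ≤ m) : IsPair (zeta (2 * m - 1)) (zeta m) 1 := by
  rw [zeta_odd hm]
  exact isPair_lift (zeta_mem_commutator (by omega))

/-- The subgroup generated by `zeta n` and `Y n`. -/
noncomputable def cyc (n : ℕ) : Subgroup G := Subgroup.zpowers (zeta (n + 2)) ⊔ Y (n + 2)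

theorem zeta_mem_cyc (n : ℕ) : zeta (n + 2) ∈ cyc n :=
  Subgroup.mem_sup_left (Subgroup.mem_zpowers _)

theorem Y_le_cyc (n : ℕ) : Y (n + 2) ≤ cyc n := le_sup_right

instance cyc_normal (n : ℕ) : (cyc n).Normal := by
  refine sup_Y_normal (by omega) ?_
  rw [Subgroup.zpowers_le]
  exact zeta_mem_Y (n + 2) (by omega)

theorem cyc_le_leftPull {n : ℕ} (hn : 1 ≤ n) : cyc n ≤ leftPull (cyc (2 * n + 1)) := by
  refine sup_le ?_ ((Y_le_leftPull (by omega)).trans (leftPull_mono ?_))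
  · rw [Subgroup.zpowers_le]
    refine ⟨_, zeta_mem_cyc _, ?_⟩
    have := isPair_zeta (m := n + 2) (by omega)
    rwa [show 2 * (n + 2) - 1 = 2 * n + 1 + 2 by omega] at this
  · exact (sqSeries_antitone _ (by omega)).trans (Y_le_cyc _)

theorem comm_C_A : comm gC gA = gD := by rw [gD]

theorem comm_D_A : comm gD gA = gE := by rw [gE]

theorem comm_one_right {Γ : Type*} [Group Γ] (x : Γ) : comm x 1 = 1 := by simp [comm]

/-- Indices are shifted: `cyc (n - 1)` is generated by `zeta (n + 1)` and `Y (n + 1)`. So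
commutation with a generator of `G` takes each `zeta` to a multiple of the next, modulo `Y`. -/
theorem comm_zeta_mem (n : ℕ) (hn : 2 ≤ n) :
    comm (zeta n) gA ∈ cyc (n - 1) ∧ comm (zeta n) gB ∈ cyc (n - 1) := by
  induction n, hn using zeta_induction with
  | h₂ =>
    rw [zeta_two]
    refine ⟨?_, ?_⟩
    · have := zeta_mem_cyc 1
      rwa [zeta_three, ← comm_C_A] at this
    · rw [comm_mem_iff]
      exact commute_C_B.map (QuotientGroup.mk' (cyc 1))
  | h₃ =>
    rw [zeta_three]
    refine ⟨?_, ?_⟩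
    · obtain ⟨t, ht, e⟩ := exists_eq_gE
      rw [comm_D_A, e]
      refine mul_mem (mul_mem (Y_le_cyc _ D_zpow_mem_Y) ?_)
        (Y_le_cyc _ (dbl_gamma_three_le_Y ht))
      have := zeta_mem_cyc 2
      rwa [zeta_four] at this
    · refine Y_le_cyc _ (dbl_gamma_three_le_Y ?_)
      rw [comm_mem_iff]
      exact commute_B_mod_dbl gD_mem_commutator
  | h₄ =>
    rw [zeta_four]
    refine ⟨?_, ?_⟩
    · have h : comm gF gA = (gF ^ 2)⁻¹ := by
        have : comm gF gA = gF⁻¹ * (gA⁻¹ * gF * gA) := by simp [comm, mul_assoc]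
        rw [this, conjA_F, pow_two, mul_inv_rev]
      rw [h]
      exact Y_le_cyc _ (inv_mem (sq_mem_sqSeries _ (by norm_num) (by norm_num) gF_mem_Y))
    · have h := zeta_mem_cyc 3
      have w := isPair_zeta (m := 3) le_rfl
      rw [zeta_three] at w
      have w' : IsPair (comm gF gB) gD 1 := by
        have := IsPair.F.comm IsPair.B
        rwa [comm_one_right, comm_C_A] at this
      rwa [w'.eq w]
  | ho m hm ih =>
    rw [show 2 * m - 1 - 1 = 2 * (m - 1) by omega]
    refine ⟨?_, ?_⟩
    · have := zeta_mem_cyc (2 * (m - 1))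
      rwa [show 2 * (m - 1) + 2 = 2 * m by omega, zeta_even hm, ← zeta_odd hm] at this
    · refine mem_of_mem_leftPull (x := comm (zeta m) gA) ?_ (leftPull_mono (Y_le_cyc _) ?_)
      · simpa [comm] using (isPair_zeta hm).comm IsPair.B
      · have := comm_mem_Y (by omega) (zeta_mem_Y m (by omega)) gA
        exact leftPull_mono (sqSeries_antitone _ (by omega)) (Y_le_leftPull (by omega) this)
  | he m hm ih =>
    have hl := cyc_le_leftPull (n := m - 1) (by omega)
    rw [show 2 * (m - 1) + 1 = 2 * m - 1 by omega] at hl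
    have w := isPair_zeta hm
    rw [zeta_even hm, ← zeta_odd hm]
    refine ⟨?_, ?_⟩
    -- With `w = ⟨ζₘ, 1⟩`, the double commutator `[[w, a], a]` is `[w, a²] = ⟨[ζₘ, b], 1⟩` up to the
    -- square of `[w, a]`.
    · have h := comm_sq_right (zeta (2 * m - 1)) gA
      rw [← inv_mul_eq_iff_eq_mul] at h
      rw [← h]
      refine mul_mem (inv_mem (Y_le_cyc _ ?_)) (mem_of_mem_leftPull ?_ (hl ih.2))
      · exact sq_mem_sqSeries _ (n := 2 * m - 1) (by omega) (by omega)
          (sqSeries_antitone _ (by omega)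
            (comm_mem_Y (by omega) (zeta_mem_Y (2 * m - 1) (by omega)) gA))
      · simpa [comm] using w.comm IsPair.A_sq
    · refine mem_of_mem_leftPull (x := comm (zeta m)⁻¹ gA) ?_ (hl ?_)
      · have := w.comm_A.comm IsPair.B
        rwa [comm_one_right] at this
      · have := (comm_mem_iff _ _ _).1 ih.1
        rw [comm_mem_iff]
        exact this.inv_left

theorem commutator_zpowers_top_le {M : Subgroup G} [M.Normal] {z : G} (hA : comm z gA ∈ M)
    (hB : comm z gB ∈ M) : ⁅Subgroup.zpowers z, (⊤ : Subgroup G)⁆ ≤ M := by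
  rw [comm_mem_iff] at hA hB
  apply commutator_top_le
  · rintro _ ⟨n, rfl⟩
    rw [commutatorElement_mem_iff]
    exact hA.zpow_left n
  · rintro _ ⟨n, rfl⟩
    rw [commutatorElement_mem_iff]
    exact hB.zpow_left n

theorem gamma_le_cyc (n : ℕ) : gamma G (n + 2) ≤ cyc n := by
  induction n with
  | zero =>
    rw [gamma_two]
    apply commutator_le_of_C_mem
    have := zeta_mem_cyc 0
    rwa [zeta_two] at this
  | succ n ih =>
    rw [show n + 1 + 2 = n + 2 + 1 by ring, gamma_succ _ (by omega)]
    have h := comm_zeta_mem (n + 2) (by omega)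
    refine (Subgroup.commutator_mono ih le_rfl).trans (commutator_sup_left_le ?_ ?_)
    · exact commutator_zpowers_top_le h.1 h.2
    · exact (commutator_sqSeries_le _ _ (by omega)).trans (Y_le_cyc (n + 1))

theorem zeta_mem_twoCentral {n : ℕ} (hn : 2 ≤ n) : zeta n ∈ twoCentral G n := by
  have := sqSeries_commutator_le_twoCentral (n - 1) (by omega) (zeta_mem_Y n hn)
  rwa [show n - 1 + 1 = n by omega] at this

theorem mixed_le_zpowers_sup {n : ℕ} (hn : 2 ≤ n) :
    mixed G n ≤ Subgroup.zpowers (zeta n) ⊔ twoCentral G (n + 1) := by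
  obtain ⟨n, rfl⟩ := Nat.exists_eq_add_of_le' hn
  refine sup_le ((gamma_le_cyc n).trans (sup_le_sup_left ?_ _)) le_sup_right
  exact sqSeries_commutator_le_twoCentral _ (by omega)

/-- Passing from index `m` to `2m - 1` replaces an element of `H j` by one of `dbl (H j)`, which
lies in `H (j + 1)`. -/
theorem zeta_mem_H (n : ℕ) (hn : 2 ≤ n) : ∀ i, 3 ≤ n → 2 ^ i < n → zeta n ∈ H i := by
  have key : ∀ m, 3 ≤ m → (∀ i, 3 ≤ m → 2 ^ i < m → zeta m ∈ H i) →
      ∀ i, 2 ^ i < 2 * m → zeta (2 * m - 1) ∈ H i := by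
    intro m hm ih i hi
    have h (j : ℕ) (hj : 2 ^ j < m) : zeta (2 * m - 1) ∈ dbl (H j) :=
      (mem_dbl_iff (isPair_zeta hm)).2 ⟨ih j hm hj, one_mem _⟩
    cases i with
    | zero =>
      have := h 0 (by omega)
      rw [H_zero] at this ⊢
      exact dbl_gamma_three_le this
    | succ i => exact dbl_H_le i (h i (by rw [pow_succ] at hi; omega))
  induction n, hn using zeta_induction with
  | h₂ => intro i h; omega
  | h₃ =>
    intro i _ hi
    have : i < 2 := by
      by_contra! h
      have := Nat.pow_le_pow_right (n := 2) (by norm_num) h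
      omega
    rw [zeta_three]
    interval_cases i
    · rw [H_zero]; exact gD_mem
    · rw [H_one]; exact gD_mem
  | h₄ =>
    intro i _ hi
    have : i < 2 := by
      by_contra! h
      have := Nat.pow_le_pow_right (n := 2) (by norm_num) h
      omega
    rw [zeta_four]
    interval_cases i
    · rw [H_zero]; exact gF_mem
    · rw [H_one]; exact gF_mem
  | ho m hm ih =>
    intro i _ hi
    exact key m hm ih i (by omega)
  | he m hm ih =>
    intro i _ hi
    rw [zeta_even hm, ← zeta_odd hm, comm_mem_iff']
    exact (Subgroup.commutator_le_left _ _) (Subgroup.commutator_mem_commutator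
      (key m hm ih i hi) (Subgroup.mem_top gA))

/-- For `n > 2 ^ (i + 1)`, `Γₙ` is generated modulo `Γₙ₊₁` by `zeta n ∈ H (i + 1)` and squares from
`Γ_⌈n/2⌉ ≤ K i`. Iterating pushes the error term down until cofinality of `K (i + 1)` absorbs it. -/
theorem twoCentral_le_K (i : ℕ) : twoCentral G (2 ^ i + 1) ≤ K i := by
  induction i with
  | zero => rw [K_zero, pow_zero]
  | succ i ih =>
    have hp := Nat.one_le_two_pow (n := i)
    have step : ∀ n, 2 ^ (i + 1) + 1 ≤ n → twoCentral G n ≤ K (i + 1) ⊔ twoCentral G (n + 1) := by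
      intro n hn
      rw [pow_succ] at hn
      refine (twoCentral_le_mixed_sup_squares n (by omega)).trans (sup_le ?_ ?_)
      · refine (mixed_le_zpowers_sup (by omega)).trans (sup_le_sup_right ?_ _)
        rw [Subgroup.zpowers_le]
        exact H_le_K _ (zeta_mem_H n (by omega) _ (by omega) (by rw [pow_succ]; omega))
      · refine (squares_mono ?_).trans ((squares_K_le i).trans le_sup_left)
        exact (twoCentral_antitone (by omega)).trans ih
    have step' : ∀ k, twoCentral G (2 ^ (i + 1) + 1) ≤
        K (i + 1) ⊔ twoCentral G (2 ^ (i + 1) + 1 + k) := by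
      intro k
      induction k with
      | zero => exact le_sup_right
      | succ k ih => exact ih.trans (sup_le le_sup_left (step _ (by omega)))
    obtain ⟨N, -, hN⟩ := isCofinal_K (i + 1)
    exact (step' N).trans (sup_le le_rfl ((twoCentral_antitone (by omega)).trans hN))

/-! ### Upper bounds for the 2-central factors -/

section Index

variable {Γ : Type*} [Group Γ]

theorem relIndex_eq_card_map (M X : Subgroup Γ) [M.Normal] :
    M.relIndex X = Nat.card (X.map (QuotientGroup.mk' M)) := by
  rw [← Subgroup.relIndex_ker, QuotientGroup.ker_mk']

theorem relIndex_zpowers_sup_dvd_two (M : Subgroup Γ) [M.Normal] {z : Γ} (hz : z ^ 2 ∈ M) :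
    M.relIndex (Subgroup.zpowers z ⊔ M) ∣ 2 := by
  rw [Subgroup.relIndex_sup_right, relIndex_eq_card_map, MonoidHom.map_zpowers,
    Nat.card_zpowers]
  exact orderOf_dvd_of_pow_eq_one ((QuotientGroup.eq_one_iff (z ^ 2)).2 hz)

theorem relIndex_dvd_of_le_zpowers_sup {M X : Subgroup Γ} [M.Normal] {z : Γ} (hz : z ^ 2 ∈ M)
    (h : X ≤ Subgroup.zpowers z ⊔ M) (hM : M ≤ X) : M.relIndex X ∣ 2 :=
  (Dvd.intro _ (Subgroup.relIndex_mul_relIndex M X _ hM h)).trans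
    (relIndex_zpowers_sup_dvd_two M hz)

/-- Squaring is a homomorphism from `X` to `Γ ⧸ M` that kills `N`, and its image contains `Z` modulo
`M`. -/
theorem relIndex_dvd_of_le_sup_squares {X Z M N : Subgroup Γ} [M.Normal] (hX : ⁅X, X⁆ ≤ M)
    (hN : squares N ≤ M) (h : Z ≤ M ⊔ squares X) (hM : M ≤ Z) :
    M.relIndex Z ∣ N.relIndex X := by
  let f : X →* Γ ⧸ M :=
    { toFun := fun x => (x : Γ) ^ 2
      map_one' := by simp
      map_mul' := fun x y => by
        have h : Commute ((x : Γ) : Γ ⧸ M) ((y : Γ) : Γ ⧸ M) :=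
          (commutatorElement_mem_iff _ _ _).1 (hX (Subgroup.commutator_mem_commutator x.2 y.2))
        rw [Subgroup.coe_mul, QuotientGroup.mk_mul, h.mul_pow] }
  have h₁ : M.relIndex Z ∣ M.relIndex (squares X ⊔ M) := by
    rw [sup_comm]
    exact Dvd.intro _ (Subgroup.relIndex_mul_relIndex M Z _ hM h)
  have h₂ : (squares X).map (QuotientGroup.mk' M) ≤ f.range := by
    rw [Subgroup.map_le_iff_le_comap]
    refine squares_le.2 fun x hx => ⟨⟨x, hx⟩, rfl⟩
  have h₃ : N.subgroupOf X ≤ f.ker := fun x hx =>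
    (QuotientGroup.eq_one_iff ((x : Γ) ^ 2)).2 (hN (sq_mem_squares hx))
  rw [Subgroup.relIndex_sup_right, relIndex_eq_card_map M (squares X)] at h₁
  refine h₁.trans ((Subgroup.card_dvd_of_le h₂).trans ?_)
  rw [← Subgroup.index_ker]
  exact Subgroup.index_dvd_of_le h₃

end Index

/-- The rank of the factor `Γₙ / Γₙ₊₁` of the lower `2`-central series. -/
def rank (n : ℕ) : ℕ :=
  if n ≤ 1 then 2 else if n % 2 = 0 then rank (n / 2) + 1 else 1
  termination_by n

theorem rank_one : rank 1 = 2 := by rw [rank]; simp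

theorem rank_even {m : ℕ} (hm : 1 ≤ m) : rank (2 * m) = rank m + 1 := by
  rw [rank, if_neg (by omega), if_pos (by omega), show 2 * m / 2 = m by omega]

theorem rank_odd {m : ℕ} (hm : 1 ≤ m) : rank (2 * m + 1) = 1 := by
  rw [rank, if_neg (by omega), if_neg (by omega)]

theorem rank_two_pow (i : ℕ) : rank (2 ^ i) = i + 2 := by
  induction i with
  | zero => exact rank_one
  | succ i ih => rw [pow_succ', rank_even Nat.one_le_two_pow, ih]

theorem sum_rank (i : ℕ) : ∑ n ∈ Finset.range (2 ^ i), rank (n + 1) = 2 ^ (i + 1) + i := by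
  -- Even indices repeat the shorter sum with 1 added to each of its `m + 1` terms; the `m + 1` odd
  -- indices contribute 1 each, except index 1, which contributes 2.
  have key : ∀ m, ∑ n ∈ Finset.range (2 * (m + 1)), rank (n + 1) =
      ∑ n ∈ Finset.range (m + 1), rank (n + 1) + 2 * (m + 1) + 1 := by
    intro m
    induction m with
    | zero =>
      have : rank 2 = 3 := by simpa [rank_one] using rank_even (m := 1) le_rfl
      simp [Finset.sum_range_succ, rank_one, this]
    | succ m ih =>
      rw [show 2 * (m + 1 + 1) = 2 * (m + 1) + 1 + 1 by ring, Finset.sum_range_succ,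
        Finset.sum_range_succ, ih, Finset.sum_range_succ _ (m + 1), rank_odd (by omega),
        show 2 * (m + 1) + 1 + 1 = 2 * (m + 1 + 1) by ring, rank_even (by omega)]
      ring
  induction i with
  | zero => simp [rank_one]
  | succ i ih =>
    obtain ⟨m, hm⟩ := Nat.exists_eq_add_of_le' (Nat.one_le_two_pow (n := i))
    rw [pow_succ' 2 i]
    have := key m
    rw [← hm] at this
    rw [this, ih]
    ring

theorem isGreatest_rank (n : ℕ) (hn : 1 ≤ n) (h : ∀ i, n ≠ 2 ^ i) :
    IsGreatest {m : ℕ | ∃ i : ℕ, m = i + 1 ∧ 2 ^ i ∣ n} (rank n) := by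
  induction n using Nat.strong_induction_on with
  | _ n ih =>
    rcases Nat.even_or_odd' n with ⟨m, rfl | rfl⟩
    · have hm : ∀ i, m ≠ 2 ^ i := fun i hi => h (i + 1) (by rw [hi, pow_succ'])
      obtain ⟨⟨j, hj, hd⟩, hu⟩ := ih m (by omega) (by omega) hm
      rw [rank_even (by omega)]
      refine ⟨⟨j + 1, by rw [hj], by rw [pow_succ']; exact Nat.mul_dvd_mul_left 2 hd⟩, ?_⟩
      rintro _ ⟨i, rfl, hi⟩
      cases i with
      | zero => omega
      | succ i =>
        rw [pow_succ'] at hi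
        have := hu ⟨i, rfl, Nat.dvd_of_mul_dvd_mul_left (by norm_num) hi⟩
        omega
    · have hm : m ≠ 0 := fun hm => h 0 (by rw [hm]; rfl)
      rw [rank_odd (by omega)]
      refine ⟨⟨0, rfl, by simp⟩, ?_⟩
      rintro _ ⟨i, rfl, hi⟩
      cases i with
      | zero => exact le_rfl
      | succ i =>
        rw [pow_succ'] at hi
        have := dvd_of_mul_right_dvd hi
        omega

theorem relIndex_mixed_dvd {n : ℕ} (hn : 2 ≤ n) :
    (twoCentral G (n + 1)).relIndex (mixed G n) ∣ 2 :=
  relIndex_dvd_of_le_zpowers_sup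
    (sq_mem_twoCentral (by omega) (by omega) (zeta_mem_twoCentral hn)) (mixed_le_zpowers_sup hn)
    (le_mixed le_rfl)

theorem relIndex_twoCentral_one : (twoCentral G 2).relIndex (twoCentral G 1) ∣ 4 := by
  have hsq (g : G) : g ^ 2 ∈ twoCentral G 2 :=
    sq_mem_twoCentral (n := 1) le_rfl le_rfl (by rw [twoCentral_one]; trivial)
  have hc : commutator G ≤ twoCentral G 2 := by
    rw [← gamma_two]
    exact gamma_le_twoCentral 2 (by norm_num)
  let X : Subgroup G := Subgroup.zpowers gB ⊔ twoCentral G 2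
  have hX : X.Normal := Subgroup.Normal.of_commutator_le _ (hc.trans le_sup_right)
  have h₁ : (twoCentral G 2).relIndex X ∣ 2 := relIndex_zpowers_sup_dvd_two _ (hsq _)
  have h₂ : X.relIndex ⊤ ∣ 2 := by
    refine relIndex_dvd_of_le_zpowers_sup (z := gA) (Subgroup.mem_sup_right (hsq _)) ?_ le_top
    rw [← closure_gA_gB, Subgroup.closure_le]
    rintro _ (rfl | rfl)
    · exact Subgroup.mem_sup_left (Subgroup.mem_zpowers _)
    · exact Subgroup.mem_sup_right (Subgroup.mem_sup_left (Subgroup.mem_zpowers _))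
  rw [twoCentral_one, ← Subgroup.relIndex_mul_relIndex _ X _ le_sup_right le_top]
  exact mul_dvd_mul h₁ h₂

/-- The step from `Γₙ₊₁` to `mixed G n` has index at most 2. The step from there to `Γₙ` is trivial
for odd `n`, and for `n = 2m` it is an image under squaring of `Γₘ` modulo `Γₘ₊₁`. -/
theorem relIndex_twoCentral_dvd (n : ℕ) (hn : 1 ≤ n) :
    (twoCentral G (n + 1)).relIndex (twoCentral G n) ∣ 2 ^ rank n := by
  induction n using Nat.strong_induction_on with
  | _ n ih =>
    rcases hn.eq_or_lt with rfl | hn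
    · rw [rank_one]
      exact relIndex_twoCentral_one
    · rw [← Subgroup.relIndex_mul_relIndex _ (mixed G n) _ (le_mixed le_rfl)
        (mixed_le n (by omega))]
      have h := twoCentral_le_mixed_sup_squares (Γ := G) n (by omega)
      rcases Nat.even_or_odd' n with ⟨m, rfl | rfl⟩
      · rw [rank_even (by omega), pow_succ']
        refine mul_dvd_mul (relIndex_mixed_dvd hn) (dvd_trans ?_ (ih m (by omega) (by omega)))
        rw [show (2 * m + 1) / 2 = m by omega] at h
        refine relIndex_dvd_of_le_sup_squares ?_ ?_ h
          (mixed_le _ (by omega))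
        · rw [two_mul]
          exact commutator_twoCentral_le_mixed m m (by omega) (by omega)
        · exact squares_le.2 fun x hx =>
            le_mixed (m := 2 * m + 1) le_rfl (sq_mem_twoCentral (by omega) (by omega) hx)
      · rw [rank_odd (by omega), pow_one]
        have h' : twoCentral G (2 * m + 1) ≤ mixed G (2 * m + 1) := by
          refine h.trans (sup_le le_rfl (squares_le.2 fun x hx => ?_))
          exact le_mixed (m := 2 * m + 1 + 1) le_rfl (sq_mem_twoCentral (by omega) (by omega) hx)
        rw [Subgroup.relIndex_eq_one.2 h', mul_one]
        exact relIndex_mixed_dvd (by omega)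

theorem index_twoCentral (n : ℕ) : (twoCentral G (n + 1)).index =
    ∏ k ∈ Finset.range n, (twoCentral G (k + 1 + 1)).relIndex (twoCentral G (k + 1)) := by
  induction n with
  | zero => simp [twoCentral_one]
  | succ n ih =>
    rw [Finset.prod_range_succ, ← ih, mul_comm]
    exact (Subgroup.relIndex_mul_index (twoCentral_antitone (by omega))).symm

theorem index_twoCentral_dvd (i : ℕ) : (twoCentral G (2 ^ i + 1)).index ∣ 2 ^ (2 ^ (i + 1) + i) := by
  rw [index_twoCentral, ← sum_rank, ← Finset.prod_pow_eq_pow_sum]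
  exact Finset.prod_dvd_prod_of_dvd _ _ fun k _ => relIndex_twoCentral_dvd (k + 1) (by omega)

theorem index_K_ne_zero (i : ℕ) : (K i).index ≠ 0 := fun h => by
  have h₁ := Subgroup.index_dvd_of_le (twoCentral_le_K i)
  rw [h, zero_dvd_iff] at h₁
  have h₂ := index_twoCentral_dvd i
  rw [h₁, zero_dvd_iff] at h₂
  simp at h₂

theorem relIndex_H_ne_zero (i : ℕ) : (H i).relIndex (gamma G 3) ≠ 0 := fun h => by
  have h₁ : (H i).relIndex (gamma G 3) ∣ (K i).relIndex (gamma G 3) := by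
    rw [← Subgroup.inf_relIndex_right (K i)]
    exact Subgroup.relIndex_dvd_of_le_left _ (K_inf_gamma_le i)
  rw [h, zero_dvd_iff] at h₁
  have h₂ := Subgroup.relIndex_dvd_index_of_normal (K i) (gamma G 3)
  rw [h₁, zero_dvd_iff] at h₂
  exact index_K_ne_zero i h₂

/-! ### Lower bounds and exact orders -/

theorem eq_of_fin_sub_eq_mul {M : ℕ} {x x' : Fin M} {k : ℤ}
    (h : (x' : ℤ) - (x : ℤ) = (M : ℤ) * k) : x = x' := by
  have h₁ := x.2
  have h₂ := x'.2
  have : ((x' : ℕ) : ℤ) - ((x : ℕ) : ℤ) = 0 :=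
    Int.eq_zero_of_abs_lt_dvd ⟨k, h⟩ (abs_lt.2 ⟨by omega, by omega⟩)
  exact Fin.ext (by omega)

/-- The elements `dˣ fʸ ⟨p, q⟩` with `0 ≤ x, y < 2 ^ i` and `p`, `q` representatives of `γ₃` modulo
`H i` are distinct modulo `H (i + 1)`: coordinates there are divisible by `2 ^ i`, and its part in
`γ₃ × γ₃` lies in `H i × H i`. -/
theorem le_relIndex_H_succ (i : ℕ) :
    2 ^ (2 * i) * (H i).relIndex (gamma G 3) ^ 2 ≤ (H (i + 1)).relIndex (gamma G 3) := by
  let Q := gamma G 3 ⧸ (H i).subgroupOf (gamma G 3)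
  have hpair (p q : gamma G 3) : ∃ g, IsPair g (p : G) (q : G) :=
    (exists_isPair (gamma_three_le_commutator p.2) (gamma_three_le_commutator q.2)).imp
      fun _ h => h.2
  choose P hP using hpair
  have hP' (p q : gamma G 3) : P p q ∈ dbl (gamma G 3) :=
    (mem_dbl_iff (hP p q)).2 ⟨p.2, q.2⟩
  let f : (Fin (2 ^ i) × Fin (2 ^ i)) × (Q × Q) → gamma G 3 ⧸ (H (i + 1)).subgroupOf (gamma G 3) :=
    fun z => QuotientGroup.mk ⟨gD ^ (z.1.1 : ℤ) * gF ^ (z.1.2 : ℤ) * P z.2.1.out z.2.2.out,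
      mul_mem (mul_mem (zpow_mem gD_mem _) (zpow_mem gF_mem _)) (dbl_gamma_three_le (hP' _ _))⟩
  have hf : Function.Injective f := by
    rintro ⟨⟨x, y⟩, p, q⟩ ⟨⟨x', y'⟩, p', q'⟩ h
    have h : (gD ^ (x : ℤ) * gF ^ (y : ℤ) * P p.out q.out)⁻¹ *
        (gD ^ (x' : ℤ) * gF ^ (y' : ℤ) * P p'.out q'.out) ∈ H (i + 1) :=
      (QuotientGroup.eq (s := (H (i + 1)).subgroupOf (gamma G 3))).1 h
    obtain ⟨m, n, w⟩ := (form i).coord h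
    have w' := ((Coord.zpow_mul_zpow (x : ℤ) (y : ℤ)).mul (Coord.of_mem (hP' p.out q.out))).inv.mul
      ((Coord.zpow_mul_zpow (x' : ℤ) (y' : ℤ)).mul (Coord.of_mem (hP' p'.out q'.out)))
    have e := w'.unique w
    obtain rfl : x = x' := eq_of_fin_sub_eq_mul (k := m) (by push_cast; linarith [e.1])
    obtain rfl : y = y' := eq_of_fin_sub_eq_mul (k := n) (by push_cast; linarith [e.2])
    rw [show ∀ u v w : G, (u * v)⁻¹ * (u * w) = v⁻¹ * w by intros; group] at h
    have h' := H_inf_dbl_le i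
      ⟨h, (dbl (gamma G 3)).mul_mem ((dbl (gamma G 3)).inv_mem (hP' _ _)) (hP' _ _)⟩
    rw [mem_dbl_iff ((hP _ _).inv.mul (hP _ _))] at h'
    have hp : p = p' := by
      rw [← p.out_eq, ← p'.out_eq]
      exact QuotientGroup.eq.2 h'.1
    have hq : q = q' := by
      rw [← q.out_eq, ← q'.out_eq]
      exact QuotientGroup.eq.2 h'.2
    rw [hp, hq]
  have : Finite (gamma G 3 ⧸ (H (i + 1)).subgroupOf (gamma G 3)) :=
    Nat.finite_of_card_ne_zero (relIndex_H_ne_zero (i + 1))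
  have hc := Nat.card_le_card_of_injective f hf
  rw [Nat.card_prod, Nat.card_prod, Nat.card_prod, Nat.card_fin] at hc
  refine le_trans (le_of_eq ?_) hc
  rw [two_mul, pow_add, pow_two]
  rfl

theorem le_relIndex_H (i : ℕ) : 2 ^ 2 ^ (i + 1) ≤ 2 ^ (2 * i + 2) * (H i).relIndex (gamma G 3) := by
  induction i with
  | zero =>
    have := Nat.pos_of_ne_zero (relIndex_H_ne_zero 0)
    norm_num
    omega
  | succ i ih =>
    calc 2 ^ 2 ^ (i + 1 + 1) = (2 ^ 2 ^ (i + 1)) ^ 2 := by rw [← pow_mul, ← pow_succ]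
      _ ≤ (2 ^ (2 * i + 2) * (H i).relIndex (gamma G 3)) ^ 2 := Nat.pow_le_pow_left ih 2
      _ = 2 ^ (2 * (i + 1) + 2) * (2 ^ (2 * i) * (H i).relIndex (gamma G 3) ^ 2) := by ring
      _ ≤ _ := Nat.mul_le_mul_left _ (le_relIndex_H_succ i)

/-- The elements `aˣ bʸ cᶻ q` with `x, y < 2 ^ (i + 1)`, `z < 2 ^ i` and `q` representing `γ₃`
modulo `H i` are distinct modulo `K i`, by the normal form and the independence of `a, b` modulo
`γ₂` and of `c` modulo `γ₃`. -/
theorem le_index_K_of_relIndex (i : ℕ) :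
    2 ^ (3 * i + 2) * (H i).relIndex (gamma G 3) ≤ (K i).index := by
  let Q := gamma G 3 ⧸ (H i).subgroupOf (gamma G 3)
  let f : ((Fin (2 ^ (i + 1)) × Fin (2 ^ (i + 1))) × Fin (2 ^ i)) × Q → G ⧸ K i :=
    fun z => QuotientGroup.mk
      (gA ^ (z.1.1.1 : ℤ) * gB ^ (z.1.1.2 : ℤ) * gC ^ (z.1.2 : ℤ) * (z.2.out : G))
  have ab_gamma (h : gamma G 3) : ((h : G) : Ab) = 1 :=
    ab_eq_one_iff.2 (gamma_three_le_commutator h.2)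
  have hf : Function.Injective f := by
    rintro ⟨⟨⟨x, y⟩, z⟩, q⟩ ⟨⟨⟨x', y'⟩, z'⟩, q'⟩ h
    have h : (gA ^ (x : ℤ) * gB ^ (y : ℤ) * gC ^ (z : ℤ) * (q.out : G))⁻¹ *
        (gA ^ (x' : ℤ) * gB ^ (y' : ℤ) * gC ^ (z' : ℤ) * (q'.out : G)) ∈ K i := QuotientGroup.eq.1 h
    obtain ⟨m, n, e⟩ := ab_of_mem_K h
    simp only [QuotientGroup.mk_mul, QuotientGroup.mk_inv, QuotientGroup.mk_zpow, ab_gamma, ab_C,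
      one_zpow, mul_one] at e
    have e' : (gA : Ab) ^ ((x' : ℤ) - x - 2 ^ (i + 1) * m) *
        (gB : Ab) ^ ((y' : ℤ) - y - 2 ^ (i + 1) * n) = 1 := by
      rw [inv_mul_eq_iff_eq_mul] at e
      rw [zpow_sub, zpow_sub, zpow_sub, zpow_sub]
      rw [show ∀ a b c d e f : Ab, a * b⁻¹ * c⁻¹ * (d * e⁻¹ * f⁻¹) =
        a * d * (b * e * (c * f))⁻¹ by
          intros
          simp only [mul_inv]
          ac_rfl, e, mul_inv_cancel]
    have hxy := ab_injective e'
    obtain rfl : x = x' := eq_of_fin_sub_eq_mul (k := m) (by push_cast; linarith [hxy.1])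
    obtain rfl : y = y' := eq_of_fin_sub_eq_mul (k := n) (by push_cast; linarith [hxy.2])
    rw [show ∀ u v w r s : G, (u * v * w)⁻¹ * (u * r * s) = w⁻¹ * (v⁻¹ * r) * s by
      intros; group] at h
    have hγ (h : gamma G 3) : (h : G) ∈ commutator G := gamma_three_le_commutator h.2
    obtain ⟨t, u, hu, e⟩ := exists_of_mem_K_of_mem_commutator h (mul_mem (mul_mem
      (inv_mem (hγ _)) (mul_mem (inv_mem (zpow_mem gC_mem _)) (zpow_mem gC_mem _))) (hγ _))
    have e₃ := congrArg (QuotientGroup.mk' (gamma G 3)) e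
    have hq (h : G) (hh : h ∈ gamma G 3) : QuotientGroup.mk' (gamma G 3) h = 1 :=
      (QuotientGroup.eq_one_iff h).2 hh
    simp only [map_mul, map_inv, map_zpow, hq _ q.out.2, hq _ q'.out.2, hq _ (H_le_gamma i hu),
      inv_one, one_mul, mul_one] at e₃
    rw [← zpow_neg, ← zpow_add, ← map_zpow, ← map_zpow, QuotientGroup.mk'_apply,
      QuotientGroup.mk'_apply, QuotientGroup.eq, ← zpow_neg, ← zpow_add] at e₃
    have hz := C_injective e₃
    obtain rfl : z = z' := eq_of_fin_sub_eq_mul (k := t) (by push_cast; linarith)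
    rw [inv_mul_cancel, mul_one] at h
    have hqq : q = q' := by
      rw [← q.out_eq, ← q'.out_eq]
      exact QuotientGroup.eq.2 (K_inf_gamma_le i
        ⟨h, (gamma G 3).mul_mem ((gamma G 3).inv_mem q.out.2) q'.out.2⟩)
    rw [hqq]
  have : Finite (G ⧸ K i) := Nat.finite_of_card_ne_zero (index_K_ne_zero i)
  have hc := Nat.card_le_card_of_injective f hf
  rw [Nat.card_prod, Nat.card_prod, Nat.card_prod, Nat.card_fin, Nat.card_fin] at hc
  refine le_trans (le_of_eq ?_) hc
  rw [show 3 * i + 2 = i + 1 + (i + 1) + i by ring, pow_add, pow_add]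
  rfl

theorem le_index_K (i : ℕ) : 2 ^ (2 ^ (i + 1) + i) ≤ (K i).index := by
  calc 2 ^ (2 ^ (i + 1) + i) = 2 ^ 2 ^ (i + 1) * 2 ^ i := pow_add _ _ _
    _ ≤ 2 ^ (2 * i + 2) * (H i).relIndex (gamma G 3) * 2 ^ i :=
      Nat.mul_le_mul_right _ (le_relIndex_H i)
    _ = 2 ^ (3 * i + 2) * (H i).relIndex (gamma G 3) := by
      rw [show 3 * i + 2 = 2 * i + 2 + i by ring, pow_add _ _ i]
      ring
    _ ≤ _ := le_index_K_of_relIndex i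

/-- One strict inequality among the upper bounds would make the index of `Γ` at `2 ^ (m + 1) + 1`
smaller than the lower bound for the index of `K (m + 1)`, which contains it. -/
theorem relIndex_twoCentral (n : ℕ) (hn : 1 ≤ n) :
    (twoCentral G (n + 1)).relIndex (twoCentral G n) = 2 ^ rank n := by
  have hle (k : ℕ) : (twoCentral G (k + 1 + 1)).relIndex (twoCentral G (k + 1)) ≤
      2 ^ rank (k + 1) := Nat.le_of_dvd (by positivity) (relIndex_twoCentral_dvd _ (by omega))
  have hpos (k : ℕ) : 0 < (twoCentral G (k + 1 + 1)).relIndex (twoCentral G (k + 1)) :=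
    Nat.pos_of_dvd_of_pos (relIndex_twoCentral_dvd _ (by omega)) (by positivity)
  obtain ⟨m, rfl⟩ := Nat.exists_eq_add_of_le' hn
  by_contra hne
  have h₁ : (twoCentral G (2 ^ (m + 1) + 1)).index < 2 ^ (2 ^ (m + 1 + 1) + (m + 1)) := by
    rw [index_twoCentral, ← sum_rank, ← Finset.prod_pow_eq_pow_sum]
    refine Finset.prod_lt_prod (fun k _ => hpos k) (fun k _ => hle k) ⟨m, ?_, ?_⟩
    · rw [Finset.mem_range]
      exact (Nat.lt_succ_self m).trans Nat.lt_two_pow_self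
    · exact lt_of_le_of_ne (hle m) hne
  have h₂ : (twoCentral G (2 ^ (m + 1) + 1)).index ≠ 0 :=
    fun h => by simpa [h] using index_twoCentral_dvd (m + 1)
  have h₃ := Nat.le_of_dvd (Nat.pos_of_ne_zero h₂)
    (Subgroup.index_dvd_of_le (twoCentral_le_K (m + 1)))
  exact absurd ((le_index_K (m + 1)).trans h₃) (not_le.2 h₁)

/-! ### Structure of the factor groups -/

section Structure

variable {Q : Type*} [Group Q]

theorem nonempty_mulEquiv_int_prod {u v : Q} (h : Commute u v)
    (hi : ∀ m n : ℤ, u ^ m * v ^ n = 1 → m = 0 ∧ n = 0) (hs : ∀ q, ∃ m n : ℤ, q = u ^ m * v ^ n) :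
    Nonempty (Q ≃* Multiplicative (ℤ × ℤ)) := by
  let f : Multiplicative (ℤ × ℤ) →* Q :=
    { toFun := fun z => u ^ z.toAdd.1 * v ^ z.toAdd.2
      map_one' := by simp
      map_mul' := fun z w => by
        rw [toAdd_mul, Prod.fst_add, Prod.snd_add, zpow_add, zpow_add]
        exact (h.zpow_zpow _ _).mul_mul_mul_comm _ _ }
  refine ⟨(MulEquiv.ofBijective f
    ⟨(injective_iff_map_eq_one f).2 fun z hz => ?_, fun q => ?_⟩).symm⟩
  · have := hi _ _ hz
    exact Multiplicative.toAdd.injective (Prod.ext this.1 this.2)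
  · obtain ⟨m, n, rfl⟩ := hs q
    exact ⟨Multiplicative.ofAdd (m, n), rfl⟩

theorem nonempty_mulEquiv_int {u : Q} (hi : ∀ n : ℤ, u ^ n = 1 → n = 0)
    (hs : ∀ q, ∃ n : ℤ, q = u ^ n) : Nonempty (Q ≃* Multiplicative ℤ) := by
  refine ⟨(MulEquiv.ofBijective (zpowersHom Q u)
    ⟨(injective_iff_map_eq_one _).2 fun z hz => ?_, fun q => ?_⟩).symm⟩
  · exact Multiplicative.toAdd.injective (hi _ hz)
  · obtain ⟨n, rfl⟩ := hs q
    exact ⟨Multiplicative.ofAdd n, rfl⟩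

theorem nonempty_mulEquiv_zmod {u : Q} {n : ℕ} (h : orderOf u = n) (hs : ∀ q, ∃ n : ℤ, q = u ^ n) :
    Nonempty (Q ≃* Multiplicative (ZMod n)) := by
  have hs' : ∀ q, q ∈ Subgroup.zpowers u := fun q => by
    obtain ⟨n, rfl⟩ := hs q
    exact ⟨n, rfl⟩
  have hc : IsCyclic Q := ⟨u, hs'⟩
  rw [orderOf_eq_card_of_forall_mem_zpowers hs'] at h
  subst h
  exact ⟨(zmodCyclicMulEquiv hc).symm⟩

theorem nonempty_mulEquiv_of_sq_eq_one {r : ℕ} (h : ∀ q : Q, q ^ 2 = 1) (hc : Nat.card Q = 2 ^ r) :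
    Nonempty (Q ≃* Multiplicative (Fin r → ZMod 2)) := by
  let _ : CommGroup Q :=
    { (inferInstance : Group Q) with
      mul_comm := fun x y => by
        have hinv (z : Q) : z⁻¹ = z := inv_eq_of_mul_eq_one_left (by rw [← pow_two, h])
        rw [← hinv (x * y), mul_inv_rev, hinv, hinv] }
  let _ : Module (ZMod 2) (Additive Q) := AddCommGroup.zmodModule fun q => h q.toMul
  have : Finite (Additive Q) := Nat.finite_of_card_ne_zero (α := Q) (by rw [hc]; positivity)
  have hf : Module.finrank (ZMod 2) (Additive Q) = r := by
    have h₁ := Module.natCard_eq_pow_finrank (K := ZMod 2) (V := Additive Q)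
    rw [Nat.card_zmod, show Nat.card (Additive Q) = 2 ^ r from hc] at h₁
    exact (Nat.pow_right_injective le_rfl h₁).symm
  have e := LinearEquiv.ofFinrankEq (Additive Q) (Fin r → ZMod 2) (by rw [hf]; simp)
  exact ⟨AddEquiv.toMultiplicativeRight e.toAddEquiv⟩

end Structure

theorem factor_twoCentral {n : ℕ} (hn : 1 ≤ n) :
    Nonempty (Factor (twoCentral G n) (twoCentral G (n + 1)) ≃*
      Multiplicative (Fin (rank n) → ZMod 2)) := by
  refine nonempty_mulEquiv_of_sq_eq_one (fun q => ?_) (relIndex_twoCentral n hn)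
  obtain ⟨⟨g, hg⟩, rfl⟩ := QuotientGroup.mk_surjective q
  exact (QuotientGroup.eq_one_iff _).2
    (Subgroup.mem_subgroupOf.2 (sq_mem_twoCentral hn (by omega) hg))

theorem factor_gamma_one : Nonempty (Factor (gamma G 1) (gamma G 2) ≃* Multiplicative (ℤ × ℤ)) := by
  let u : gamma G 1 := ⟨gA, trivial⟩
  let v : gamma G 1 := ⟨gB, trivial⟩
  have hmem (g h : gamma G 1) (e : ((g : G) : Ab) = (h : G)) :
      (g : Factor (gamma G 1) (gamma G 2)) = h :=
    QuotientGroup.eq.2 (Subgroup.mem_subgroupOf.2 (QuotientGroup.eq.1 e))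
  refine nonempty_mulEquiv_int_prod (u := (u : Factor (gamma G 1) (gamma G 2)))
    (v := (v : Factor (gamma G 1) (gamma G 2))) (hmem (u * v) (v * u) (mul_comm (gA : Ab) gB)) ?_ ?_
  · intro m n h
    have h' : ((u ^ m * v ^ n : gamma G 1) : Factor (gamma G 1) (gamma G 2)) = 1 := h
    rw [QuotientGroup.eq_one_iff, Subgroup.mem_subgroupOf] at h'
    exact ab_injective (ab_eq_one_iff.2 h')
  · intro q
    obtain ⟨g, rfl⟩ := QuotientGroup.mk_surjective q
    obtain ⟨m, n, e⟩ := exists_ab_eq g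
    exact ⟨m, n, hmem g (u ^ m * v ^ n) e⟩

theorem factor_gamma_two : Nonempty (Factor (gamma G 2) (gamma G 3) ≃* Multiplicative ℤ) := by
  let u : gamma G 2 := ⟨gC, gC_mem⟩
  refine nonempty_mulEquiv_int (u := (u : Factor (gamma G 2) (gamma G 3))) ?_ ?_
  · intro n h
    have h' : ((u ^ n : gamma G 2) : Factor (gamma G 2) (gamma G 3)) = 1 := h
    rw [QuotientGroup.eq_one_iff, Subgroup.mem_subgroupOf] at h'
    exact C_injective h'
  · intro q
    obtain ⟨⟨g, hg⟩, rfl⟩ := QuotientGroup.mk_surjective q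
    obtain ⟨n, h, hh, rfl⟩ := exists_C_zpow hg
    refine ⟨n, ?_⟩
    have := (QuotientGroup.eq (s := (gamma G 3).subgroupOf (gamma G 2)) (a := u ^ n)
      (b := ⟨gC ^ n * h, hg⟩)).2 (Subgroup.mem_subgroupOf.2 (by simpa [u] using hh))
    exact this.symm

/-- The character `x + 2y mod 4` vanishes on `γ₄`, since commutation with `a` gives `-2x + 2(x - 2y)
= -4y`. Conversely `f² = [f, a]⁻¹` and `e² ≡ d⁻⁴f²` put `d⁴` into `γ₄`. -/
theorem D_zpow_mem_gamma_four {n : ℤ} : gD ^ n ∈ gamma G 4 ↔ 4 ∣ n := by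
  constructor
  · let T : Subgroup G :=
      { carrier := {g | ∃ x y : ℤ, Coord g x y ∧ 4 ∣ x + 2 * y}
        one_mem' := ⟨0, 0, Coord.of_mem (one_mem _), by simp⟩
        mul_mem' := by
          rintro g h ⟨x, y, w, e⟩ ⟨x', y', w', e'⟩
          exact ⟨_, _, w.mul w', by omega⟩
        inv_mem' := by
          rintro g ⟨x, y, w, e⟩
          exact ⟨_, _, w.inv, by omega⟩ }
    have hT : T.Normal := by
      apply normal_of_conj
      · rintro g ⟨x, y, w, e⟩
        exact ⟨_, _, w.conjA, by omega⟩
      · rintro g ⟨x, y, w, e⟩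
        exact ⟨_, _, w.conjA_inv, by omega⟩
      · rintro g ⟨x, y, w, e⟩
        exact ⟨_, _, w.conjB, e⟩
      · rintro g ⟨x, y, w, e⟩
        exact ⟨_, _, w.conjB_inv, e⟩
    have hcomm (g s : G) : comm g s = g⁻¹ * (s⁻¹ * g * s) := by simp [comm, mul_assoc]
    have h : gamma G 4 ≤ T := by
      rw [gamma_succ 3 (by norm_num)]
      apply commutator_top_le
      · intro g hg
        obtain ⟨x, y, w⟩ := exists_coord hg
        rw [← comm_mem_iff', hcomm]
        exact ⟨_, _, w.inv.mul w.conjA, by omega⟩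
      · intro g hg
        obtain ⟨x, y, w⟩ := exists_coord hg
        rw [← comm_mem_iff', hcomm]
        exact ⟨_, _, w.inv.mul w.conjB, by omega⟩
    intro hn
    obtain ⟨x, y, w, e⟩ := h hn
    have := w.unique (Coord.D.zpow n)
    omega
  · rintro ⟨k, rfl⟩
    rw [zpow_mul]
    refine zpow_mem ?_ k
    have h₁ : gF ^ 2 ∈ gamma G 4 := by
      have : gF ^ 2 = (comm gF gA)⁻¹ := by
        have : comm gF gA = gF⁻¹ * (gA⁻¹ * gF * gA) := by simp [comm, mul_assoc]
        rw [this, conjA_F, pow_two, mul_inv_rev, inv_inv]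
      rw [this, gamma_succ 3 (by norm_num)]
      refine inv_mem ?_
      rw [comm_mem_iff']
      exact Subgroup.commutator_mem_commutator gF_mem trivial
    obtain ⟨t, ht, e⟩ := ((((Coord.E.zpow 2).inv.mul (Coord.F.zpow 2))).exists_eq)
    have h₂ : gD ^ (4 : ℤ) = (gE ^ (2 : ℤ))⁻¹ * gF ^ (2 : ℤ) * t⁻¹ := by
      rw [e]
      norm_num
    rw [h₂]
    refine mul_mem (mul_mem (inv_mem (zpow_mem gE_mem_gamma_four _)) ?_)
      (inv_mem (dbl_gamma_three_le_four ht))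
    exact_mod_cast h₁

theorem factor_gamma_three :
    Nonempty (Factor (gamma G 3) (gamma G 4) ≃* Multiplicative (ZMod 4)) := by
  let u : gamma G 3 := ⟨gD, gD_mem⟩
  have hu (n : ℤ) : (u : Factor (gamma G 3) (gamma G 4)) ^ n = 1 ↔ 4 ∣ n := by
    rw [← D_zpow_mem_gamma_four, ← QuotientGroup.mk_zpow, QuotientGroup.eq_one_iff,
      Subgroup.mem_subgroupOf]
    rfl
  refine nonempty_mulEquiv_zmod (u := (u : Factor (gamma G 3) (gamma G 4))) ?_ ?_
  · refine Nat.dvd_antisymm (orderOf_dvd_of_pow_eq_one ?_) ?_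
    · have := (hu 4).2 dvd_rfl
      exact_mod_cast this
    · have := (hu (orderOf (u : Factor (gamma G 3) (gamma G 4)))).1
        (by rw [zpow_natCast, pow_orderOf_eq_one])
      exact_mod_cast this
  · intro q
    obtain ⟨⟨g, hg⟩, rfl⟩ := QuotientGroup.mk_surjective q
    obtain ⟨x, y, w⟩ := exists_coord hg
    -- Since `f ≡ d²e` modulo `G''`, `dˣ fʸ ≡ d^(x+2y) eʸ`, and `e ∈ γ₄`.
    refine ⟨x + 2 * y, ?_⟩
    obtain ⟨t, ht, e⟩ := ((Coord.D.zpow (x + 2 * y)).mul (Coord.E.zpow y)).inv.mul w |>.exists_eq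
    have hm : (gD ^ (x + 2 * y))⁻¹ * g ∈ gamma G 4 := by
      have h₁ : (gD ^ (x + 2 * y) * gE ^ y)⁻¹ * g = t := by
        rw [e]
        have h₁ : -((x + 2 * y) * 1 + y * -2) + x = 0 := by ring
        have h₂ : -((x + 2 * y) * 0 + y * 1) + y = 0 := by ring
        rw [h₁, h₂]
        simp
      have h₂ : (gD ^ (x + 2 * y))⁻¹ * g =
          gE ^ y * ((gD ^ (x + 2 * y) * gE ^ y)⁻¹ * g) := by group
      rw [h₂, h₁]
      exact mul_mem (zpow_mem gE_mem_gamma_four _) (dbl_gamma_three_le_four ht)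
    have := (QuotientGroup.eq (s := (gamma G 4).subgroupOf (gamma G 3)) (a := u ^ (x + 2 * y))
      (b := ⟨g, hg⟩)).2 (Subgroup.mem_subgroupOf.2 hm)
    exact this.symm

/-- The homomorphism from `γₙ` to `G / γₙ₊₂` given by commutation with `s`. -/
noncomputable def bracketHom (n : ℕ) (hn : 1 ≤ n) (s : G) : gamma G n →* G ⧸ gamma G (n + 2) where
  toFun x := ((⁅(x : G), s⁆ : G) : G ⧸ gamma G (n + 2))
  map_one' := by simp
  map_mul' x y := by
    have h : ⁅⁅(y : G), s⁆, (x : G)⁆ ∈ gamma G (n + 2) := by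
      rw [gamma_succ (n + 1) (by omega), gamma_succ n hn]
      exact Subgroup.commutator_mem_commutator
        (Subgroup.commutator_mem_commutator y.2 trivial) trivial
    rw [commutatorElement_mem_iff] at h
    have e : ⁅(x : G) * y, s⁆ = x * ⁅(y : G), s⁆ * (x : G)⁻¹ * ⁅(x : G), s⁆ := by
      simp only [commutatorElement_def]
      group
    have h' : ⁅⁅(y : G), s⁆, ⁅(x : G), s⁆⁆ ∈ gamma G (n + 2) := by
      rw [gamma_succ (n + 1) (by omega), gamma_succ n hn]
      exact Subgroup.commutator_mem_commutator
        (Subgroup.commutator_mem_commutator y.2 trivial) trivial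
    rw [commutatorElement_mem_iff] at h'
    rw [Subgroup.coe_mul, e, QuotientGroup.mk_mul, QuotientGroup.mk_mul, QuotientGroup.mk_mul,
      QuotientGroup.mk_inv, ← h.eq, mul_inv_cancel_right, h'.eq]

theorem bracketHom_apply_commute (n : ℕ) (hn : 1 ≤ n) (s : G) (x : gamma G n)
    (g : G ⧸ gamma G (n + 2)) : Commute (bracketHom n hn s x) g := by
  obtain ⟨g, rfl⟩ := QuotientGroup.mk_surjective g
  refine (commutatorElement_mem_iff _ ⁅(x : G), s⁆ g).1 ?_
  rw [gamma_succ (n + 1) (by omega), gamma_succ n hn]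
  exact Subgroup.commutator_mem_commutator
    (Subgroup.commutator_mem_commutator x.2 trivial) trivial

theorem finite_range_bracketHom (n : ℕ) (hn : 1 ≤ n)
    (h : (gamma G (n + 1)).relIndex (gamma G n) ≠ 0) (s : G) : Finite (bracketHom n hn s).range := by
  have hk : (gamma G (n + 1)).subgroupOf (gamma G n) ≤ (bracketHom n hn s).ker := fun x hx => by
    refine (QuotientGroup.eq_one_iff ⁅(x : G), s⁆).2 ?_
    rw [gamma_succ (n + 1) (by omega)]
    exact Subgroup.commutator_mem_commutator hx trivial
  refine Nat.finite_of_card_ne_zero fun h₀ => h ?_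
  have := Subgroup.index_dvd_of_le hk
  rwa [Subgroup.index_ker, h₀, zero_dvd_iff] at this

/-- Modulo `γₙ₊₂`, commutation with `a` and with `b` factors through the finite group `γₙ / γₙ₊₁`;
the two finite central images generate a finite group containing the image of `γₙ₊₁`. -/
theorem relIndex_gamma_succ_ne_zero (n : ℕ) (hn : 1 ≤ n)
    (h : (gamma G (n + 1)).relIndex (gamma G n) ≠ 0) :
    (gamma G (n + 2)).relIndex (gamma G (n + 1)) ≠ 0 := by
  have hnormal (s : G) : (bracketHom n hn s).range.Normal := by
    constructor
    rintro _ ⟨x, rfl⟩ g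
    rw [← (bracketHom_apply_commute n hn s x g).eq, mul_inv_cancel_right]
    exact ⟨x, rfl⟩
  have hA := hnormal gA
  have hB := hnormal gB
  have fA := finite_range_bracketHom n hn h gA
  have fB := finite_range_bracketHom n hn h gB
  let R := (bracketHom n hn gA).range ⊔ (bracketHom n hn gB).range
  have hR : Finite R := by
    have : (R : Set (G ⧸ gamma G (n + 2))).Finite := by
      rw [Subgroup.mul_normal]
      exact Set.Finite.mul (Set.toFinite _) (Set.toFinite _)
    exact this
  have hle : (gamma G (n + 1)).map (QuotientGroup.mk' (gamma G (n + 2))) ≤ R := by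
    rw [Subgroup.map_le_iff_le_comap, gamma_succ n hn]
    apply commutator_top_le
    · exact fun x hx => Subgroup.mem_sup_left ⟨⟨x, hx⟩, rfl⟩
    · exact fun x hx => Subgroup.mem_sup_right ⟨⟨x, hx⟩, rfl⟩
  rw [relIndex_eq_card_map]
  have : Finite ((gamma G (n + 1)).map (QuotientGroup.mk' (gamma G (n + 2)))) :=
    Finite.of_injective _ (Subgroup.inclusion_injective hle)
  exact Nat.card_pos.ne'

theorem finite_factor_gamma {n : ℕ} (hn : 3 ≤ n) :
    Finite (Factor (gamma G n) (gamma G (n + 1))) := by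
  refine Nat.finite_of_card_ne_zero ?_
  change (gamma G (n + 1)).relIndex (gamma G n) ≠ 0
  induction n, hn using Nat.le_induction with
  | base =>
    obtain ⟨e⟩ := factor_gamma_three
    have h : (gamma G (3 + 1)).relIndex (gamma G 3) = 4 := by
      refine (Nat.card_congr e.toEquiv).trans ?_
      rw [Nat.card_congr Multiplicative.toAdd, Nat.card_zmod]
    rw [h]
    norm_num
  | succ n hn ih => exact relIndex_gamma_succ_ne_zero n (by omega) ih

/-! ### Transfer to subgroups of the automorphism group of the tree -/

theorem map_dbl_gamma_three :
    (dbl (gamma G 3)).map G.subtype =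
      prodSubgroup ((gamma G 3).map G.subtype) ((gamma G 3).map G.subtype) := by
  ext g
  constructor
  · rintro ⟨g, ⟨x, hx, y, hy, w⟩, rfl⟩
    exact ⟨(x, y), ⟨⟨x, hx, rfl⟩, ⟨y, hy, rfl⟩⟩, w.symm⟩
  · rintro ⟨⟨_, _⟩, ⟨⟨x, hx, rfl⟩, ⟨y, hy, rfl⟩⟩, rfl⟩
    obtain ⟨g, -, w⟩ :=
      exists_isPair (gamma_three_le_commutator hx) (gamma_three_le_commutator hy)
    exact ⟨g, ⟨x, hx, y, hy, w⟩, w⟩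

theorem map_derivedSeries_two :
    (derivedSeries G 2).map G.subtype =
      prodSubgroup ((gamma G 3).map G.subtype) ((gamma G 3).map G.subtype) := by
  rw [← map_dbl_gamma_three, ← second_derived, derivedSeries_succ, derivedSeries_one]

theorem coe_gamma_three :
    (((gamma G 3).map G.subtype : Subgroup RAut) : Set RAut) =
      (prodSubgroup ((gamma G 3).map G.subtype) ((gamma G 3).map G.subtype) : Set RAut) *
        (Subgroup.closure {d, e} : Set RAut) := by
  rw [← map_dbl_gamma_three]
  apply Set.Subset.antisymm
  · rintro _ ⟨g, hg, rfl⟩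
    obtain ⟨x, y, w⟩ := exists_coord hg
    have w' := w.mul ((Coord.D.zpow (x + 2 * y)).mul (Coord.E.zpow y)).inv
    rw [show x + -((x + 2 * y) * 1 + y * -2) = 0 by ring,
      show y + -((x + 2 * y) * 0 + y * 1) = 0 by ring] at w'
    obtain ⟨t, ht, h⟩ := w'.exists_eq
    rw [zpow_zero, zpow_zero, one_mul, one_mul] at h
    refine ⟨_, ⟨t, ht, rfl⟩, d ^ (x + 2 * y) * e ^ y, mul_mem
      (zpow_mem (Subgroup.subset_closure (by simp)) _)
      (zpow_mem (Subgroup.subset_closure (by simp)) _), ?_⟩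
    have h' : t * (gD ^ (x + 2 * y) * gE ^ y) = g := by rw [← h]; group
    change G.subtype t * (d ^ (x + 2 * y) * e ^ y) = G.subtype g
    rw [← h', map_mul, map_mul, map_zpow, map_zpow, ← coe_gD, ← coe_gE]
    rfl
  · rintro _ ⟨_, ⟨t, ht, rfl⟩, w, hw, rfl⟩
    have hcl : Subgroup.closure {d, e} ≤ (gamma G 3).map G.subtype := by
      rw [Subgroup.closure_le]
      rintro _ (rfl | rfl)
      · exact ⟨gD, gD_mem, coe_gD⟩
      · exact ⟨gE, gamma_antitone (by norm_num) gE_mem_gamma_four, coe_gE⟩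
    exact mul_mem (Subgroup.mem_map_of_mem _ (dbl_gamma_three_le ht)) (hcl hw)

end Basilica

theorem mainTheorem7 :
    ((derivedSeries Basilica.G 2).map Basilica.G.subtype =
        Basilica.prodSubgroup
          ((Basilica.gamma Basilica.G 3).map Basilica.G.subtype)
          ((Basilica.gamma Basilica.G 3).map Basilica.G.subtype)) ∧
    ((((Basilica.gamma Basilica.G 3).map Basilica.G.subtype : Subgroup Basilica.RAut) :
          Set Basilica.RAut) =
        (Basilica.prodSubgroup
          ((Basilica.gamma Basilica.G 3).map Basilica.G.subtype)
          ((Basilica.gamma Basilica.G 3).map Basilica.G.subtype) : Set Basilica.RAut) *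
        (Subgroup.closure {Basilica.d, Basilica.e} : Set Basilica.RAut)) ∧
    Nonempty (Basilica.Factor (Basilica.gamma Basilica.G 1) (Basilica.gamma Basilica.G 2) ≃*
      Multiplicative (ℤ × ℤ)) ∧
    Nonempty (Basilica.Factor (Basilica.gamma Basilica.G 2) (Basilica.gamma Basilica.G 3) ≃*
      Multiplicative ℤ) ∧
    Nonempty (Basilica.Factor (Basilica.gamma Basilica.G 3) (Basilica.gamma Basilica.G 4) ≃*
      Multiplicative (ZMod 4)) ∧
    (∀ n : ℕ, 3 ≤ n → Finite
      (Basilica.Factor (Basilica.gamma Basilica.G n) (Basilica.gamma Basilica.G (n + 1)))) ∧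
    (∀ i : ℕ, Nonempty
      (Basilica.Factor (Basilica.twoCentral Basilica.G (2 ^ i))
          (Basilica.twoCentral Basilica.G (2 ^ i + 1)) ≃*
        Multiplicative (Fin (i + 2) → ZMod 2))) ∧
    (∀ n : ℕ, 1 ≤ n → (∀ i : ℕ, n ≠ 2 ^ i) →
      ∃ r : ℕ, IsGreatest {m : ℕ | ∃ i : ℕ, m = i + 1 ∧ 2 ^ i ∣ n} r ∧
        Nonempty
          (Basilica.Factor (Basilica.twoCentral Basilica.G n)
              (Basilica.twoCentral Basilica.G (n + 1)) ≃*
            Multiplicative (Fin r → ZMod 2))) := by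
  refine ⟨Basilica.map_derivedSeries_two, Basilica.coe_gamma_three, Basilica.factor_gamma_one,
    Basilica.factor_gamma_two, Basilica.factor_gamma_three,
    fun n hn => Basilica.finite_factor_gamma hn, fun i => ?_,
    fun n hn h => ⟨_, Basilica.isGreatest_rank n hn h, Basilica.factor_twoCentral hn⟩⟩
  have := Basilica.factor_twoCentral (Nat.one_le_two_pow (n := i))
  rwa [Basilica.rank_two_pow] at this
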